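/- **Setting.** For $n=1,2,\dots$ let $G$ be a simple graph on $N_v=N_v(n)$ vertices with adjacency matrix $A$ and degrees $d_i$; all quantities below depend on $n$, and all limits and asymptotic symbols refer to $n\to\infty$, with $N_v\to\infty$. The treatment indicators $Z_i$ are Bernoulli($p$). The observed simple graph with adjacency matrix $\tilde A$ satisfies $\mathbb P(\tilde A_{ij}=1)=\alpha$ if $\{i,j\}$ is not an edge of $G$ and $\mathbb P(\tilde A_{ij}=0)=\beta$ if it is an edge; all $Z_i$ and all $\tilde A_{ij}$ ($i<j$) are mutually independent. Vertex $i$ has exposure level $f(Z,A_{\cdot i})\in\{c_{11},c_{10},c_{01},c_{00}\}$, where the first index is $Z_i$ and the second is $1$ if $i$ has a treated neighbour and $0$ otherwise. The potential outcomes $y_i(c_k)$ are deterministic, the outcome $y_i(f(Z,A_{\cdot i}))$ is observed, and $\overline y(c_k)=N_v^{-1}\sum_i y_i(c_k)$. **Estimator.** Let $\tilde{\boldsymbol y}_i$ be the vector with entries $1\{f(Z,\tilde A_{\cdot i})=c_k\}\,y_i(f(Z,A_{\cdot i}))$, let $\tilde p_i^e(c_k)=\sum_{z}p_z1\{f(z,\tilde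 A_{\cdot i})=c_k\}$ with $p_z$ the probability of the assignment $z$, and let $\tilde y_{\mathrm{A\&S},i}(c_k)=1\{\tilde p^e_i(c_k)>0\}\,\tilde{\boldsymbol y}_i(c_k)/\tilde p_i^e(c_k)$. Let $P(d,\alpha,\beta)$ be the matrix of the probabilities $\mathbb P(f(Z,\tilde A_{\cdot i})=c_k,\ f(Z,A_{\cdot i})=c_l)$ of a vertex of degree $d$, extended to real $d$: with $a=(1-p)^d$, $b=(1-(1-\beta)p)^d$, $g=(1-\alpha p)^{N_v-1-d}$ it is block diagonal with blocks $$p\begin{pmatrix}1-a-gb+ga & a(1-g)\\ g(b-a)& ga\end{pmatrix},\qquad (1-p)\begin{pmatrix}1-a-gb+ga & a(1-g)\\ g(b-a)& ga\end{pmatrix}$$ for $(c_{11},c_{10})$ and $(c_{01},c_{00})$. Given random variables $\hat\alpha,\hat\beta$, put $\hat d_i=\dfrac{\tilde d_i-(N_v-1)\hat\alpha}{1-\hat\alpha-\hat\beta}$, where $\tilde d_i$ is the observed degree, $\tilde{\boldsymbol y}_{\mathrm{MME},i}=P^{-1}(\hat d_i,\hat\alpha,\hat\beta)\,\tilde{\boldsymbol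 y}_i$, and $$\tilde{\overline{\boldsymbol y}}_{\mathrm{MME}}=\frac1{N_v}\sum_{i}\Big\{\tilde{\boldsymbol y}_{\mathrm{MME},i}\,1\{C_1\le\hat d_i<C_2\}+\tilde{\boldsymbol y}_{\mathrm{A\&S},i}\,1\{\hat d_i<C_1\text{ or }\hat d_i\ge C_2\}\Big\},$$ with cutoffs $C_1=o(1/p)$, $C_2=\omega(1/p)$ that separate the vertices with $\hat d_i=\Theta(1/p)$ from those with $\hat d_i=o(1/p)$ or $\omega(1/p)$. **Theorem.** Assume: * (inhomogeneous setting) the degree distribution of $G$ is the Pareto law with exponential cutoff with rate $\lambda$, fixed shape $\zeta>0$, lower bound $0<d_L<N_v-1$ and upper bound $N_v-1$, i.e. with density proportional to $e^{-\lambda x}x^{-(\zeta+1)}$ on $[d_L,N_v-1]$, in the sense that its distribution function and that of the empirical distribution of the degrees $d_i$ differ by $o(1)$ uniformly; $\bar d$ denotes the mean of this law; $\lambda=\Theta(p)$ and $\lambda>p$; * $p=o(1)$, $p=\omega(1/N_v)$, $\bar d=\Theta(1/p)$; the number of ordered pairs of distinct vertices without a common neighbour in $G$ is $\sim N_v^2$;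 $|y_i(c_k)|\le c$ for a constant $c$; * $1-\beta=\Omega(1)$, $\alpha=\Theta(1/(pN_v))$, $\alpha=o(p)$; * $\hat\alpha,\hat\beta$ are consistent: $\hat\alpha/\alpha\to1$ and $\hat\beta-\beta\to0$ in probability. (They may depend arbitrarily on the other random variables; known values $\hat\alpha=\alpha$, $\hat\beta=\beta$ are allowed.) Then there are $L_1>0$, $L_2$ with $L_1=o(1/p)$, $L_2=\omega(1/p)$ such that for all cutoffs $C_1\ge L_1$, $C_1=o(1/p)$ and $0<C_2\le L_2$, $C_2=\omega(1/p)$, and for every level $c_k$, the estimator $\tilde{\overline y}_{\mathrm{MME}}(c_k)$ is consistent for $\overline y(c_k)$, i.e. $\tilde{\overline y}_{\mathrm{MME}}(c_k)-\overline y(c_k)\to0$ in probability. It is also asymptotically unbiased, i.e. eventually integrable with $\mathbb E[\tilde{\overline y}_{\mathrm{MME}}(c_k)]-\overline y(c_k)\to0$, provided the estimates are admissible error rates: for some constant $b'>0$, eventually $0\le\hat\alpha\le1$ and $0\le\hat\beta\le1-b'$ almost surely (automatic when $\alpha,\beta$ are known). -/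

import Mathlib

open MeasureTheory ProbabilityTheory Filter Asymptotics
open scoped Topology

/-- The four exposure levels; the first index records direct treatment, the second one
records whether some neighbour is treated. -/
inductive ExposureLevel : Type
  | c11 | c10 | c01 | c00
  deriving DecidableEq

instance : Fintype ExposureLevel where
  elems := {ExposureLevel.c11, ExposureLevel.c10, ExposureLevel.c01, ExposureLevel.c00}
  complete := by intro k; cases k <;> decide

noncomputable section

open Classical in
/-- The four-level exposure mapping `f(z, A_{·i})`. A treatment assignment is given by the finite
set `z` of treated vertices, and `#{j ∈ z | j ~ i}` is the number of treated neighbours of `i`. -/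
def exposure {V : Type*} (G : SimpleGraph V) (z : Finset V) (i : V) : ExposureLevel :=
  if i ∈ z then
    if 0 < (z.filter fun j => G.Adj j i).card then ExposureLevel.c11 else ExposureLevel.c10
  else
    if 0 < (z.filter fun j => G.Adj j i).card then ExposureLevel.c01 else ExposureLevel.c00

/-- The probability `p_z` of the treatment assignment `z` under Bernoulli(`p`) assignment. -/
def assignmentProb {V : Type*} [Fintype V] (p : ℝ) (z : Finset V) : ℝ :=
  p ^ z.card * (1 - p) ^ (Fintype.card V - z.card)

/-- The exposure probability `p_i^e(c_k) = ∑_z p_z 1{f(z, x_i) = c_k}` in the graph `H`. -/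
def exposureProb {V : Type*} [Fintype V] (p : ℝ) (H : SimpleGraph V) (i : V)
    (k : ExposureLevel) : ℝ :=
  ∑ z : Finset V, assignmentProb p z * if exposure H z i = k then 1 else 0

/-- The degree of the vertex `i`. -/
def vertexDegree {V : Type*} [Fintype V] (G : SimpleGraph V) (i : V) : ℕ :=
  Nat.card (G.neighborSet i)

/-- The vector `ỹ_i = 1(X̃_i) · (1(x_i)ᵀ y_i)`: observed outcome times observed exposure level.
Here `G` is the true graph, `H` the observed graph, `z` the set of treated vertices. -/
def observedVector {V : Type*} (G H : SimpleGraph V) (z : Finset V) (y : V → ExposureLevel → ℝ)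
    (i : V) (k : ExposureLevel) : ℝ :=
  (if exposure H z i = k then 1 else 0) *
    ∑ l : ExposureLevel, y i l * if exposure G z i = l then 1 else 0

/-- The Aronow–Samii estimator `ỹ_{A&S,i}(c_k)` of vertex `i` in the noisy network. -/
def aronowSamiiNode {V : Type*} [Fintype V] (p : ℝ) (G H : SimpleGraph V) (z : Finset V)
    (y : V → ExposureLevel → ℝ) (i : V) (k : ExposureLevel) : ℝ :=
  (if 0 < exposureProb p H i k then 1 else 0) * (1 / exposureProb p H i k) *
    observedVector G H z y i k

/-- The expected confusion matrix `P(d, α, β)` of observed (rows) versus true (columns) exposure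
levels of a vertex of degree `d` in a graph with `N` vertices, under Bernoulli(`p`) treatment and
independent edge noise with error rates `α`, `β`. With
`a = (1-p)^d` (no treated true neighbour),
`b = (1-(1-β)p)^d` (no treated true neighbour whose edge is observed) and
`g = (1-αp)^(N-1-d)` (no treated non-neighbour to which an edge is observed),
`P(no true exposure and no observed exposure) = g a`,
`P(no observed exposure) = g b`, `P(no true exposure) = a`.
The exponents are real, since the matrix is evaluated at an estimated degree. -/
def confusionMatrix (N : ℕ) (p d α β : ℝ) : Matrix ExposureLevel ExposureLevel ℝ :=
  let a : ℝ := (1 - p) ^ d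
  let b : ℝ := (1 - (1 - β) * p) ^ d
  let g : ℝ := (1 - α * p) ^ ((N : ℝ) - 1 - d)
  Matrix.of fun k l =>
    match k, l with
    | .c11, .c11 => p * (1 - a - g * b + g * a)
    | .c11, .c10 => p * (a * (1 - g))
    | .c10, .c11 => p * (g * (b - a))
    | .c10, .c10 => p * (g * a)
    | .c01, .c01 => (1 - p) * (1 - a - g * b + g * a)
    | .c01, .c00 => (1 - p) * (a * (1 - g))
    | .c00, .c01 => (1 - p) * (g * (b - a))
    | .c00, .c00 => (1 - p) * (g * a)
    | _, _ => 0

/-- The degree estimator `d̂_i = (d̃_i - (N_v - 1) α̂) / (1 - α̂ - β̂)`, `d̃_i` being the degree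
of `i` in the observed graph `H`. -/
def estimatedDegree {V : Type*} [Fintype V] (H : SimpleGraph V) (αh βh : ℝ) (i : V) : ℝ :=
  ((vertexDegree H i : ℝ) - ((Fintype.card V : ℝ) - 1) * αh) / (1 - αh - βh)

/-- The method-of-moments estimator `P⁻¹(d̂_i, α̂, β̂) ỹ_i` of vertex `i`. -/
def mmeNode {V : Type*} [Fintype V] (p : ℝ) (G H : SimpleGraph V) (z : Finset V)
    (y : V → ExposureLevel → ℝ) (αh βh : ℝ) (i : V) : ExposureLevel → ℝ :=
  Matrix.mulVec (confusionMatrix (Fintype.card V) p (estimatedDegree H αh βh i) αh βh)⁻¹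
    (observedVector G H z y i)

open Classical in
/-- The method-of-moments estimator of the population mean: vertices with `C₁ ≤ d̂_i < C₂`
contribute the method-of-moments estimator, all others the Aronow–Samii estimator. -/
def mmeEstimator {V : Type*} [Fintype V] (p : ℝ) (G H : SimpleGraph V) (z : Finset V)
    (y : V → ExposureLevel → ℝ) (αh βh C₁ C₂ : ℝ) (k : ExposureLevel) : ℝ :=
  (1 / (Fintype.card V : ℝ)) * ∑ i : V,
    if C₁ ≤ estimatedDegree H αh βh i ∧ estimatedDegree H αh βh i < C₂ then
      mmeNode p G H z y αh βh i k
    else aronowSamiiNode p G H z y i k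

/-- The average potential outcome `ȳ(c_k)`. -/
def meanOutcome {V : Type*} [Fintype V] (y : V → ExposureLevel → ℝ) (k : ExposureLevel) : ℝ :=
  (1 / (Fintype.card V : ℝ)) * ∑ i : V, y i k

/-- The unnormalised density of the Pareto law with exponential cutoff. -/
def paretoCutoffWeight (lam ζ x : ℝ) : ℝ :=
  Real.exp (-(lam * x)) * x ^ (-(ζ + 1))

/-- The mean of the Pareto law with exponential cutoff of rate `lam`, shape `ζ`, lower bound `lo`
and upper bound `hi`. -/
def paretoCutoffMean (lam ζ lo hi : ℝ) : ℝ :=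
  (∫ x in lo..hi, x * paretoCutoffWeight lam ζ x) / ∫ x in lo..hi, paretoCutoffWeight lam ζ x

/-- The distribution function of the Pareto law with exponential cutoff. -/
def paretoCutoffCDF (lam ζ lo hi x : ℝ) : ℝ :=
  (∫ t in lo..(max lo (min x hi)), paretoCutoffWeight lam ζ t) /
    ∫ t in lo..hi, paretoCutoffWeight lam ζ t

/-- The distribution function of the degrees over the whole network: the fraction of vertices
of degree at most `x`. -/
def degreeCDF {V : Type*} [Fintype V] (G : SimpleGraph V) (x : ℝ) : ℝ :=
  (Nat.card {i : V // (vertexDegree G i : ℝ) ≤ x} : ℝ) / Fintype.card V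

/-- The inhomogeneous network setting for a sequence of graphs `G n` on `Nv n` vertices: the degree
distribution is the Pareto law with exponential cutoff with rate `lam n`, fixed shape `ζ > 0`, lower
bound `dL n` and upper bound `Nv n - 1`. As that law is continuous and degrees of finite graphs are
integers, the two distribution functions agree up to an error that vanishes uniformly. -/
structure IsInhomogeneous (Nv : ℕ → ℕ) (G : ∀ n, SimpleGraph (Fin (Nv n)))
    (lam dL : ℕ → ℝ) (ζ : ℝ) : Prop where
  shape_pos : 0 < ζ
  lower_pos : ∀ᶠ n in atTop, 0 < dL n
  lower_lt : ∀ᶠ n in atTop, dL n < (Nv n : ℝ) - 1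
  degree_law : ∀ ε : ℝ, 0 < ε → ∀ᶠ n in atTop, ∀ x : ℝ,
    |degreeCDF (G n) x - paretoCutoffCDF (lam n) ζ (dL n) ((Nv n : ℝ) - 1) x| ≤ ε

/-- The number of ordered pairs of distinct vertices without a common neighbour. -/
def pairsWithoutCommonNeighbor {V : Type*} (G : SimpleGraph V) : ℕ :=
  Nat.card {q : V × V // q.1 ≠ q.2 ∧ G.commonNeighbors q.1 q.2 = ∅}

/-- `Z` (the random set of treated vertices) and `H` (the random observed graph) follow a
Bernoulli(`p`) treatment assignment and the noise model with constant error rates: non-edges of `G`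
are observed as edges with probability `α`, edges of `G` as non-edges with probability `β`, and all
treatment indicators and all observed edge indicators are mutually independent. -/
structure IsNoisyExperiment {Ω : Type*} [MeasurableSpace Ω] (μ : Measure Ω) {V : Type*}
    (G : SimpleGraph V) (p α β : ℝ) (Z : Ω → Finset V) (H : Ω → SimpleGraph V) : Prop where
  measurable_treat : ∀ i, MeasurableSet {ω | i ∈ Z ω}
  measurable_edge : ∀ i j, MeasurableSet {ω | (H ω).Adj i j}
  prob_treat : ∀ i, μ.real {ω | i ∈ Z ω} = p
  prob_nonedge : ∀ i j, i ≠ j → ¬ G.Adj i j → μ.real {ω | (H ω).Adj i j} = α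
  prob_edge : ∀ i j, G.Adj i j → μ.real {ω | ¬ (H ω).Adj i j} = β
  indep : iIndepSet
    (Sum.elim (fun i : V => {ω | i ∈ Z ω})
      (fun e : {e : Sym2 V // ¬ e.IsDiag} => {ω | (e : Sym2 V) ∈ (H ω).edgeSet})) μ

/-- `X n` is consistent for the real numbers `θ n`: `X n - θ n → 0` in probability. -/
def IsConsistent {Ω : ℕ → Type*} [∀ n, MeasurableSpace (Ω n)] (μ : ∀ n, Measure (Ω n))
    (X : ∀ n, Ω n → ℝ) (θ : ℕ → ℝ) : Prop :=
  ∀ ε : ℝ, 0 < ε → Tendsto (fun n => (μ n).real {ω | ε ≤ |X n ω - θ n|}) atTop (𝓝 0)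

/-- `X n` is asymptotically unbiased for `θ n`: eventually the expectation of `X n` exists, and the
bias tends to `0`. -/
def IsAsymptoticallyUnbiased {Ω : ℕ → Type*} [∀ n, MeasurableSpace (Ω n)]
    (μ : ∀ n, Measure (Ω n)) (X : ∀ n, Ω n → ℝ) (θ : ℕ → ℝ) : Prop :=
  (∀ᶠ n in atTop, Integrable (X n) (μ n)) ∧
    Tendsto (fun n => (∫ ω, X n ω ∂(μ n)) - θ n) atTop (𝓝 0)

end

/-!
The observed exposure vector of a vertex is a mixture of its potential outcomes whose mixing matrix
is the confusion matrix at its true degree and the true error rates. Multiplying by the inverse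
matrix at the true parameters therefore gives an unbiased estimator, `idealNode`
(`IsNoisyExperiment.integral_idealNode`). The proof compares the actual estimator with the average
of the ideal ones over the vertices of typical degree, `2 w ≤ p d ≤ X - 1` with `X = p C₂`, and
bounds everything else by inverse probability weights.

*Ideal estimators.* Two vertices that are neither adjacent nor share a neighbour have nearly
independent exposures: only the noisy edge between them and vertices falsely observed as neighbours
of one or both couple them, which costs `pairError`. All other pairs are few by the assumption on
common neighbours, so that the average of the ideal estimators has vanishing variance
(`IsNoisyExperiment.integral_sum_idealNode_sub_sq_le`).

*Estimated parameters.* By Chebyshev's inequality the observed degree of a vertex deviates from its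
mean by more than a small multiple of `1 / p` only with small probability. When the rates are
estimated well, the estimated degree is then close to the true one on the scale `1 / p`, and the
entries of the inverse matrix are Lipschitz on that scale (`abs_mmeCoeff_sub_le`).

*Exceptional vertices.* Treatment is independent of the observed network, so the Aronow-Samii
weights of a vertex sum to `totalWeight`, whose integral over an event `E` that is determined by the
observed network is at most `4 P(E)` (`IsNoisyExperiment.integral_totalWeight_mul_le`). The
method-of-moments estimator of a vertex is dominated by `totalWeight` times a factor of order `exp (p C₂)` on good
events, and `exp (2 p C₂)` times the reciprocal of the lower cutoff in general
(`Admissible.abs_mmeNode_le`). The Pareto law with `lam > p` and mean of order `1 / p` has its lower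
bound at the order `1 / p`, so small degrees are rare, and the fraction of vertices with `p d > m`
is `O(exp (-m) / m)` (`eventually_degree_fractions`). At `m = X - 1` the tail cancels the
factor `exp X` and leaves `1 / (X - 1)`, up to constants; at `m = R`, where `X ≤ R / 8`, the tail
beats the general factor.

*Choice of the cutoffs.* All errors that vanish by assumption are made smaller than `exp (-R ^ 2)`
along truncation levels `R` tending to infinity slowly enough (`exists_regime`), and `1 / (R p)` and
`R / (8 p)` serve as the bounds for the cutoffs. All error bounds then vanish (`tendsto_biasBound`).

*Bias.* If the estimates of the rates are poor but admissible, the estimator is still bounded by the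
total weights. These are uniformly integrable on average, because at typical vertices they are at
most a power of `exp R` times `1{Z_i = t} / P(Z_i = t)`, whose average has a bounded second moment
(`Regime.integral_bad_totalWeight_le`).
-/

set_option linter.unusedSectionVars false
set_option linter.unnecessarySeqFocus false

/-! ### Exposure levels, exposure probabilities, and the inverse confusion matrix -/

/-- The real-valued indicator of a proposition. -/
noncomputable def ind (P : Prop) : ℝ := by
  classical exact if P then 1 else 0

lemma ind_of {P : Prop} (h : P) : ind P = 1 := by simp [ind, h]

lemma ind_of_not {P : Prop} (h : ¬ P) : ind P = 0 := by simp [ind, h]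

lemma ind_nonneg (P : Prop) : 0 ≤ ind P := by
  by_cases h : P <;> simp [ind, h]

lemma ind_le_one (P : Prop) : ind P ≤ 1 := by
  by_cases h : P <;> simp [ind, h]

lemma ind_and (P Q : Prop) : ind (P ∧ Q) = ind P * ind Q := by
  by_cases h : P <;> by_cases h' : Q <;> simp [ind, h, h']

lemma ind_not (P : Prop) : ind (¬ P) = 1 - ind P := by
  by_cases h : P <;> simp [ind, h]

lemma ind_mono {P Q : Prop} (h : P → Q) : ind P ≤ ind Q := by
  by_cases hP : P
  · rw [ind_of hP, ind_of (h hP)]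
  · rw [ind_of_not hP]; exact ind_nonneg Q

lemma ite_eq_ind (P : Prop) [Decidable P] : (if P then (1 : ℝ) else 0) = ind P := by
  by_cases h : P <;> simp [ind, h]

/-- The exposure level with treatment status `t` and neighbourhood exposure `s`. -/
def level : Bool → Bool → ExposureLevel
  | true, true => .c11
  | true, false => .c10
  | false, true => .c01
  | false, false => .c00

lemma exists_level (k : ExposureLevel) : ∃ t s, k = level t s := by
  cases k
  exacts [⟨true, true, rfl⟩, ⟨true, false, rfl⟩, ⟨false, true, rfl⟩, ⟨false, false, rfl⟩]

lemma sum_exposureLevel {M : Type*} [AddCommMonoid M] (f : ExposureLevel → M) :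
    ∑ k, f k = f .c11 + (f .c10 + (f .c01 + f .c00)) := by
  have : (Finset.univ : Finset ExposureLevel) =
    {ExposureLevel.c11, ExposureLevel.c10, ExposureLevel.c01, ExposureLevel.c00} := rfl
  rw [this, Finset.sum_insert (by decide), Finset.sum_insert (by decide),
    Finset.sum_insert (by decide), Finset.sum_singleton]

/-- Some neighbour of `i` in `H` is treated. -/
def Exposed {V : Type*} (H : SimpleGraph V) (z : Finset V) (i : V) : Prop :=
  ∃ h ∈ z, H.Adj h i

lemma exposure_eq_level_iff {V : Type*} (H : SimpleGraph V) (z : Finset V) (i : V) (t s : Bool) :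
    exposure H z i = level t s ↔ ((i ∈ z ↔ t = true) ∧ (Exposed H z i ↔ s = true)) := by
  classical
  have hE : (0 < (z.filter fun j => H.Adj j i).card) ↔ Exposed H z i := by
    rw [Finset.card_pos]
    constructor
    · rintro ⟨h, hh⟩
      rw [Finset.mem_filter] at hh
      exact ⟨h, hh.1, hh.2⟩
    · rintro ⟨h, hh, hh'⟩
      exact ⟨h, Finset.mem_filter.2 ⟨hh, hh'⟩⟩
  have hx : exposure H z i = level (decide (i ∈ z)) (decide (Exposed H z i)) := by
    unfold exposure
    by_cases h1 : i ∈ z <;> by_cases h2 : Exposed H z i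
    · rw [if_pos h1, if_pos (by convert hE.2 h2)]; simp only [h1, h2, decide_true, level]
    · rw [if_pos h1, if_neg (by convert mt hE.1 h2)]
      simp only [h1, h2, decide_true, decide_false, level]
    · rw [if_neg h1, if_pos (by convert hE.2 h2)]
      simp only [h1, h2, decide_true, decide_false, level]
    · rw [if_neg h1, if_neg (by convert mt hE.1 h2)]; simp only [h1, h2, decide_false, level]
  rw [hx]
  by_cases h1 : i ∈ z <;> by_cases h2 : Exposed H z i <;> cases t <;> cases s <;>
    simp only [h1, h2] <;> simp [level]

/-- The probability of treatment status `t`. -/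
def treatProb (p : ℝ) : Bool → ℝ
  | true => p
  | false => 1 - p

lemma observedVector_eq {V : Type*} (G H : SimpleGraph V) (z : Finset V)
    (y : V → ExposureLevel → ℝ) (i : V) (k : ExposureLevel) :
    observedVector G H z y i k = ind (exposure H z i = k) * y i (exposure G z i) := by
  unfold observedVector
  rw [ite_eq_ind]
  congr 1
  simp

lemma assignmentProb_eq_prod {V : Type*} [Fintype V] (p : ℝ) (z : Finset V) :
    assignmentProb p z = ∏ h, (ind (h ∈ z) * p + ind (h ∉ z) * (1 - p)) := by
  classical
  have h1 : ∀ h, (ind (h ∈ z) * p + ind (h ∉ z) * (1 - p)) = if h ∈ z then p else 1 - p := by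
    intro h
    by_cases hz : h ∈ z <;> simp [ind, hz]
  simp only [h1]
  rw [Finset.prod_ite]
  simp only [Finset.prod_const, assignmentProb]
  congr 2
  · congr 1; ext; simp
  · rw [Finset.filter_not, Finset.card_sdiff]
    simp

/-- The expectation of a product over the vertices under Bernoulli assignment factorises. -/
lemma sum_assignmentProb_mul_prod {V : Type*} [Fintype V] (p : ℝ) (φ : V → Prop → ℝ) :
    ∑ z : Finset V, assignmentProb p z * ∏ h, φ h (h ∈ z) =
      ∏ h, (p * φ h True + (1 - p) * φ h False) := by
  classical
  rw [Finset.prod_add, Finset.powerset_univ]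
  refine Finset.sum_congr rfl fun z _ => ?_
  rw [assignmentProb_eq_prod, ← Finset.prod_mul_distrib,
    ← Finset.prod_mul_prod_compl z, Finset.compl_eq_univ_sdiff]
  congr 1
  · refine Finset.prod_congr rfl fun h hh => ?_
    simp [ind, hh]
  · refine Finset.prod_congr rfl fun h hh => ?_
    have : h ∉ z := (Finset.mem_sdiff.1 hh).2
    simp [ind, this]

lemma vertexDegree_eq_card {V : Type*} [Fintype V] (H : SimpleGraph V) (i : V)
    [DecidablePred fun h => H.Adj h i] :
    vertexDegree H i = (Finset.univ.filter fun h => H.Adj h i).card := by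
  classical
  unfold vertexDegree
  rw [Nat.card_eq_fintype_card, ← Set.toFinset_card]
  congr 1
  ext h
  simp [SimpleGraph.adj_comm]

lemma vertexDegree_le {V : Type*} [Fintype V] (H : SimpleGraph V) (i : V) :
    (vertexDegree H i : ℝ) ≤ (Fintype.card V : ℝ) - 1 := by
  classical
  rw [vertexDegree_eq_card]
  have : (Finset.univ.filter fun h => H.Adj h i) ⊆ Finset.univ.erase i := by
    intro h hh
    have := (Finset.mem_filter.1 hh).2
    simp [this.ne]
  have h2 := Finset.card_le_card this
  rw [Finset.card_erase_of_mem (Finset.mem_univ _), Finset.card_univ] at h2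
  have h3 : 1 ≤ Fintype.card V := Fintype.card_pos_iff.2 ⟨i⟩
  have h4 : ((Finset.univ.filter fun h => H.Adj h i).card : ℝ) ≤ ((Fintype.card V - 1 : ℕ) : ℝ) :=
    by exact_mod_cast h2
  rwa [Nat.cast_sub h3, Nat.cast_one] at h4

lemma prod_adj_eq_pow {V : Type*} [Fintype V] (H : SimpleGraph V) (i : V) (x : ℝ) :
    ∏ h, (ind (H.Adj h i) * x + ind (¬ H.Adj h i)) = x ^ vertexDegree H i := by
  classical
  have h1 : ∀ h, (ind (H.Adj h i) * x + ind (¬ H.Adj h i)) = if H.Adj h i then x else 1 := by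
    intro h
    by_cases hz : H.Adj h i <;> simp [ind, hz]
  simp only [h1]
  rw [Finset.prod_ite, vertexDegree_eq_card]
  simp

lemma ind_not_exposed {V : Type*} [Fintype V] (H : SimpleGraph V) (z : Finset V) (i : V) :
    ind (¬ Exposed H z i) = ∏ h, ind (h ∈ z → ¬ H.Adj h i) := by
  classical
  by_cases h : Exposed H z i
  · rw [ind_of_not (not_not.2 h)]
    obtain ⟨h, h1, h2⟩ := h
    rw [Finset.prod_eq_zero (Finset.mem_univ h)]
    exact ind_of_not (fun h3 => h3 h1 h2)
  · rw [ind_of h, Finset.prod_eq_one]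
    intro j _
    exact ind_of (fun h1 h2 => h ⟨j, h1, h2⟩)

lemma sum_assignmentProb_treat {V : Type*} [Fintype V] (p : ℝ) (i : V) (t : Bool) :
    ∑ z : Finset V, assignmentProb p z * ind (i ∈ z ↔ t = true) = treatProb p t := by
  classical
  have key := sum_assignmentProb_mul_prod (V := V) p
    (fun h P => if h = i then ind (P ↔ t = true) else 1)
  have h1 : ∀ z : Finset V, ∏ h, (if h = i then ind (h ∈ z ↔ t = true) else 1)
      = ind (i ∈ z ↔ t = true) := by
    intro z
    rw [Finset.prod_ite_eq' Finset.univ i]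
    simp
  simp only [h1] at key
  rw [key, Finset.prod_eq_single i]
  · cases t <;> simp [ind, treatProb]
  · intro j _ hj
    simp [hj]
  · simp

lemma exposureProb_level_false {V : Type*} [Fintype V] (p : ℝ) (H : SimpleGraph V) (i : V)
    (t : Bool) :
    exposureProb p H i (level t false) = treatProb p t * (1 - p) ^ vertexDegree H i := by
  classical
  have key := sum_assignmentProb_mul_prod (V := V) p
    (fun h P => (if h = i then ind (P ↔ t = true) else 1) * ind (P → ¬ H.Adj h i))
  have h1 : ∀ z : Finset V, ∏ h, ((if h = i then ind (h ∈ z ↔ t = true) else 1) *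
      ind (h ∈ z → ¬ H.Adj h i)) = (if exposure H z i = level t false then 1 else 0) := by
    intro z
    rw [Finset.prod_mul_distrib, ← ind_not_exposed, Finset.prod_ite_eq' Finset.univ i, ite_eq_ind]
    simp only [Finset.mem_univ, if_true]
    rw [← ind_and]
    congr 1
    rw [exposure_eq_level_iff]
    simp
  simp only [h1] at key
  unfold exposureProb
  rw [key]
  have h2 : ∀ h, p * ((if h = i then ind (True ↔ t = true) else 1) * ind (True → ¬ H.Adj h i)) +
      (1 - p) * ((if h = i then ind (False ↔ t = true) else 1) * ind (False → ¬ H.Adj h i)) =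
      (if h = i then treatProb p t else 1) * (ind (H.Adj h i) * (1 - p) + ind (¬ H.Adj h i)) := by
    intro h
    by_cases hi : h = i
    · subst hi
      cases t <;> simp [ind, treatProb]
    · by_cases hA : H.Adj h i <;> simp [ind, hi, hA]
  simp only [h2]
  rw [Finset.prod_mul_distrib, prod_adj_eq_pow, Finset.prod_ite_eq' Finset.univ i]
  simp

lemma exposureProb_level_true {V : Type*} [Fintype V] (p : ℝ) (H : SimpleGraph V) (i : V)
    (t : Bool) :
    exposureProb p H i (level t true) = treatProb p t * (1 - (1 - p) ^ vertexDegree H i) := by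
  have h : exposureProb p H i (level t true) + exposureProb p H i (level t false) =
      treatProb p t := by
    rw [← sum_assignmentProb_treat p i t]
    unfold exposureProb
    rw [← Finset.sum_add_distrib]
    refine Finset.sum_congr rfl fun z _ => ?_
    rw [← mul_add, ite_eq_ind, ite_eq_ind, exposure_eq_level_iff, exposure_eq_level_iff]
    congr 1
    by_cases h1 : (i ∈ z ↔ t = true) <;> by_cases h2 : Exposed H z i <;> simp [ind, h1, h2]
  rw [exposureProb_level_false] at h
  linarith

/-- The entries of the inverse of a block of the confusion matrix, up to the factor
`1 / treatProb p t`, in terms of `u = 1 / g`, `v = 1 / a` and `b`. -/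
noncomputable def invCoeff (u v b : ℝ) : Bool → Bool → ℝ
  | true, true => 1 / (1 - b)
  | true, false => (1 - u) / (1 - b)
  | false, true => (1 - b * v) / (1 - b)
  | false, false => (u * v - u - b * v + 1) / (1 - b)

/-- The reciprocal `1 / g` of the probability that no treated non-neighbour is observed as a
neighbour. -/
noncomputable def invNoiseProb (N : ℕ) (p d α : ℝ) : ℝ := ((1 - α * p) ^ ((N : ℝ) - 1 - d))⁻¹

/-- The reciprocal `1 / a` of the probability that no neighbour is treated. -/
noncomputable def invUntreatedProb (p d : ℝ) : ℝ := ((1 - p) ^ d)⁻¹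

/-- The probability `b` that no neighbour is both treated and observed. -/
noncomputable def noHitProb (p d β : ℝ) : ℝ := (1 - (1 - β) * p) ^ d

/-- The entries of the inverse of a block of the confusion matrix, up to `1 / treatProb p t`. -/
noncomputable def mmeCoeff (N : ℕ) (p d α β : ℝ) (s s' : Bool) : ℝ :=
  invCoeff (invNoiseProb N p d α) (invUntreatedProb p d) (noHitProb p d β) s s'

lemma confusionMatrix_inv_mulVec {N : ℕ} {p d α β : ℝ} (hp : p ≠ 0) (hp1 : 1 - p ≠ 0)
    (ha : (1 - p) ^ d ≠ 0) (hg : (1 - α * p) ^ ((N : ℝ) - 1 - d) ≠ 0)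
    (hb : 1 - noHitProb p d β ≠ 0) (w : ExposureLevel → ℝ) (t s : Bool) :
    Matrix.mulVec (confusionMatrix N p d α β)⁻¹ w (level t s) =
      (1 / treatProb p t) * ∑ s' : Bool, mmeCoeff N p d α β s s' * w (level t s') := by
  set Q : Matrix ExposureLevel ExposureLevel ℝ := Matrix.of fun k l =>
    match k, l with
    | .c11, .c11 => (1 / p) * mmeCoeff N p d α β true true
    | .c11, .c10 => (1 / p) * mmeCoeff N p d α β true false
    | .c10, .c11 => (1 / p) * mmeCoeff N p d α β false true
    | .c10, .c10 => (1 / p) * mmeCoeff N p d α β false false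
    | .c01, .c01 => (1 / (1 - p)) * mmeCoeff N p d α β true true
    | .c01, .c00 => (1 / (1 - p)) * mmeCoeff N p d α β true false
    | .c00, .c01 => (1 / (1 - p)) * mmeCoeff N p d α β false true
    | .c00, .c00 => (1 / (1 - p)) * mmeCoeff N p d α β false false
    | _, _ => 0 with hQ
  have hinv : (confusionMatrix N p d α β)⁻¹ = Q := by
    apply Matrix.inv_eq_right_inv
    have hb' : 1 - (1 - (1 - β) * p) ^ d ≠ 0 := hb
    ext k l
    rw [Matrix.mul_apply, sum_exposureLevel]
    cases k <;> cases l <;>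
      simp [hQ, confusionMatrix, mmeCoeff, invCoeff, invNoiseProb,
        invUntreatedProb, noHitProb] <;>
      generalize (1 - p) ^ d = a at * <;>
      generalize (1 - α * p) ^ ((N : ℝ) - 1 - d) = g at * <;>
      generalize (1 - (1 - β) * p) ^ d = b at * <;>
      field_simp <;> ring
  rw [hinv]
  simp only [Matrix.mulVec, dotProduct, Fintype.sum_bool, sum_exposureLevel]
  cases t <;> cases s <;> simp [hQ, level, treatProb] <;> ring

lemma mmeNode_level {V : Type*} [Fintype V] {p : ℝ} {G H : SimpleGraph V} {z : Finset V}
    {y : V → ExposureLevel → ℝ} {αh βh : ℝ} {i : V} (hp : p ≠ 0) (hp1 : 1 - p ≠ 0)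
    (ha : (1 - p) ^ (estimatedDegree H αh βh i) ≠ 0)
    (hg : (1 - αh * p) ^ ((Fintype.card V : ℝ) - 1 - estimatedDegree H αh βh i) ≠ 0)
    (hb : 1 - noHitProb p (estimatedDegree H αh βh i) βh ≠ 0) (t s : Bool) :
    mmeNode p G H z y αh βh i (level t s) = (1 / treatProb p t) * ∑ s' : Bool,
      mmeCoeff (Fintype.card V) p (estimatedDegree H αh βh i) αh βh s s' *
        observedVector G H z y i (level t s') :=
  confusionMatrix_inv_mulVec hp hp1 ha hg hb _ t s

/-- The inverse probability weight of level `k` in the observed network `H`. -/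
noncomputable def ipw {V : Type*} [Fintype V] (p : ℝ) (H : SimpleGraph V) (z : Finset V) (i : V)
    (k : ExposureLevel) : ℝ :=
  ind (exposure H z i = k) * (ind (0 < exposureProb p H i k) * (1 / exposureProb p H i k))

lemma aronowSamiiNode_eq {V : Type*} [Fintype V] (p : ℝ) (G H : SimpleGraph V) (z : Finset V)
    (y : V → ExposureLevel → ℝ) (i : V) (k : ExposureLevel) :
    aronowSamiiNode p G H z y i k = ipw p H z i k * y i (exposure G z i) := by
  unfold aronowSamiiNode ipw
  rw [observedVector_eq, ite_eq_ind]
  ring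

lemma ipw_nonneg {V : Type*} [Fintype V] (p : ℝ) (H : SimpleGraph V) (z : Finset V) (i : V)
    (k : ExposureLevel) : 0 ≤ ipw p H z i k := by
  unfold ipw
  refine mul_nonneg (ind_nonneg _) ?_
  by_cases h : 0 < exposureProb p H i k
  · exact mul_nonneg (ind_nonneg _) (by positivity)
  · rw [ind_of_not h, zero_mul]

/-- The sum of the inverse probability weights of all levels. -/
noncomputable def totalWeight {V : Type*} [Fintype V] (p : ℝ) (H : SimpleGraph V) (z : Finset V)
    (i : V) : ℝ :=
  ∑ k, ipw p H z i k

lemma ipw_le_totalWeight {V : Type*} [Fintype V] (p : ℝ) (H : SimpleGraph V) (z : Finset V)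
    (i : V) (k : ExposureLevel) : ipw p H z i k ≤ totalWeight p H z i :=
  Finset.single_le_sum (f := fun k => ipw p H z i k) (fun k _ => ipw_nonneg p H z i k)
    (Finset.mem_univ k)

lemma totalWeight_nonneg {V : Type*} [Fintype V] (p : ℝ) (H : SimpleGraph V) (z : Finset V)
    (i : V) : 0 ≤ totalWeight p H z i :=
  Finset.sum_nonneg fun k _ => ipw_nonneg p H z i k

/-! ### Independence of functions of disjoint sets of indicators -/

section Experiment

variable {Ω : Type*} [MeasurableSpace Ω] {μ : Measure Ω} {V : Type*}
  {G : SimpleGraph V} {p α β : ℝ} {Z : Ω → Finset V} {H : Ω → SimpleGraph V}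

/-- The indicators underlying the experiment: vertices index treatments, pairs index edges. -/
abbrev Coord (V : Type*) := V ⊕ {e : Sym2 V // ¬ e.IsDiag}

/-- The event that the indicator with a given index equals one. -/
def coordEvent (Z : Ω → Finset V) (H : Ω → SimpleGraph V) : Coord V → Set Ω :=
  Sum.elim (fun i : V => {ω | i ∈ Z ω})
    (fun e : {e : Sym2 V // ¬ e.IsDiag} => {ω | (e : Sym2 V) ∈ (H ω).edgeSet})

/-- The σ-algebra generated by the indicators with index in `S`. -/
abbrev coordAlg (Z : Ω → Finset V) (H : Ω → SimpleGraph V) (S : Set (Coord V)) : MeasurableSpace Ω :=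
  ⨆ i ∈ S, MeasurableSpace.generateFrom {coordEvent Z H i}

lemma coordAlg_mono {S T : Set (Coord V)} (h : S ⊆ T) : coordAlg Z H S ≤ coordAlg Z H T :=
  biSup_mono h

lemma measurableSet_coordEvent {S : Set (Coord V)} {i : Coord V} (hi : i ∈ S) :
    MeasurableSet[coordAlg Z H S] (coordEvent Z H i) := by
  have h : MeasurableSpace.generateFrom {coordEvent Z H i} ≤ coordAlg Z H S :=
    le_biSup (fun i => MeasurableSpace.generateFrom {coordEvent Z H i}) hi
  exact h _ (MeasurableSpace.measurableSet_generateFrom rfl)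

lemma measurableSet_treat {S : Set (Coord V)} {i : V} (hi : Sum.inl i ∈ S) :
    MeasurableSet[coordAlg Z H S] {ω | i ∈ Z ω} :=
  measurableSet_coordEvent hi

lemma measurableSet_adj {S : Set (Coord V)} {i j : V} (hij : ¬ (s(i, j) : Sym2 V).IsDiag)
    (h : Sum.inr ⟨s(i, j), hij⟩ ∈ S) :
    MeasurableSet[coordAlg Z H S] {ω | (H ω).Adj i j} :=
  measurableSet_coordEvent h

lemma IsNoisyExperiment.measurableSet_coord (hX : IsNoisyExperiment μ G p α β Z H) (i : Coord V) :
    MeasurableSet (coordEvent Z H i) := by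
  rcases i with i | ⟨e, he⟩
  · exact hX.measurable_treat i
  · induction e with
    | _ i j => exact hX.measurable_edge i j

/-- Events that are determined by disjoint sets of indicators are independent. -/
lemma IsNoisyExperiment.real_inter (hX : IsNoisyExperiment μ G p α β Z H)
    {S T : Set (Coord V)} (hST : Disjoint S T) {A B : Set Ω}
    (hA : MeasurableSet[coordAlg Z H S] A) (hB : MeasurableSet[coordAlg Z H T] B) :
    μ.real (A ∩ B) = μ.real A * μ.real B := by
  have h1 : iIndep (fun i => MeasurableSpace.generateFrom {coordEvent Z H i}) μ :=
    (iIndepSet_iff_iIndep _ _).1 hX.indep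
  have h2 := indep_iSup_of_disjoint (fun i => MeasurableSpace.generateFrom_le (by
    rintro _ rfl
    exact hX.measurableSet_coord i)) h1 hST
  have h3 := (Indep_iff _ _ μ).1 h2 A B hA hB
  simp only [Measure.real, h3, ENNReal.toReal_mul]

lemma IsNoisyExperiment.real_biInter [IsProbabilityMeasure μ]
    (hX : IsNoisyExperiment μ G p α β Z H) {κ : Type*}
    (s : Finset κ) (S : κ → Set (Coord V)) (hS : Pairwise (Function.onFun Disjoint S))
    (A : κ → Set Ω) (hA : ∀ h ∈ s, MeasurableSet[coordAlg Z H (S h)] (A h)) :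
    μ.real (⋂ h ∈ s, A h) = ∏ h ∈ s, μ.real (A h) := by
  classical
  induction s using Finset.induction_on with
  | empty => simp
  | insert a s ha ih =>
    rw [Finset.set_biInter_insert, Finset.prod_insert ha,
      ← ih fun h hh => hA h (Finset.mem_insert_of_mem hh)]
    refine hX.real_inter (S := S a) (T := ⋃ h ∈ s, S h) ?_
      (hA a (Finset.mem_insert_self _ _)) ?_
    · rw [Set.disjoint_iUnion₂_right]
      intro h hh
      exact hS (fun e => ha (e ▸ hh))
    · refine Finset.measurableSet_biInter _ fun h hh => ?_
      exact coordAlg_mono (Set.subset_biUnion_of_mem (u := S) hh) _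
        (hA h (Finset.mem_insert_of_mem hh))

/-! ### Expectations of functions of the treatment and the observed network -/

lemma integral_ind {P : Ω → Prop} (hP : MeasurableSet {ω | P ω}) :
    ∫ ω, ind (P ω) ∂μ = μ.real {ω | P ω} := by
  rw [← integral_indicator_one hP]
  refine integral_congr_ae (Eventually.of_forall fun ω => ?_)
  by_cases h : P ω <;> simp [ind, h]

lemma integrable_ind [IsFiniteMeasure μ] {P : Ω → Prop} (hP : MeasurableSet {ω | P ω}) :
    Integrable (fun ω => ind (P ω)) μ := by
  have : (fun ω => ind (P ω)) = Set.indicator {ω | P ω} (fun _ => (1 : ℝ)) := by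
    funext ω
    by_cases h : P ω <;> simp [ind, h]
  rw [this]
  exact (integrable_const _).indicator hP

section Finite

variable [Fintype V]

lemma IsNoisyExperiment.measurableSet_fiber (hX : IsNoisyExperiment μ G p α β Z H)
    (z : Finset V) (K : SimpleGraph V) : MeasurableSet {ω | Z ω = z ∧ H ω = K} := by
  have h : {ω | Z ω = z ∧ H ω = K} =
      (⋂ i : V, {ω | i ∈ Z ω ↔ i ∈ z}) ∩ ⋂ i : V, ⋂ j : V, {ω | (H ω).Adj i j ↔ K.Adj i j} := by
    ext ω
    simp only [Set.mem_ofPred_eq, Set.mem_inter_iff, Set.mem_iInter, Finset.ext_iff,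
      SimpleGraph.ext_iff, funext_iff, eq_iff_iff]
  rw [h]
  refine (MeasurableSet.iInter fun i => ?_).inter
    (MeasurableSet.iInter fun i => MeasurableSet.iInter fun j => ?_)
  · exact (hX.measurable_treat i).iff (MeasurableSet.const _)
  · exact (hX.measurable_edge i j).iff (MeasurableSet.const _)

lemma IsNoisyExperiment.measurable_pair (hX : IsNoisyExperiment μ G p α β Z H) :
    Measurable[_, ⊤] fun ω => (Z ω, H ω) := by
  let _ : MeasurableSpace (Finset V × SimpleGraph V) := ⊤
  have : Finite (SimpleGraph V) := inferInstance
  refine measurable_to_countable' fun x => ?_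
  have := hX.measurableSet_fiber x.1 x.2
  convert this using 1
  ext ω
  simp [Prod.ext_iff]

lemma IsNoisyExperiment.measurableSet_comp (hX : IsNoisyExperiment μ G p α β Z H)
    (P : Finset V → SimpleGraph V → Prop) : MeasurableSet {ω | P (Z ω) (H ω)} :=
  hX.measurable_pair (t := {x | P x.1 x.2}) trivial

lemma IsNoisyExperiment.measurable_comp (hX : IsNoisyExperiment μ G p α β Z H)
    {F : Finset V → SimpleGraph V → ℝ} : Measurable fun ω => F (Z ω) (H ω) :=
  fun s _ => hX.measurableSet_comp fun z K => F z K ∈ s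

lemma IsNoisyExperiment.integrable_comp [IsFiniteMeasure μ]
    (hX : IsNoisyExperiment μ G p α β Z H)
    (F : Finset V → SimpleGraph V → ℝ) : Integrable (fun ω => F (Z ω) (H ω)) μ := by
  have : Finite (SimpleGraph V) := inferInstance
  obtain ⟨C, hC⟩ := (Set.finite_range
    fun x : Finset V × SimpleGraph V => ‖F x.1 x.2‖).bddAbove
  refine Integrable.of_bound hX.measurable_comp.aestronglyMeasurable C
    (Eventually.of_forall fun ω => hC ⟨(Z ω, H ω), rfl⟩)

lemma IsNoisyExperiment.integral_comp [IsFiniteMeasure μ]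
    (hX : IsNoisyExperiment μ G p α β Z H) [Fintype (SimpleGraph V)]
    (F : Finset V → SimpleGraph V → ℝ) :
    ∫ ω, F (Z ω) (H ω) ∂μ = ∑ K, ∑ z, μ.real {ω | Z ω = z ∧ H ω = K} * F z K := by
  classical
  have h1 : ∀ ω, F (Z ω) (H ω) = ∑ K, ∑ z, ind (Z ω = z ∧ H ω = K) * F z K := by
    intro ω
    rw [Finset.sum_eq_single (H ω), Finset.sum_eq_single (Z ω)]
    · simp [ind]
    · intro z _ hz
      rw [ind_of_not (fun h => hz h.1.symm), zero_mul]
    · simp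
    · intro K _ hK
      refine Finset.sum_eq_zero fun z _ => ?_
      rw [ind_of_not (fun h => hK h.2.symm), zero_mul]
    · simp
  simp only [h1]
  have h2 : ∀ z K, Integrable (fun ω => ind (Z ω = z ∧ H ω = K) * F z K) μ := fun z K =>
    (integrable_ind (hX.measurableSet_fiber z K)).mul_const _
  rw [integral_finsetSum _ fun K _ => integrable_finsetSum _ fun z _ => h2 z K]
  refine Finset.sum_congr rfl fun K _ => ?_
  rw [integral_finsetSum _ fun z _ => h2 z K]
  refine Finset.sum_congr rfl fun z _ => ?_
  rw [integral_mul_const, integral_ind (hX.measurableSet_fiber z K)]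

lemma IsNoisyExperiment.real_treat_iff [IsProbabilityMeasure μ]
    (hX : IsNoisyExperiment μ G p α β Z H)
    (i : V) (t : Prop) : μ.real {ω | i ∈ Z ω ↔ t} = ind t * p + ind (¬ t) * (1 - p) := by
  by_cases ht : t
  · simp [ht, ind, hX.prob_treat]
  · have : {ω | i ∈ Z ω ↔ t} = {ω | i ∈ Z ω}ᶜ := by ext; simp [ht]
    rw [this, probReal_compl_eq_one_sub (hX.measurable_treat i), hX.prob_treat]
    simp [ind, ht]

lemma IsNoisyExperiment.real_treat [IsProbabilityMeasure μ]
    (hX : IsNoisyExperiment μ G p α β Z H)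
    (i : V) (t : Bool) : μ.real {ω | i ∈ Z ω ↔ t = true} = treatProb p t := by
  rw [hX.real_treat_iff]
  cases t <;> simp [ind, treatProb]

/-- Treatment and observed network are independent. -/
lemma IsNoisyExperiment.real_fiber [IsProbabilityMeasure μ]
    (hX : IsNoisyExperiment μ G p α β Z H) (z : Finset V) (K : SimpleGraph V) :
    μ.real {ω | Z ω = z ∧ H ω = K} = assignmentProb p z * μ.real {ω | H ω = K} := by
  classical
  have h1 : {ω | Z ω = z} = ⋂ i ∈ (Finset.univ : Finset V), {ω | i ∈ Z ω ↔ i ∈ z} := by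
    ext ω
    simp [Finset.ext_iff]
  have hm : ∀ (S : Set (Coord V)) (i : V), Sum.inl i ∈ S →
      MeasurableSet[coordAlg Z H S] {ω | i ∈ Z ω ↔ i ∈ z} := fun S i hi =>
    (measurableSet_treat hi).iff (MeasurableSet.const _)
  have h2 : {ω | H ω = K} = ⋂ i : V, ⋂ j : V, {ω | (H ω).Adj i j ↔ K.Adj i j} := by
    ext ω
    simp only [Set.mem_ofPred_eq, Set.mem_iInter, SimpleGraph.ext_iff, funext_iff, eq_iff_iff]
  have h3 : μ.real {ω | Z ω = z} = assignmentProb p z := by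
    rw [h1, hX.real_biInter Finset.univ (fun i => {Sum.inl i}) _ _ fun i _ => hm _ i rfl,
      assignmentProb_eq_prod]
    · exact Finset.prod_congr rfl fun i _ => hX.real_treat_iff i _
    · intro i j hij
      simp [Function.onFun, hij]
  rw [← h3]
  refine hX.real_inter (A := {ω | Z ω = z}) (B := {ω | H ω = K})
    (S := Set.range Sum.inl) (T := Set.range Sum.inr) ?_ ?_ ?_
  · rw [Set.disjoint_left]
    rintro _ ⟨a, rfl⟩ ⟨b, hb⟩
    cases hb
  · rw [h1]
    exact Finset.measurableSet_biInter _ fun i _ => hm _ i ⟨i, rfl⟩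
  · rw [h2]
    refine MeasurableSet.iInter fun i => MeasurableSet.iInter fun j => ?_
    by_cases hij : i = j
    · subst hij; simp
    · exact (measurableSet_adj (by simpa using hij) (Set.mem_range_self _)).iff (MeasurableSet.const _)

/-- The treatment being independent of the observed network, the inverse probability weight of a level
has conditional expectation at most one given the observed network. -/
lemma IsNoisyExperiment.integral_ipw_mul_le [IsProbabilityMeasure μ]
    (hX : IsNoisyExperiment μ G p α β Z H) (i : V) (k : ExposureLevel)
    (A : SimpleGraph V → Prop) :
    ∫ ω, ipw p (H ω) (Z ω) i k * ind (A (H ω)) ∂μ ≤ μ.real {ω | A (H ω)} := by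
  classical
  have : Fintype (SimpleGraph V) := Fintype.ofFinite _
  rw [← integral_ind (hX.measurableSet_comp fun _ K => A K),
    hX.integral_comp fun z K => ipw p K z i k * ind (A K), hX.integral_comp fun _ K => ind (A K)]
  refine Finset.sum_le_sum fun K _ => ?_
  have e1 : ∀ z, μ.real {ω | Z ω = z ∧ H ω = K} * (ipw p K z i k * ind (A K)) =
      (assignmentProb p z * ind (exposure K z i = k)) *
      (ind (0 < exposureProb p K i k) * (1 / exposureProb p K i k) *
        μ.real {ω | H ω = K} * ind (A K)) := by
    intro z
    rw [hX.real_fiber, ipw]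
    ring
  have e2 : ∑ z, assignmentProb p z * ind (exposure K z i = k) = exposureProb p K i k := by
    unfold exposureProb
    simp only [ite_eq_ind]
  have e3 : ∑ z, μ.real {ω | Z ω = z ∧ H ω = K} * ind (A K) =
      μ.real {ω | H ω = K} * ind (A K) := by
    rw [← Finset.sum_mul]
    congr 1
    simp only [hX.real_fiber]
    rw [← Finset.sum_mul]
    have h := sum_assignmentProb_mul_prod (V := V) p fun _ _ => 1
    simp only [Finset.prod_const_one, mul_one, add_sub_cancel] at h
    rw [h, one_mul]
  simp only [e1]
  rw [← Finset.sum_mul, e2, e3]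
  have h0 : 0 ≤ μ.real {ω | H ω = K} * ind (A K) :=
    mul_nonneg measureReal_nonneg (ind_nonneg _)
  by_cases h : 0 < exposureProb p K i k
  · rw [ind_of h]
    apply le_of_eq
    field_simp
  · rw [ind_of_not h]
    simpa using h0

lemma IsNoisyExperiment.integral_totalWeight_mul_le [IsProbabilityMeasure μ]
    (hX : IsNoisyExperiment μ G p α β Z H) (i : V) (A : SimpleGraph V → Prop) :
    ∫ ω, totalWeight p (H ω) (Z ω) i * ind (A (H ω)) ∂μ ≤ 4 * μ.real {ω | A (H ω)} := by
  unfold totalWeight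
  simp only [Finset.sum_mul]
  rw [integral_finsetSum _ fun k _ =>
    hX.integrable_comp fun z K => ipw p K z i k * ind (A K)]
  refine (Finset.sum_le_sum fun k _ => hX.integral_ipw_mul_le i k A).trans ?_
  rw [sum_exposureLevel]
  linarith

lemma IsNoisyExperiment.integral_totalWeight_le [IsProbabilityMeasure μ]
    (hX : IsNoisyExperiment μ G p α β Z H) (i : V) :
    ∫ ω, totalWeight p (H ω) (Z ω) i ∂μ ≤ 4 := by
  have h := hX.integral_totalWeight_mul_le i fun _ => True
  simpa [ind] using h

/-- The second moment of a sum is the sum of the mixed second moments. -/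
lemma IsNoisyExperiment.integral_sum_sq [IsFiniteMeasure μ]
    (hX : IsNoisyExperiment μ G p α β Z H) {κ : Type*}
    (s : Finset κ) (F : κ → Finset V → SimpleGraph V → ℝ) :
    ∫ ω, (∑ i ∈ s, F i (Z ω) (H ω)) ^ 2 ∂μ =
      ∑ i ∈ s, ∑ j ∈ s, ∫ ω, F i (Z ω) (H ω) * F j (Z ω) (H ω) ∂μ := by
  simp only [sq, Finset.sum_mul_sum]
  rw [integral_finsetSum _ fun i _ => hX.integrable_comp fun z K => ∑ j ∈ s, F i z K * F j z K]
  refine Finset.sum_congr rfl fun i _ => ?_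
  rw [integral_finsetSum _ fun j _ => hX.integrable_comp fun z K => F i z K * F j z K]

end Finite

end Experiment

/-! ### Joint law of true and observed exposures -/

section Hits

variable {Ω : Type*} [MeasurableSpace Ω] {μ : Measure Ω} [IsProbabilityMeasure μ] {V : Type*}
  {G : SimpleGraph V} {p α β : ℝ} {Z : Ω → Finset V} {H : Ω → SimpleGraph V}

/-- `h` is a treated neighbour of `i` in the true network `G` (counted if `τ`) or in the observed
network `K` (counted if `o`). The four choices of `τ`, `o` describe the four possible
conjunctions of "no true exposure" and "no observed exposure". -/
def Hit (G K : SimpleGraph V) (z : Finset V) (τ o : Bool) (i h : V) : Prop :=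
  h ∈ z ∧ ((τ = true ∧ G.Adj h i) ∨ (o = true ∧ K.Adj h i))

/-- The probability that `h` is linked to `i` in the sense of `Hit`, whether treated or not. -/
noncomputable def linkProb (G : SimpleGraph V) (α β : ℝ) (τ o : Bool) (i h : V) : ℝ :=
  ind (G.Adj h i) * (if τ then 1 else if o then 1 - β else 0) +
    ind (¬ G.Adj h i) * (if o then α else 0)

/-- No true neighbour (if `τ`) and no observed neighbour (if `o`) of `i` is treated. -/
def NoHit (G K : SimpleGraph V) (z : Finset V) (τ o : Bool) (i : V) : Prop :=
  ∀ h, ¬ Hit G K z τ o i h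

lemma Hit.ne {K : SimpleGraph V} {z : Finset V} {τ o : Bool} {i h : V}
    (hh : Hit G K z τ o i h) : h ≠ i := by
  rcases hh.2 with h' | h' <;> exact h'.2.ne

lemma IsNoisyExperiment.real_adj
    (hX : IsNoisyExperiment μ G p α β Z H) {i h : V} (hi : h ≠ i) :
    μ.real {ω | (H ω).Adj h i} = ind (G.Adj h i) * (1 - β) + ind (¬ G.Adj h i) * α := by
  by_cases hG : G.Adj h i
  · have h1 := hX.prob_edge h i hG
    have h2 : {ω | ¬ (H ω).Adj h i} = {ω | (H ω).Adj h i}ᶜ := rfl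
    rw [h2, probReal_compl_eq_one_sub (hX.measurable_edge h i)] at h1
    rw [ind_of hG, ind_of_not (not_not.2 hG)]
    linarith
  · rw [ind_of_not hG, ind_of hG, hX.prob_nonedge h i hi hG]
    ring

lemma IsNoisyExperiment.real_link (hX : IsNoisyExperiment μ G p α β Z H) (τ o : Bool) {i h : V}
    (hi : h ≠ i) :
    μ.real {ω | (τ = true ∧ G.Adj h i) ∨ (o = true ∧ (H ω).Adj h i)} =
      linkProb G α β τ o i h := by
  have h1 := hX.real_adj hi
  unfold linkProb
  by_cases hG : G.Adj h i
  · rw [ind_of hG, ind_of_not (not_not.2 hG)] at *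
    cases τ <;> cases o <;> simp [hG, h1]
  · rw [ind_of hG, ind_of_not hG] at *
    cases τ <;> cases o <;> simp [hG, h1]

lemma measurableSet_link {S : Set (Coord V)} {i h : V} (τ o : Bool)
    (hd : ¬ (s(h, i) : Sym2 V).IsDiag) (hi : Sum.inr ⟨s(h, i), hd⟩ ∈ S) :
    MeasurableSet[coordAlg Z H S]
      {ω | (τ = true ∧ G.Adj h i) ∨ (o = true ∧ (H ω).Adj h i)} := by
  refine MeasurableSet.union (s₁ := {ω | τ = true ∧ G.Adj h i}) (MeasurableSet.const _) ?_
  exact MeasurableSet.inter (s₁ := {ω | o = true}) (MeasurableSet.const _)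
    (measurableSet_adj hd hi)

lemma IsNoisyExperiment.real_treat_and (hX : IsNoisyExperiment μ G p α β Z H) {A : Set Ω} (h : V)
    {S : Set (Coord V)} (hS : Sum.inl h ∉ S) (hA : MeasurableSet[coordAlg Z H S] A) (t : Bool) :
    μ.real ({ω | h ∈ Z ω ↔ t = true} ∩ A) = μ.real {ω | h ∈ Z ω ↔ t = true} * μ.real A :=
  hX.real_inter (A := {ω | h ∈ Z ω ↔ t = true}) (B := A) (S := {Sum.inl h}) (T := S)
    (Set.disjoint_singleton_left.2 hS)
    ((measurableSet_treat (Set.mem_singleton _)).iff (MeasurableSet.const _)) hA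

variable [Fintype V]

lemma IsNoisyExperiment.real_hit (hX : IsNoisyExperiment μ G p α β Z H) (τ o : Bool) {i h : V}
    (hi : h ≠ i) : μ.real {ω | Hit G (H ω) (Z ω) τ o i h} = p * linkProb G α β τ o i h := by
  have hd : ¬ (s(h, i) : Sym2 V).IsDiag := by simpa using hi
  have h1 := hX.real_treat_and (A := {ω | (τ = true ∧ G.Adj h i) ∨ (o = true ∧ (H ω).Adj h i)})
    h (S := {Sum.inr ⟨s(h, i), hd⟩}) (by simp) (measurableSet_link τ o hd (Set.mem_singleton _)) true
  rw [hX.real_link τ o hi, hX.real_treat] at h1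
  rw [show p = treatProb p true from rfl, ← h1]
  congr 1
  ext ω
  simp [Hit]

lemma IsNoisyExperiment.real_not_hit (hX : IsNoisyExperiment μ G p α β Z H) (τ o : Bool) {i h : V}
    (hi : h ≠ i) :
    μ.real {ω | ¬ Hit G (H ω) (Z ω) τ o i h} = 1 - p * linkProb G α β τ o i h := by
  rw [← hX.real_hit τ o hi, ← probReal_compl_eq_one_sub
    (hX.measurableSet_comp fun z K => Hit G K z τ o i h)]
  rfl

/-- The indicators that determine whether `h` is a hit for `i`. -/
def hitCoords (i h : V) : Set (Coord V) :=
  {c | c = Sum.inl h ∨ ∃ hd : ¬ (s(h, i) : Sym2 V).IsDiag, c = Sum.inr ⟨s(h, i), hd⟩}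

lemma measurableSet_not_hit {S : Set (Coord V)} (τ o : Bool) {i h : V} (hi : h ≠ i)
    (hS : hitCoords i h ⊆ S) :
    MeasurableSet[coordAlg Z H S] {ω | ¬ Hit G (H ω) (Z ω) τ o i h} := by
  have hd : ¬ (s(h, i) : Sym2 V).IsDiag := by simpa using hi
  have h1 := (measurableSet_treat (Z := Z) (H := H) (hS (Or.inl rfl))).inter
    (measurableSet_link (Z := Z) (H := H) (G := G) τ o hd (hS (Or.inr ⟨hd, rfl⟩)))
  exact h1.compl

/-- The indicators attached to the vertex `h` when the exposures of `i` and `j` are studied: the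
treatment of `h`, and its edges to `i` and `j` unless `h` is one of these two. -/
def pairCoords (i j h : V) : Set (Coord V) :=
  {c | c = Sum.inl h ∨ (h ≠ i ∧ h ≠ j ∧ ∃ hd : ¬ (s(h, i) : Sym2 V).IsDiag,
      c = Sum.inr ⟨s(h, i), hd⟩) ∨
    (h ≠ i ∧ h ≠ j ∧ ∃ hd : ¬ (s(h, j) : Sym2 V).IsDiag, c = Sum.inr ⟨s(h, j), hd⟩)}

lemma pairwise_disjoint_pairCoords (i j : V) :
    Pairwise (Function.onFun Disjoint (pairCoords i j)) := by
  intro a b hab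
  rw [Function.onFun, Set.disjoint_left]
  rintro c (rfl | ⟨ha, ha', hd, rfl⟩ | ⟨ha, ha', hd, rfl⟩) (hc | ⟨hb, hb', hd', hc⟩ |
    ⟨hb, hb', hd', hc⟩)
  · exact hab (Sum.inl.inj hc)
  all_goals first | exact (Sum.inl_ne_inr hc).elim | exact (Sum.inr_ne_inl hc).elim | skip
  all_goals
    have h := congrArg Subtype.val (Sum.inr.inj hc)
    simp only [Sym2.eq_iff] at h
    rcases h with ⟨h1, h2⟩ | ⟨h1, h2⟩
    · exact hab h1
    · subst h1 h2; simp at *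

lemma pairCoords_left (i j h : V) (h1 : h ≠ i) (h2 : h ≠ j) :
    hitCoords i h ⊆ pairCoords i j h := by
  rintro c (rfl | ⟨hd, rfl⟩)
  · exact Or.inl rfl
  · exact Or.inr (Or.inl ⟨h1, h2, hd, rfl⟩)

lemma pairCoords_right (i j h : V) (h1 : h ≠ i) (h2 : h ≠ j) :
    hitCoords j h ⊆ pairCoords i j h := by
  rintro c (rfl | ⟨hd, rfl⟩)
  · exact Or.inl rfl
  · exact Or.inr (Or.inr ⟨h1, h2, hd, rfl⟩)

/-- The treatment of `i` and of `j` and the events at all other vertices factorise. -/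
lemma IsNoisyExperiment.real_pair (hX : IsNoisyExperiment μ G p α β Z H) [DecidableEq V] {i j : V}
    (hij : i ≠ j) (t t' : Bool) (A : V → Set Ω)
    (hA : ∀ h, h ≠ i → h ≠ j → MeasurableSet[coordAlg Z H (pairCoords i j h)] (A h)) :
    μ.real {ω | ((i ∈ Z ω ↔ t = true) ∧ (j ∈ Z ω ↔ t' = true)) ∧ ∀ h, h ≠ i → h ≠ j → ω ∈ A h} =
      treatProb p t * treatProb p t' * ∏ h ∈ Finset.univ \ {i, j}, μ.real (A h) := by
  set B : V → Set Ω := fun h => if h = i then {ω | i ∈ Z ω ↔ t = true} else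
    if h = j then {ω | j ∈ Z ω ↔ t' = true} else A h with hB
  have h1 : {ω | ((i ∈ Z ω ↔ t = true) ∧ (j ∈ Z ω ↔ t' = true)) ∧
      ∀ h, h ≠ i → h ≠ j → ω ∈ A h} = ⋂ h ∈ (Finset.univ : Finset V), B h := by
    ext ω
    simp only [Set.mem_ofPred_eq, Finset.mem_univ, Set.iInter_true, Set.mem_iInter]
    constructor
    · rintro ⟨⟨h1, h2⟩, h3⟩ h
      by_cases hi : h = i
      · simpa [hB, hi] using h1
      · by_cases hj : h = j
        · simpa [hB, hj, hij.symm] using h2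
        · simpa [hB, hi, hj] using h3 h hi hj
    · intro h
      refine ⟨⟨by simpa [hB] using h i, by simpa [hB, hij.symm] using h j⟩, fun k hi hj => ?_⟩
      simpa [hB, hi, hj] using h k
  rw [h1, hX.real_biInter Finset.univ (pairCoords i j) (pairwise_disjoint_pairCoords i j)]
  · rw [← Finset.prod_sdiff (Finset.subset_univ {i, j}), mul_comm, Finset.prod_pair hij]
    congr 1
    · simp only [hB, if_true, hij.symm, if_false, hX.real_treat]
    · refine Finset.prod_congr rfl fun h hh => ?_
      simp only [Finset.mem_sdiff, Finset.mem_univ, Finset.mem_insert, Finset.mem_singleton,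
        true_and, not_or] at hh
      simp [hB, hh.1, hh.2]
  · intro h _
    by_cases hi : h = i
    · subst hi
      simp only [hB, if_true]
      exact (measurableSet_treat (Or.inl rfl)).iff (MeasurableSet.const _)
    · by_cases hj : h = j
      · subst hj
        simp only [hB, hi, if_true, if_false]
        exact (measurableSet_treat (Or.inl rfl)).iff (MeasurableSet.const _)
      · simpa [hB, hi, hj] using hA h hi hj

/-- The probability that `i` has no hit. -/
noncomputable def noHitProduct (G : SimpleGraph V) (p α β : ℝ) (τ o : Bool) (i : V) : ℝ :=
  open Classical in ∏ h ∈ Finset.univ \ {i}, (1 - p * linkProb G α β τ o i h)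

lemma IsNoisyExperiment.real_noHit (hX : IsNoisyExperiment μ G p α β Z H) (i : V) (t τ o : Bool) :
    μ.real {ω | (i ∈ Z ω ↔ t = true) ∧ NoHit G (H ω) (Z ω) τ o i} =
      treatProb p t * noHitProduct G p α β τ o i := by
  classical
  set B : V → Set Ω := fun h => if h = i then {ω | i ∈ Z ω ↔ t = true} else
    {ω | ¬ Hit G (H ω) (Z ω) τ o i h} with hB
  have h1 : {ω | (i ∈ Z ω ↔ t = true) ∧ NoHit G (H ω) (Z ω) τ o i} =
      ⋂ h ∈ (Finset.univ : Finset V), B h := by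
    ext ω
    simp only [Set.mem_ofPred_eq, Finset.mem_univ, Set.iInter_true, Set.mem_iInter, NoHit]
    constructor
    · rintro ⟨h1, h3⟩ h
      by_cases hi : h = i
      · simpa [hB, hi] using h1
      · simpa [hB, hi] using h3 h
    · intro h
      refine ⟨by simpa [hB] using h i, fun k hk => ?_⟩
      have := h k
      simp only [hB, hk.ne, if_false] at this
      exact this hk
  rw [h1, hX.real_biInter Finset.univ (pairCoords i i) (pairwise_disjoint_pairCoords i i)]
  · rw [← Finset.prod_sdiff (Finset.subset_univ {i}), mul_comm, Finset.prod_singleton]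
    unfold noHitProduct
    congr 1
    · simp only [hB, if_true, hX.real_treat]
    · refine Finset.prod_congr rfl fun h hh => ?_
      have hi : h ≠ i := by simpa using hh
      simp only [hB, hi, if_false, hX.real_not_hit τ o hi]
  · intro h _
    by_cases hi : h = i
    · subst hi
      simp only [hB, if_true]
      exact (measurableSet_treat (Or.inl rfl)).iff (MeasurableSet.const _)
    · simp only [hB, hi, if_false]
      exact measurableSet_not_hit τ o hi (pairCoords_left i i h hi hi)

lemma prod_sdiff_adj (G : SimpleGraph V) (i : V) (x w : ℝ) [DecidableEq V] :
    ∏ h ∈ Finset.univ \ {i}, (ind (G.Adj h i) * x + ind (¬ G.Adj h i) * w) =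
      x ^ vertexDegree G i * w ^ (Fintype.card V - 1 - vertexDegree G i) := by
  classical
  have h1 : ∀ h, (ind (G.Adj h i) * x + ind (¬ G.Adj h i) * w) = if G.Adj h i then x else w := by
    intro h
    by_cases hz : G.Adj h i <;> simp [ind, hz]
  simp only [h1]
  have h2 : ((Finset.univ \ {i}).filter fun h => G.Adj h i) =
      Finset.univ.filter fun h => G.Adj h i := by
    ext h
    simp only [Finset.mem_filter, Finset.mem_sdiff, Finset.mem_univ, Finset.mem_singleton,
      true_and, and_iff_right_iff_imp]
    exact fun h' => h'.ne
  rw [Finset.prod_ite, Finset.filter_not, h2, Finset.prod_const, Finset.prod_const,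
    vertexDegree_eq_card, Finset.card_sdiff_of_subset, Finset.card_sdiff_of_subset
      (Finset.subset_univ _)]
  · simp
  · rw [← h2]
    exact Finset.filter_subset _ _

lemma noHitProduct_eq (G : SimpleGraph V) (p α β : ℝ) (τ o : Bool) (i : V) :
    noHitProduct G p α β τ o i =
      (1 - p * (if τ then 1 else if o then 1 - β else 0)) ^ vertexDegree G i *
        (1 - p * (if o then α else 0)) ^ (Fintype.card V - 1 - vertexDegree G i) := by
  classical
  rw [← prod_sdiff_adj]
  unfold noHitProduct
  refine Finset.prod_congr (by congr) fun h _ => ?_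
  unfold linkProb
  by_cases hz : G.Adj h i <;> simp [ind, hz]

end Hits

/-! ### Asymptotic independence of the exposures of two vertices -/

lemma abs_prod_sub_prod_le {κ : Type*} (s : Finset κ) (x w : κ → ℝ)
    (hx : ∀ h ∈ s, 0 ≤ x h ∧ x h ≤ 1) (hw : ∀ h ∈ s, 0 ≤ w h ∧ w h ≤ 1) :
    |∏ h ∈ s, x h - ∏ h ∈ s, w h| ≤ ∑ h ∈ s, |x h - w h| := by
  classical
  induction s using Finset.induction_on with
  | empty => simp
  | insert a s ha ih =>
    rw [Finset.prod_insert ha, Finset.prod_insert ha, Finset.sum_insert ha]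
    have ih' := ih (fun h hh => hx h (Finset.mem_insert_of_mem hh))
      (fun h hh => hw h (Finset.mem_insert_of_mem hh))
    have h1 := hx a (Finset.mem_insert_self _ _)
    have h2 : |∏ h ∈ s, w h| ≤ 1 := by
      rw [abs_of_nonneg (Finset.prod_nonneg fun h hh => (hw h (Finset.mem_insert_of_mem hh)).1)]
      exact Finset.prod_le_one (fun h hh => (hw h (Finset.mem_insert_of_mem hh)).1)
        (fun h hh => (hw h (Finset.mem_insert_of_mem hh)).2)
    have h3 : x a * ∏ h ∈ s, x h - w a * ∏ h ∈ s, w h =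
        x a * (∏ h ∈ s, x h - ∏ h ∈ s, w h) + (x a - w a) * ∏ h ∈ s, w h := by ring
    rw [h3]
    refine (abs_add_le _ _).trans ?_
    rw [abs_mul, abs_mul, abs_of_nonneg h1.1]
    have h4 : x a * |∏ h ∈ s, x h - ∏ h ∈ s, w h| ≤ 1 * ∑ h ∈ s, |x h - w h| :=
      mul_le_mul h1.2 ih' (abs_nonneg _) zero_le_one
    have h5 : |x a - w a| * |∏ h ∈ s, w h| ≤ |x a - w a| * 1 :=
      mul_le_mul_of_nonneg_left h2 (abs_nonneg _)
    linarith

section Pairs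

variable {Ω : Type*} [MeasurableSpace Ω] {μ : Measure Ω} [IsProbabilityMeasure μ]
  {V : Type*} [Fintype V]
  {G : SimpleGraph V} {p α β : ℝ} {Z : Ω → Finset V} {H : Ω → SimpleGraph V}

lemma linkProb_mem_Icc (hα : 0 ≤ α ∧ α ≤ 1) (hβ : 0 ≤ β ∧ β ≤ 1) (τ o : Bool) (i h : V) :
    0 ≤ linkProb G α β τ o i h ∧ linkProb G α β τ o i h ≤ linkProb G α β true true i h ∧
      linkProb G α β true true i h ≤ 1 := by
  unfold linkProb
  by_cases hG : G.Adj h i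
  · rw [ind_of hG, ind_of_not (not_not.2 hG)]
    cases τ <;> cases o <;> simp <;> (try constructor) <;> linarith
  · rw [ind_of_not hG, ind_of hG]
    cases τ <;> cases o <;> simp <;> (try constructor) <;> linarith

lemma IsNoisyExperiment.real_two_hits_le (hX : IsNoisyExperiment μ G p α β Z H)
    (τ o τ' o' : Bool) {i j h : V} (hij : i ≠ j) (hi : h ≠ i) (hj : h ≠ j) :
    μ.real {ω | Hit G (H ω) (Z ω) τ o i h ∧ Hit G (H ω) (Z ω) τ' o' j h} ≤
      p * (linkProb G α β true true i h * linkProb G α β true true j h) := by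
  have hdi : ¬ (s(h, i) : Sym2 V).IsDiag := by simpa using hi
  have hdj : ¬ (s(h, j) : Sym2 V).IsDiag := by simpa using hj
  have mi := measurableSet_link (Z := Z) (H := H) (G := G) (S := {Sum.inr ⟨s(h, i), hdi⟩})
    true true hdi (Set.mem_singleton _)
  have mj := measurableSet_link (Z := Z) (H := H) (G := G) (S := {Sum.inr ⟨s(h, j), hdj⟩})
    true true hdj (Set.mem_singleton _)
  have hne : (s(h, i) : Sym2 V) ≠ s(h, j) := by
    intro e
    rw [Sym2.eq_iff] at e
    rcases e with ⟨_, e⟩ | ⟨e, _⟩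
    · exact hij e
    · exact hj e
  set A : Set Ω := {ω | (true = true ∧ G.Adj h i) ∨ (true = true ∧ (H ω).Adj h i)} with hA
  set B : Set Ω := {ω | (true = true ∧ G.Adj h j) ∨ (true = true ∧ (H ω).Adj h j)} with hB
  have h2 : μ.real (A ∩ B) = μ.real A * μ.real B :=
    hX.real_inter (Set.disjoint_singleton.2 (by simpa using hne)) mi mj
  have mAB : MeasurableSet[coordAlg Z H ({Sum.inr ⟨s(h, i), hdi⟩} ∪ {Sum.inr ⟨s(h, j), hdj⟩})]
      (A ∩ B) := MeasurableSet.inter (coordAlg_mono Set.subset_union_left _ mi)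
    (coordAlg_mono Set.subset_union_right _ mj)
  have h3 := hX.real_treat_and h (by simp) mAB true
  rw [h2, hA, hB, hX.real_link true true hi, hX.real_link true true hj, hX.real_treat] at h3
  refine le_trans (measureReal_mono ?_) h3.le
  rintro ω ⟨⟨h1, h2⟩, h4, h5⟩
  refine ⟨by simpa using h1, ?_, ?_⟩
  · exact h2.imp (fun h => ⟨rfl, h.2⟩) fun h => ⟨rfl, h.2⟩
  · exact h5.imp (fun h => ⟨rfl, h.2⟩) fun h => ⟨rfl, h.2⟩

lemma IsNoisyExperiment.abs_real_not_hits_sub_le (hX : IsNoisyExperiment μ G p α β Z H)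
    (hp : 0 ≤ p ∧ p ≤ 1) (hα : 0 ≤ α ∧ α ≤ 1) (hβ : 0 ≤ β ∧ β ≤ 1)
    (τ o τ' o' : Bool) {i j h : V} (hij : i ≠ j) (hi : h ≠ i) (hj : h ≠ j) :
    |μ.real {ω | ¬ Hit G (H ω) (Z ω) τ o i h ∧ ¬ Hit G (H ω) (Z ω) τ' o' j h} -
      (1 - p * linkProb G α β τ o i h) * (1 - p * linkProb G α β τ' o' j h)| ≤
      p * (linkProb G α β true true i h * linkProb G α β true true j h) := by
  have h1 := hX.real_two_hits_le τ o τ' o' hij hi hj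
  have h2 := hX.real_hit τ o hi
  have h3 := hX.real_hit τ' o' hj
  have h4 : μ.real {ω | ¬ Hit G (H ω) (Z ω) τ o i h ∧ ¬ Hit G (H ω) (Z ω) τ' o' j h} =
      1 - (μ.real {ω | Hit G (H ω) (Z ω) τ o i h} + μ.real {ω | Hit G (H ω) (Z ω) τ' o' j h} -
        μ.real {ω | Hit G (H ω) (Z ω) τ o i h ∧ Hit G (H ω) (Z ω) τ' o' j h}) := by
    have m1 := hX.measurableSet_comp fun z K => Hit G K z τ o i h
    have m2 := hX.measurableSet_comp fun z K => Hit G K z τ' o' j h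
    have h5 := measureReal_union_add_inter (μ := μ)
      (s := {ω | Hit G (H ω) (Z ω) τ o i h}) m2
    have h6 := probReal_compl_eq_one_sub (μ := μ) (m1.union m2)
    rw [show ({ω | Hit G (H ω) (Z ω) τ o i h} ∪ {ω | Hit G (H ω) (Z ω) τ' o' j h})ᶜ =
      {ω | ¬ Hit G (H ω) (Z ω) τ o i h ∧ ¬ Hit G (H ω) (Z ω) τ' o' j h} by
        ext ω; simp] at h6
    rw [show {ω | Hit G (H ω) (Z ω) τ o i h} ∩ {ω | Hit G (H ω) (Z ω) τ' o' j h} =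
      {ω | Hit G (H ω) (Z ω) τ o i h ∧ Hit G (H ω) (Z ω) τ' o' j h} from rfl] at h5
    linarith
  have h0 : 0 ≤ μ.real {ω | Hit G (H ω) (Z ω) τ o i h ∧ Hit G (H ω) (Z ω) τ' o' j h} :=
    measureReal_nonneg
  obtain ⟨a1, a2, a3⟩ := linkProb_mem_Icc (G := G) hα hβ τ o i h
  obtain ⟨b1, b2, b3⟩ := linkProb_mem_Icc (G := G) hα hβ τ' o' j h
  have h7 : (p * linkProb G α β τ o i h) * (p * linkProb G α β τ' o' j h) ≤
      p * (linkProb G α β true true i h * linkProb G α β true true j h) := by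
    have e1 : linkProb G α β τ o i h * linkProb G α β τ' o' j h ≤
      linkProb G α β true true i h * linkProb G α β true true j h :=
      mul_le_mul a2 b2 b1 (a1.trans a2)
    calc (p * linkProb G α β τ o i h) * (p * linkProb G α β τ' o' j h)
        = p * (p * (linkProb G α β τ o i h * linkProb G α β τ' o' j h)) := by ring
      _ ≤ p * (1 * (linkProb G α β true true i h * linkProb G α β true true j h)) := by
          refine mul_le_mul_of_nonneg_left ?_ hp.1
          exact mul_le_mul hp.2 e1 (mul_nonneg a1 b1) zero_le_one
      _ = _ := by ring
  have h8 : 0 ≤ (p * linkProb G α β τ o i h) * (p * linkProb G α β τ' o' j h) :=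
    mul_nonneg (mul_nonneg hp.1 a1) (mul_nonneg hp.1 b1)
  rw [h4, h2, h3, abs_le]
  constructor <;> nlinarith

lemma sum_ind_adj (G : SimpleGraph V) (i : V) :
    ∑ h, ind (G.Adj h i) = vertexDegree G i := by
  classical
  rw [vertexDegree_eq_card, Finset.card_filter]
  push_cast
  exact Finset.sum_congr rfl fun h _ => by by_cases hz : G.Adj h i <;> simp [ind, hz]

lemma sum_linkProb_mul_le (hα : 0 ≤ α ∧ α ≤ 1) {i j : V} (s : Finset V)
    (hcn : ∀ h, ¬ (G.Adj h i ∧ G.Adj h j)) :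
    ∑ h ∈ s, linkProb G α β true true i h * linkProb G α β true true j h ≤
      α * (vertexDegree G i + vertexDegree G j) + Fintype.card V * α ^ 2 := by
  classical
  have hα0 := hα.1
  have h1 : ∀ h, linkProb G α β true true i h * linkProb G α β true true j h ≤
      α * (ind (G.Adj h i) + ind (G.Adj h j)) + α ^ 2 := by
    intro h
    unfold linkProb
    by_cases hG : G.Adj h i <;> by_cases hG' : G.Adj h j
    · exact absurd ⟨hG, hG'⟩ (hcn h)
    all_goals simp [ind, hG, hG']; nlinarith
  have h2 : ∀ h, 0 ≤ α * (ind (G.Adj h i) + ind (G.Adj h j)) + α ^ 2 := fun h => by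
    have := ind_nonneg (G.Adj h i)
    have := ind_nonneg (G.Adj h j)
    positivity
  calc _ ≤ ∑ h ∈ s, (α * (ind (G.Adj h i) + ind (G.Adj h j)) + α ^ 2) :=
        Finset.sum_le_sum fun h _ => h1 h
    _ ≤ ∑ h, (α * (ind (G.Adj h i) + ind (G.Adj h j)) + α ^ 2) :=
        Finset.sum_le_sum_of_subset_of_nonneg (Finset.subset_univ s) fun h _ _ => h2 h
    _ = _ := by
        rw [Finset.sum_add_distrib, ← Finset.mul_sum, Finset.sum_add_distrib, sum_ind_adj,
          sum_ind_adj]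
        simp

/-- The error in the factorisation of the joint exposure probabilities of two vertices that are
neither adjacent nor share a neighbour: it stems from the observed edge between them and from the
vertices that are possibly observed as neighbours of both. -/
noncomputable def pairError (G : SimpleGraph V) (p α : ℝ) (i j : V) : ℝ :=
  3 * α + p * (α * (vertexDegree G i + vertexDegree G j) + Fintype.card V * α ^ 2)

lemma one_sub_mul_linkProb_mem (hp : 0 ≤ p ∧ p ≤ 1) (hα : 0 ≤ α ∧ α ≤ 1) (hβ : 0 ≤ β ∧ β ≤ 1)
    (τ o : Bool) (i h : V) :
    0 ≤ 1 - p * linkProb G α β τ o i h ∧ 1 - p * linkProb G α β τ o i h ≤ 1 := by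
  obtain ⟨a1, a2, a3⟩ := linkProb_mem_Icc (G := G) hα hβ τ o i h
  have : p * linkProb G α β τ o i h ≤ 1 * 1 :=
    mul_le_mul hp.2 (a2.trans a3) a1 zero_le_one
  have := mul_nonneg hp.1 a1
  constructor <;> linarith

/-- The exposures of two vertices that are neither adjacent nor share a neighbour are nearly
independent: the joint probabilities are products over the other vertices, up to the edge between
the two, and at every other vertex at most one of the two links is certain. -/
lemma IsNoisyExperiment.abs_pair_noHit_sub_le (hX : IsNoisyExperiment μ G p α β Z H)
    (hp : 0 ≤ p ∧ p ≤ 1) (hα : 0 ≤ α ∧ α ≤ 1) (hβ : 0 ≤ β ∧ β ≤ 1)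
    (t τ o τ' o' : Bool) {i j : V} (hij : i ≠ j) (hG : ¬ G.Adj j i)
    (hcn : ∀ h, ¬ (G.Adj h i ∧ G.Adj h j)) :
    |μ.real {ω | ((i ∈ Z ω ↔ t = true) ∧ (j ∈ Z ω ↔ t = true)) ∧
        (NoHit G (H ω) (Z ω) τ o i ∧ NoHit G (H ω) (Z ω) τ' o' j)} -
      treatProb p t ^ 2 * (noHitProduct G p α β τ o i * noHitProduct G p α β τ' o' j)| ≤
      treatProb p t ^ 2 * pairError G p α i j := by
  classical
  set q := treatProb p t with hq
  set s : Finset V := Finset.univ \ {i, j} with hs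
  have hsi : ∀ h ∈ s, h ≠ i ∧ h ≠ j := by
    intro h hh
    simpa [hs, not_or] using hh
  set A : V → Set Ω := fun h =>
    {ω | ¬ Hit G (H ω) (Z ω) τ o i h ∧ ¬ Hit G (H ω) (Z ω) τ' o' j h} with hA
  have hAm : ∀ h, h ≠ i → h ≠ j → MeasurableSet[coordAlg Z H (pairCoords i j h)] (A h) :=
    fun h hi hj => (measurableSet_not_hit τ o hi (pairCoords_left i j h hi hj)).inter
      (measurableSet_not_hit τ' o' hj (pairCoords_right i j h hi hj))
  have hJ' := hX.real_pair hij t t A hAm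
  set J := μ.real {ω | ((i ∈ Z ω ↔ t = true) ∧ (j ∈ Z ω ↔ t = true)) ∧
        (NoHit G (H ω) (Z ω) τ o i ∧ NoHit G (H ω) (Z ω) τ' o' j)} with hJdef
  set J' := μ.real {ω | ((i ∈ Z ω ↔ t = true) ∧ (j ∈ Z ω ↔ t = true)) ∧
    ∀ h, h ≠ i → h ≠ j → ω ∈ A h} with hJ'def
  -- the observed edge between `i` and `j`
  have hE : μ.real ({ω | (i ∈ Z ω ↔ t = true) ∧ (j ∈ Z ω ↔ t = true)} ∩
      {ω | (H ω).Adj j i}) = q ^ 2 * α := by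
    have hd : ¬ (s(j, i) : Sym2 V).IsDiag := by simpa using hij.symm
    have h2 : μ.real {ω | (i ∈ Z ω ↔ t = true) ∧ (j ∈ Z ω ↔ t = true)} = q ^ 2 := by
      have := hX.real_pair hij t t (fun _ => Set.univ) fun _ _ _ => MeasurableSet.univ
      simpa [sq] using this
    rw [hX.real_inter (A := {ω | (i ∈ Z ω ↔ t = true) ∧ (j ∈ Z ω ↔ t = true)})
      (B := {ω | (H ω).Adj j i})
      (S := Set.range Sum.inl) (T := Set.range Sum.inr) ?_ ?_ ?_, h2,
      hX.prob_nonedge j i hij.symm hG]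
    · rw [Set.disjoint_left]
      rintro _ ⟨a, rfl⟩ ⟨b, hb⟩
      cases hb
    · exact ((measurableSet_treat (Set.mem_range_self _)).iff (MeasurableSet.const _)).inter
        ((measurableSet_treat (Set.mem_range_self _)).iff (MeasurableSet.const _))
    · exact measurableSet_adj hd (Set.mem_range_self _)
  have hJJ' : J ≤ J' := by
    refine measureReal_mono ?_
    rintro ω ⟨h1, h2, h3⟩
    exact ⟨h1, fun h _ _ => ⟨h2 h, h3 h⟩⟩
  have hJ'J : J' ≤ J + q ^ 2 * α := by
    rw [← hE]
    refine le_trans (measureReal_mono ?_) (measureReal_union_le _ _)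
    rintro ω ⟨h1, h2⟩
    by_cases hadj : (H ω).Adj j i
    · exact Or.inr ⟨h1, hadj⟩
    · refine Or.inl ⟨h1, fun h hh => ?_, fun h hh => ?_⟩
      · by_cases hj : h = j
        · subst hj
          rcases hh.2 with h' | h'
          · exact hG h'.2
          · exact hadj h'.2
        · exact (h2 h hh.ne hj).1 hh
      · by_cases hi : h = i
        · subst hi
          rcases hh.2 with h' | h'
          · exact hG h'.2.symm
          · exact hadj h'.2.symm
        · exact (h2 h hi hh.ne).2 hh
  set P := ∏ h ∈ s, μ.real (A h) with hP
  set x : V → ℝ := fun h => 1 - p * linkProb G α β τ o i h with hx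
  set w : V → ℝ := fun h => 1 - p * linkProb G α β τ' o' j h with hw
  have hxm : ∀ h, 0 ≤ x h ∧ x h ≤ 1 := fun h => one_sub_mul_linkProb_mem hp hα hβ τ o i h
  have hwm : ∀ h, 0 ≤ w h ∧ w h ≤ 1 := fun h => one_sub_mul_linkProb_mem hp hα hβ τ' o' j h
  have hprod : |P - ∏ h ∈ s, x h * w h| ≤
      p * (α * (vertexDegree G i + vertexDegree G j) + Fintype.card V * α ^ 2) := by
    refine (abs_prod_sub_prod_le s _ _ (fun h _ => ⟨measureReal_nonneg, measureReal_le_one⟩)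
      fun h _ => ⟨mul_nonneg (hxm h).1 (hwm h).1,
        mul_le_one₀ (hxm h).2 (hwm h).1 (hwm h).2⟩).trans ?_
    refine (Finset.sum_le_sum fun h hh => hX.abs_real_not_hits_sub_le hp hα hβ τ o τ' o' hij
      (hsi h hh).1 (hsi h hh).2).trans ?_
    rw [← Finset.mul_sum]
    exact mul_le_mul_of_nonneg_left (sum_linkProb_mul_le hα s hcn) hp.1
  have hi1 : noHitProduct G p α β τ o i = x j * ∏ h ∈ s, x h := by
    unfold noHitProduct
    have hd : Finset.univ \ {i} = insert j s := by
      ext h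
      by_cases hj : h = j <;> simp [hs, hj, hij.symm]
    rw [show (Finset.univ \ {i} : Finset V) = insert j s by convert hd,
      Finset.prod_insert (by simp [hs])]
  have hj1 : noHitProduct G p α β τ' o' j = w i * ∏ h ∈ s, w h := by
    unfold noHitProduct
    have hd : Finset.univ \ {j} = insert i s := by
      ext h
      by_cases hj : h = i <;> simp [hs, hj, hij]
    rw [show (Finset.univ \ {j} : Finset V) = insert i s by convert hd,
      Finset.prod_insert (by simp [hs])]
  have hlink : ∀ (σ σ' : Bool) (a b : V), ¬ G.Adj b a → p * linkProb G α β σ σ' a b ≤ α := by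
    intro σ σ' a b hab
    have h1 : linkProb G α β true true a b = α := by simp [linkProb, ind, hab]
    obtain ⟨a1, a2, a3⟩ := linkProb_mem_Icc (G := G) hα hβ σ σ' a b
    rw [h1] at a2
    calc p * linkProb G α β σ σ' a b ≤ 1 * α := mul_le_mul hp.2 a2 a1 zero_le_one
      _ = α := one_mul _
  have hxj : 1 - α ≤ x j := by
    have := hlink τ o i j hG
    simp only [hx]; linarith
  have hwi : 1 - α ≤ w i := by
    have := hlink τ' o' j i (fun h => hG h.symm)
    simp only [hw]; linarith
  have hPx : 0 ≤ ∏ h ∈ s, x h ∧ ∏ h ∈ s, x h ≤ 1 :=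
    ⟨Finset.prod_nonneg fun h _ => (hxm h).1, Finset.prod_le_one (fun h _ => (hxm h).1)
      fun h _ => (hxm h).2⟩
  have hPw : 0 ≤ ∏ h ∈ s, w h ∧ ∏ h ∈ s, w h ≤ 1 :=
    ⟨Finset.prod_nonneg fun h _ => (hwm h).1, Finset.prod_le_one (fun h _ => (hwm h).1)
      fun h _ => (hwm h).2⟩
  rw [Finset.prod_mul_distrib] at hprod
  have hfac : |(∏ h ∈ s, x h) * (∏ h ∈ s, w h) -
      noHitProduct G p α β τ o i * noHitProduct G p α β τ' o' j| ≤ 2 * α := by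
    rw [hi1, hj1]
    set X := ∏ h ∈ s, x h
    set W := ∏ h ∈ s, w h
    have e : X * W - x j * X * (w i * W) = (1 - x j * w i) * (X * W) := by ring
    have e1 : 0 ≤ 1 - x j * w i := by nlinarith [hxm j, hwm i]
    have e2 : 1 - x j * w i ≤ 2 * α := by nlinarith [hxm j, hwm i]
    have e3 : X * W ≤ 1 := mul_le_one₀ hPx.2 hPw.1 hPw.2
    have e4 : 0 ≤ X * W := mul_nonneg hPx.1 hPw.1
    rw [e, abs_of_nonneg (mul_nonneg e1 e4)]
    nlinarith
  have hJ'2 : J' = q ^ 2 * P := by rw [hJ', sq]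
  have hq2 : 0 ≤ q ^ 2 := sq_nonneg q
  have hfin : |P - noHitProduct G p α β τ o i * noHitProduct G p α β τ' o' j| ≤
      2 * α + p * (α * (vertexDegree G i + vertexDegree G j) + Fintype.card V * α ^ 2) := by
    have := abs_sub_le P ((∏ h ∈ s, x h) * (∏ h ∈ s, w h))
      (noHitProduct G p α β τ o i * noHitProduct G p α β τ' o' j)
    linarith
  have e1 : |J - J'| ≤ q ^ 2 * α := by
    rw [abs_le]; constructor <;> linarith [mul_nonneg hq2 hα.1]
  have e2 : |J' - q ^ 2 * (noHitProduct G p α β τ o i * noHitProduct G p α β τ' o' j)| ≤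
      q ^ 2 * (2 * α +
        p * (α * (vertexDegree G i + vertexDegree G j) + Fintype.card V * α ^ 2)) := by
    rw [hJ'2, ← mul_sub, abs_mul, abs_of_nonneg hq2]
    exact mul_le_mul_of_nonneg_left hfin hq2
  have e3 := abs_sub_le J J'
    (q ^ 2 * (noHitProduct G p α β τ o i * noHitProduct G p α β τ' o' j))
  unfold pairError
  linarith

end Pairs

/-! ### First and second moments -/

section Moments

variable {Ω : Type*} [MeasurableSpace Ω] {μ : Measure Ω} [IsProbabilityMeasure μ]
  {V : Type*} [Fintype V]
  {G : SimpleGraph V} {p α β : ℝ} {Z : Ω → Finset V} {H : Ω → SimpleGraph V}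

lemma integral_sub_mul_sub {f g : Ω → ℝ} (hf : Integrable f μ) (hg : Integrable g μ)
    (hfg : Integrable (fun ω => f ω * g ω) μ) (a b : ℝ) :
    ∫ ω, (f ω - a) * (g ω - b) ∂μ =
      ∫ ω, f ω * g ω ∂μ - (∫ ω, f ω ∂μ) * b - a * (∫ ω, g ω ∂μ) + a * b := by
  have j1 : Integrable (fun ω => f ω * g ω - f ω * b) μ := hfg.sub (hf.mul_const b)
  have j2 : Integrable (fun ω => f ω * g ω - f ω * b - a * g ω) μ := j1.sub (hg.const_mul a)
  have e : ∀ ω, (f ω - a) * (g ω - b) = f ω * g ω - f ω * b - a * g ω + a * b := fun ω => by ring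
  simp only [e]
  rw [integral_add j2 (integrable_const _), integral_sub j1 (hg.const_mul a),
    integral_sub hfg (hf.mul_const b), integral_mul_const, integral_const_mul, integral_const]
  simp

/-- The method-of-moments estimator of a vertex, formed with its true degree and the true error
rates. -/
noncomputable def idealNode (p α β : ℝ) (G K : SimpleGraph V) (z : Finset V)
    (y : V → ExposureLevel → ℝ) (i : V) (t s : Bool) : ℝ :=
  (1 / treatProb p t) * ∑ s' : Bool,
    mmeCoeff (Fintype.card V) p (vertexDegree G i) α β s s' *
      observedVector G K z y i (level t s')

/-- The inverse probability weight of treatment status `t`. -/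
noncomputable def treatWeight (p : ℝ) (z : Finset V) (i : V) (t : Bool) : ℝ :=
  (1 / treatProb p t) * ind (i ∈ z ↔ t = true)

lemma treatWeight_nonneg (hp : 0 ≤ p ∧ p ≤ 1) (z : Finset V) (i : V) (t : Bool) :
    0 ≤ treatWeight p z i t := by
  refine mul_nonneg ?_ (ind_nonneg _)
  cases t <;> simp [treatProb, hp.1, hp.2]

/-- The coefficients of `idealNode` with respect to the indicators of `NoHit`; the components of `x`
are the parameters `τ`, `o` there. -/
noncomputable def idealCoeff (p α β : ℝ) (G : SimpleGraph V) (y : V → ExposureLevel → ℝ) (i : V)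
    (t s : Bool) (x : Bool × Bool) : ℝ :=
  (if x.2 then mmeCoeff (Fintype.card V) p (vertexDegree G i) α β s false -
      mmeCoeff (Fintype.card V) p (vertexDegree G i) α β s true
    else mmeCoeff (Fintype.card V) p (vertexDegree G i) α β s true) *
  (if x.1 then y i (level t false) - y i (level t true) else y i (level t true))

lemma observedVector_level (G K : SimpleGraph V) (z : Finset V) (y : V → ExposureLevel → ℝ)
    (i : V) (t s : Bool) :
    observedVector G K z y i (level t s) = ind (i ∈ z ↔ t = true) * ind (Exposed K z i ↔ s = true) *
      (ind (Exposed G z i) * y i (level t true) + ind (¬ Exposed G z i) * y i (level t false)) := by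
  rw [observedVector_eq, exposure_eq_level_iff, ind_and]
  by_cases h1 : (i ∈ z ↔ t = true)
  · by_cases h2 : Exposed G z i
    · rw [(exposure_eq_level_iff G z i t true).2 ⟨h1, by simpa using h2⟩]
      simp [ind, h2]
    · rw [(exposure_eq_level_iff G z i t false).2 ⟨h1, by simpa using h2⟩]
      simp [ind, h2]
  · rw [ind_of_not h1]
    ring

lemma ind_noHit (G K : SimpleGraph V) (z : Finset V) (τ o : Bool) (i : V) :
    ind (NoHit G K z τ o i) = (if τ then ind (¬ Exposed G z i) else 1) *
      (if o then ind (¬ Exposed K z i) else 1) := by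
  have h : NoHit G K z τ o i ↔
      ((τ = true → ¬ Exposed G z i) ∧ (o = true → ¬ Exposed K z i)) := by
    constructor
    · intro h
      exact ⟨fun h1 ⟨j, hj, hj'⟩ => h j ⟨hj, Or.inl ⟨h1, hj'⟩⟩,
        fun h1 ⟨j, hj, hj'⟩ => h j ⟨hj, Or.inr ⟨h1, hj'⟩⟩⟩
    · rintro ⟨h1, h2⟩ j ⟨hj, hj' | hj'⟩
      · exact h1 hj'.1 ⟨j, hj, hj'.2⟩
      · exact h2 hj'.1 ⟨j, hj, hj'.2⟩
  rw [h, ind_and]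
  congr 1
  · cases τ
    · simp [ind]
    · rw [show (true = true → ¬ Exposed G z i) ↔ ¬ Exposed G z i by simp, if_pos rfl]
  · cases o
    · simp [ind]
    · rw [show (true = true → ¬ Exposed K z i) ↔ ¬ Exposed K z i by simp, if_pos rfl]

lemma idealNode_eq (p α β : ℝ) (G K : SimpleGraph V) (z : Finset V)
    (y : V → ExposureLevel → ℝ) (i : V) (t s : Bool) :
    idealNode p α β G K z y i t s = ∑ x : Bool × Bool,
      idealCoeff p α β G y i t s x *
        ((1 / treatProb p t) * ind ((i ∈ z ↔ t = true) ∧ NoHit G K z x.1 x.2 i)) := by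
  unfold idealNode
  simp only [ind_and, ind_noHit, idealCoeff, Fintype.sum_prod_type, Fintype.sum_bool,
    observedVector_level, ind_not]
  have h1 : ind (Exposed K z i ↔ True) = ind (Exposed K z i) := by simp
  have h2 : ind (Exposed K z i ↔ False) = 1 - ind (Exposed K z i) := by
    rw [← ind_not]; simp
  simp only [h1, h2, if_true, Bool.false_eq_true, if_false]
  ring

lemma treatProb_pos (hp : 0 < p ∧ p < 1) (t : Bool) : 0 < treatProb p t := by
  cases t <;> simp [treatProb, hp.1, hp.2]

lemma IsNoisyExperiment.integral_noHit (hX : IsNoisyExperiment μ G p α β Z H) (hp : 0 < p ∧ p < 1)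
    (i : V) (t τ o : Bool) :
    ∫ ω, (1 / treatProb p t) * ind ((i ∈ Z ω ↔ t = true) ∧ NoHit G (H ω) (Z ω) τ o i) ∂μ =
      noHitProduct G p α β τ o i := by
  have hq := treatProb_pos hp t
  rw [integral_const_mul, integral_ind
    (hX.measurableSet_comp fun z K => (i ∈ z ↔ t = true) ∧ NoHit G K z τ o i), hX.real_noHit]
  field_simp

lemma IsNoisyExperiment.integral_idealNode_eq_sum (hX : IsNoisyExperiment μ G p α β Z H)
    (hp : 0 < p ∧ p < 1) (y : V → ExposureLevel → ℝ) (i : V) (t s : Bool) :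
    ∫ ω, idealNode p α β G (H ω) (Z ω) y i t s ∂μ = ∑ x : Bool × Bool,
      idealCoeff p α β G y i t s x * noHitProduct G p α β x.1 x.2 i := by
  simp only [idealNode_eq]
  rw [integral_finsetSum _ fun x _ => hX.integrable_comp fun z K =>
    idealCoeff p α β G y i t s x *
        ((1 / treatProb p t) * ind ((i ∈ z ↔ t = true) ∧ NoHit G K z x.1 x.2 i))]
  refine Finset.sum_congr rfl fun x _ => ?_
  rw [integral_const_mul, hX.integral_noHit hp]

lemma noHitProduct_eq_rpow (G : SimpleGraph V) (p α β : ℝ) (i : V) :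
    noHitProduct G p α β false false i = 1 ∧
    noHitProduct G p α β true false i = (1 - p) ^ (vertexDegree G i : ℝ) ∧
    noHitProduct G p α β false true i = (1 - (1 - β) * p) ^ (vertexDegree G i : ℝ) *
      (1 - α * p) ^ ((Fintype.card V : ℝ) - 1 - vertexDegree G i) ∧
    noHitProduct G p α β true true i = (1 - p) ^ (vertexDegree G i : ℝ) *
      (1 - α * p) ^ ((Fintype.card V : ℝ) - 1 - vertexDegree G i) := by
  have h1 := vertexDegree_le G i
  have h3 : 1 ≤ Fintype.card V := Fintype.card_pos_iff.2 ⟨i⟩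
  have h4 : vertexDegree G i ≤ Fintype.card V - 1 := by
    have : (vertexDegree G i : ℝ) ≤ ((Fintype.card V - 1 : ℕ) : ℝ) := by
      rw [Nat.cast_sub h3, Nat.cast_one]; exact h1
    exact_mod_cast this
  have h2 : (Fintype.card V : ℝ) - 1 - vertexDegree G i =
      ((Fintype.card V - 1 - vertexDegree G i : ℕ) : ℝ) := by
    rw [Nat.cast_sub h4, Nat.cast_sub h3, Nat.cast_one]
  rw [h2]
  simp only [Real.rpow_natCast, noHitProduct_eq]
  refine ⟨?_, ?_, ?_, ?_⟩ <;> simp [mul_comm]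

/-- The inverse confusion matrix unmixes the exposure levels: with the true degree and the true
error rates, the method-of-moments estimator of a vertex is unbiased. -/
lemma IsNoisyExperiment.integral_idealNode (hX : IsNoisyExperiment μ G p α β Z H)
    (hp : 0 < p ∧ p < 1) (y : V → ExposureLevel → ℝ) (i : V) (t s : Bool)
    (ha : (1 - p) ^ (vertexDegree G i : ℝ) ≠ 0)
    (hg : (1 - α * p) ^ ((Fintype.card V : ℝ) - 1 - vertexDegree G i) ≠ 0)
    (hb : 1 - noHitProb p (vertexDegree G i) β ≠ 0) :
    ∫ ω, idealNode p α β G (H ω) (Z ω) y i t s ∂μ = y i (level t s) := by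
  rw [hX.integral_idealNode_eq_sum hp]
  obtain ⟨e1, e2, e3, e4⟩ := noHitProduct_eq_rpow G p α β i
  simp only [Fintype.sum_prod_type, Fintype.sum_bool, e1, e2, e3, e4]
  simp only [idealCoeff, if_true, Bool.false_eq_true, if_false, mmeCoeff, invNoiseProb,
    invUntreatedProb]
  rw [show (1 - (1 - β) * p) ^ (vertexDegree G i : ℝ) = noHitProb p (vertexDegree G i) β from rfl]
  generalize (1 - p) ^ (vertexDegree G i : ℝ) = a at *
  generalize (1 - α * p) ^ ((Fintype.card V : ℝ) - 1 - vertexDegree G i) = g at *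
  generalize noHitProb p (vertexDegree G i) β = b at *
  cases s <;> simp only [invCoeff] <;> field_simp <;> ring

/-- The covariance of the ideal estimators of two vertices that are neither adjacent nor share a
neighbour. -/
lemma IsNoisyExperiment.abs_covariance_idealNode_le (hX : IsNoisyExperiment μ G p α β Z H)
    (hp : 0 < p ∧ p < 1) (hα : 0 ≤ α ∧ α ≤ 1) (hβ : 0 ≤ β ∧ β ≤ 1)
    (y : V → ExposureLevel → ℝ) (t s : Bool) {i j : V} (hij : i ≠ j) (hG : ¬ G.Adj j i)
    (hcn : ∀ h, ¬ (G.Adj h i ∧ G.Adj h j)) {K : ℝ}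
    (hKi : ∀ x, |idealCoeff p α β G y i t s x| ≤ K)
    (hKj : ∀ x, |idealCoeff p α β G y j t s x| ≤ K) :
    |∫ ω, idealNode p α β G (H ω) (Z ω) y i t s * idealNode p α β G (H ω) (Z ω) y j t s ∂μ -
      (∫ ω, idealNode p α β G (H ω) (Z ω) y i t s ∂μ) *
        ∫ ω, idealNode p α β G (H ω) (Z ω) y j t s ∂μ| ≤ 16 * K ^ 2 * pairError G p α i j := by
  have hq := treatProb_pos hp t
  have hp' : 0 ≤ p ∧ p ≤ 1 := ⟨hp.1.le, hp.2.le⟩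
  rw [hX.integral_idealNode_eq_sum hp, hX.integral_idealNode_eq_sum hp]
  have h1 : ∀ ω, idealNode p α β G (H ω) (Z ω) y i t s * idealNode p α β G (H ω) (Z ω) y j t s =
      ∑ x : Bool × Bool, ∑ x' : Bool × Bool,
        (idealCoeff p α β G y i t s x * idealCoeff p α β G y j t s x') *
        ((1 / treatProb p t ^ 2) * ind (((i ∈ Z ω ↔ t = true) ∧ (j ∈ Z ω ↔ t = true)) ∧
          (NoHit G (H ω) (Z ω) x.1 x.2 i ∧ NoHit G (H ω) (Z ω) x'.1 x'.2 j))) := by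
    intro ω
    rw [idealNode_eq, idealNode_eq, Finset.sum_mul_sum]
    refine Finset.sum_congr rfl fun x _ => Finset.sum_congr rfl fun x' _ => ?_
    simp only [ind_and]
    ring
  simp only [h1]
  rw [integral_finsetSum _ fun x _ => hX.integrable_comp fun z K => ∑ x' : Bool × Bool,
        (idealCoeff p α β G y i t s x * idealCoeff p α β G y j t s x') *
        ((1 / treatProb p t ^ 2) * ind (((i ∈ z ↔ t = true) ∧ (j ∈ z ↔ t = true)) ∧
          (NoHit G K z x.1 x.2 i ∧ NoHit G K z x'.1 x'.2 j))), Finset.sum_mul_sum,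
    ← Finset.sum_sub_distrib]
  refine (Finset.abs_sum_le_sum_abs _ _).trans ?_
  have key : ∀ x ∈ (Finset.univ : Finset (Bool × Bool)), |∫ ω, ∑ x' : Bool × Bool,
        (idealCoeff p α β G y i t s x * idealCoeff p α β G y j t s x') *
        ((1 / treatProb p t ^ 2) * ind (((i ∈ Z ω ↔ t = true) ∧ (j ∈ Z ω ↔ t = true)) ∧
          (NoHit G (H ω) (Z ω) x.1 x.2 i ∧ NoHit G (H ω) (Z ω) x'.1 x'.2 j))) ∂μ -
      ∑ x' : Bool × Bool, idealCoeff p α β G y i t s x * noHitProduct G p α β x.1 x.2 i *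
        (idealCoeff p α β G y j t s x' * noHitProduct G p α β x'.1 x'.2 j)| ≤
      4 * K ^ 2 * pairError G p α i j := by
    intro x _
    rw [integral_finsetSum _ fun x' _ => hX.integrable_comp fun z K =>
        (idealCoeff p α β G y i t s x * idealCoeff p α β G y j t s x') *
        ((1 / treatProb p t ^ 2) * ind (((i ∈ z ↔ t = true) ∧ (j ∈ z ↔ t = true)) ∧
          (NoHit G K z x.1 x.2 i ∧ NoHit G K z x'.1 x'.2 j))), ← Finset.sum_sub_distrib]
    refine (Finset.abs_sum_le_sum_abs _ _).trans ?_
    have key2 : ∀ x' ∈ (Finset.univ : Finset (Bool × Bool)), |∫ ω,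
        (idealCoeff p α β G y i t s x * idealCoeff p α β G y j t s x') *
        ((1 / treatProb p t ^ 2) * ind (((i ∈ Z ω ↔ t = true) ∧ (j ∈ Z ω ↔ t = true)) ∧
          (NoHit G (H ω) (Z ω) x.1 x.2 i ∧ NoHit G (H ω) (Z ω) x'.1 x'.2 j))) ∂μ -
       idealCoeff p α β G y i t s x * noHitProduct G p α β x.1 x.2 i *
        (idealCoeff p α β G y j t s x' * noHitProduct G p α β x'.1 x'.2 j)| ≤
        K ^ 2 * pairError G p α i j := by
      intro x' _
      have hpair := hX.abs_pair_noHit_sub_le hp' hα hβ t x.1 x.2 x'.1 x'.2 hij hG hcn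
      rw [integral_const_mul, integral_const_mul, integral_ind (hX.measurableSet_comp fun z K =>
        ((i ∈ z ↔ t = true) ∧ (j ∈ z ↔ t = true)) ∧
          (NoHit G K z x.1 x.2 i ∧ NoHit G K z x'.1 x'.2 j))]
      set J := μ.real {ω | ((i ∈ Z ω ↔ t = true) ∧ (j ∈ Z ω ↔ t = true)) ∧
          (NoHit G (H ω) (Z ω) x.1 x.2 i ∧ NoHit G (H ω) (Z ω) x'.1 x'.2 j)}
      set q := treatProb p t
      set a := idealCoeff p α β G y i t s x with ha
      set b := idealCoeff p α β G y j t s x' with hb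
      set π := noHitProduct G p α β x.1 x.2 i
      set π' := noHitProduct G p α β x'.1 x'.2 j
      have e1 : a * b * (1 / q ^ 2 * J) - a * π * (b * π') =
        (a * b) * ((1 / q ^ 2) * (J - q ^ 2 * (π * π'))) := by
        field_simp
      rw [e1, abs_mul, abs_mul a b, abs_mul, abs_of_pos (by positivity : 0 < 1 / q ^ 2)]
      have e2 : 1 / q ^ 2 * |J - q ^ 2 * (π * π')| ≤ pairError G p α i j := by
        rw [one_div, inv_mul_le_iff₀ (by positivity)]
        exact hpair
      have e3 : |a| * |b| ≤ K ^ 2 := by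
        rw [sq]
        exact mul_le_mul (hKi x) (hKj x') (abs_nonneg _) ((abs_nonneg _).trans (hKi x))
      exact mul_le_mul e3 e2 (by positivity) (sq_nonneg K)
    refine (Finset.sum_le_sum key2).trans (le_of_eq ?_)
    simp
    ring
  refine (Finset.sum_le_sum key).trans (le_of_eq ?_)
  simp
  ring

lemma abs_idealNode_le (hp : 0 < p ∧ p < 1) (K : SimpleGraph V) (z : Finset V)
    (y : V → ExposureLevel → ℝ) (i : V) (t s : Bool) {B : ℝ}
    (hB : ∀ x, |idealCoeff p α β G y i t s x| ≤ B) :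
    |idealNode p α β G K z y i t s| ≤ 4 * B * treatWeight p z i t := by
  have hq := treatProb_pos hp t
  rw [idealNode_eq]
  refine (Finset.abs_sum_le_sum_abs _ _).trans ?_
  have key : ∀ x ∈ (Finset.univ : Finset (Bool × Bool)), |idealCoeff p α β G y i t s x *
        ((1 / treatProb p t) * ind ((i ∈ z ↔ t = true) ∧ NoHit G K z x.1 x.2 i))| ≤
        B * treatWeight p z i t := by
    intro x _
    rw [abs_mul, abs_mul, abs_of_pos (by positivity : 0 < 1 / treatProb p t),
      abs_of_nonneg (ind_nonneg _)]
    refine mul_le_mul (hB x) ?_ (mul_nonneg (by positivity) (ind_nonneg _))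
      ((abs_nonneg _).trans (hB x))
    exact mul_le_mul_of_nonneg_left (ind_mono fun h => h.1) (by positivity)
  refine (Finset.sum_le_sum key).trans (le_of_eq ?_)
  simp
  ring

lemma IsNoisyExperiment.integral_treatWeight (hX : IsNoisyExperiment μ G p α β Z H)
    (hp : 0 < p ∧ p < 1) (i : V) (t : Bool) : ∫ ω, treatWeight p (Z ω) i t ∂μ = 1 := by
  have hq := treatProb_pos hp t
  unfold treatWeight
  rw [integral_const_mul, integral_ind (hX.measurableSet_comp fun z K => i ∈ z ↔ t = true),
    hX.real_treat]
  field_simp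

lemma IsNoisyExperiment.integral_treatWeight_mul (hX : IsNoisyExperiment μ G p α β Z H)
    (hp : 0 < p ∧ p < 1) {i j : V} (hij : i ≠ j) (t : Bool) :
    ∫ ω, treatWeight p (Z ω) i t * treatWeight p (Z ω) j t ∂μ = 1 := by
  classical
  have hq := treatProb_pos hp t
  have h1 : ∀ ω, treatWeight p (Z ω) i t * treatWeight p (Z ω) j t = (1 / treatProb p t ^ 2) *
      ind ((i ∈ Z ω ↔ t = true) ∧ (j ∈ Z ω ↔ t = true)) := by
    intro ω
    rw [ind_and, treatWeight, treatWeight]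
    ring
  have h2 : μ.real {ω | (i ∈ Z ω ↔ t = true) ∧ (j ∈ Z ω ↔ t = true)} = treatProb p t ^ 2 := by
    have := hX.real_pair hij t t (fun _ => Set.univ) fun _ _ _ => MeasurableSet.univ
    simpa [sq] using this
  simp only [h1]
  rw [integral_const_mul, integral_ind (hX.measurableSet_comp fun z K =>
    (i ∈ z ↔ t = true) ∧ (j ∈ z ↔ t = true)), h2]
  field_simp

lemma treatWeight_sq (z : Finset V) (i : V) (t : Bool) :
    treatWeight p z i t * treatWeight p z i t = (1 / treatProb p t) * treatWeight p z i t := by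
  unfold treatWeight
  by_cases h : (i ∈ z ↔ t = true) <;> simp [ind, h]

lemma IsNoisyExperiment.integral_sum_treatWeight_sq (hX : IsNoisyExperiment μ G p α β Z H)
    (hp : 0 < p ∧ p < 1) (t : Bool) :
    ∫ ω, (∑ i, treatWeight p (Z ω) i t) ^ 2 ∂μ ≤
      (Fintype.card V : ℝ) ^ 2 + Fintype.card V / treatProb p t := by
  classical
  have hq := treatProb_pos hp t
  rw [hX.integral_sum_sq Finset.univ fun i z _ => treatWeight p z i t]
  have h1 : ∀ i j : V, ∫ ω, treatWeight p (Z ω) i t * treatWeight p (Z ω) j t ∂μ ≤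
      1 + if i = j then 1 / treatProb p t else 0 := by
    intro i j
    by_cases hij : i = j
    · subst hij
      simp only [treatWeight_sq, if_true]
      rw [integral_const_mul, hX.integral_treatWeight hp]
      linarith
    · rw [hX.integral_treatWeight_mul hp hij, if_neg hij, add_zero]
  refine (Finset.sum_le_sum fun i _ => Finset.sum_le_sum fun j _ => h1 i j).trans (le_of_eq ?_)
  simp [Finset.sum_add_distrib, sq]
  ring

/-- The right-hand side also counts the diagonal, hence the inequality. -/
lemma sum_ind_commonNeighbor (G : SimpleGraph V) :
    ∑ i : V, ∑ j : V, ind (i ≠ j ∧ ∃ h, G.Adj h i ∧ G.Adj h j) ≤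
      (Fintype.card V : ℝ) ^ 2 - pairsWithoutCommonNeighbor G := by
  classical
  have h1 : (pairsWithoutCommonNeighbor G : ℝ) =
      ∑ q : V × V, ind (q.1 ≠ q.2 ∧ G.commonNeighbors q.1 q.2 = ∅) := by
    unfold pairsWithoutCommonNeighbor
    rw [Nat.card_eq_fintype_card, Fintype.card_subtype, Finset.card_filter]
    push_cast
    exact Finset.sum_congr rfl fun q _ => ite_eq_ind _
  rw [h1, Fintype.sum_prod_type, le_sub_iff_add_le, ← Finset.sum_add_distrib]
  calc _ ≤ ∑ i : V, ∑ j : V, (1 : ℝ) := by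
        refine Finset.sum_le_sum fun i _ => ?_
        rw [← Finset.sum_add_distrib]
        refine Finset.sum_le_sum fun j _ => ?_
        by_cases h : G.commonNeighbors i j = ∅
        · have h' : ¬ ∃ h, G.Adj h i ∧ G.Adj h j := by
            rintro ⟨h', h1, h2⟩
            have : h' ∈ G.commonNeighbors i j := ⟨h1.symm, h2.symm⟩
            rw [h] at this
            exact this
          rw [ind_of_not fun h2 => h' h2.2]
          have := ind_le_one (i ≠ j ∧ G.commonNeighbors i j = ∅)
          linarith
        · rw [ind_of_not fun h2 : i ≠ j ∧ G.commonNeighbors i j = ∅ => h h2.2]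
          have := ind_le_one (i ≠ j ∧ ∃ h, G.Adj h i ∧ G.Adj h j)
          linarith
    _ = _ := by simp [sq]

/-- The variance bound for a sum of ideal estimators: covariances are controlled for pairs that are
neither adjacent nor share a neighbour, and the other pairs are few. -/
lemma IsNoisyExperiment.integral_sum_idealNode_sub_sq_le (hX : IsNoisyExperiment μ G p α β Z H)
    (hp : 0 < p ∧ p < 1) (hα : 0 ≤ α ∧ α ≤ 1) (hβ : 0 ≤ β ∧ β ≤ 1)
    (y : V → ExposureLevel → ℝ) (t s : Bool) (T : Finset V) {B ε : ℝ} (hB0 : 0 ≤ B) (hε : 0 ≤ ε)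
    (hB : ∀ i ∈ T, ∀ x, |idealCoeff p α β G y i t s x| ≤ B)
    (hmean : ∀ i ∈ T, ∫ ω, idealNode p α β G (H ω) (Z ω) y i t s ∂μ = y i (level t s))
    (hpair : ∀ i ∈ T, ∀ j ∈ T, pairError G p α i j ≤ ε) :
    ∫ ω, (∑ i ∈ T, (idealNode p α β G (H ω) (Z ω) y i t s - y i (level t s))) ^ 2 ∂μ ≤
      32 * B ^ 2 * ((Fintype.card V : ℝ) ^ 2 * ε + Fintype.card V / treatProb p t +
        ∑ i ∈ T, (vertexDegree G i : ℝ) +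
        ((Fintype.card V : ℝ) ^ 2 - pairsWithoutCommonNeighbor G)) := by
  classical
  have hq := treatProb_pos hp t
  have hp' : 0 ≤ p ∧ p ≤ 1 := ⟨hp.1.le, hp.2.le⟩
  rw [hX.integral_sum_sq T fun i z K => idealNode p α β G K z y i t s - y i (level t s)]
  have hexp : ∀ i ∈ T, ∀ j ∈ T,
      ∫ ω, (idealNode p α β G (H ω) (Z ω) y i t s - y i (level t s)) *
        (idealNode p α β G (H ω) (Z ω) y j t s - y j (level t s)) ∂μ =
      ∫ ω, idealNode p α β G (H ω) (Z ω) y i t s * idealNode p α β G (H ω) (Z ω) y j t s ∂μ -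
        (∫ ω, idealNode p α β G (H ω) (Z ω) y i t s ∂μ) *
        ∫ ω, idealNode p α β G (H ω) (Z ω) y j t s ∂μ := by
    intro i hi j hj
    rw [integral_sub_mul_sub (hX.integrable_comp fun z K => idealNode p α β G K z y i t s)
      (hX.integrable_comp fun z K => idealNode p α β G K z y j t s)
      (hX.integrable_comp fun z K => idealNode p α β G K z y i t s * idealNode p α β G K z y j t s),
      hmean i hi, hmean j hj]
    ring
  have hmm : ∀ i ∈ T, ∀ j ∈ T, (∫ ω, idealNode p α β G (H ω) (Z ω) y i t s ∂μ) *
        ∫ ω, idealNode p α β G (H ω) (Z ω) y j t s ∂μ ≥ - (16 * B ^ 2) := by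
    have h1 : ∀ i ∈ T, |∫ ω, idealNode p α β G (H ω) (Z ω) y i t s ∂μ| ≤ 4 * B := by
      intro i hi
      refine abs_integral_le_integral_abs.trans ?_
      have : ∫ ω, |idealNode p α β G (H ω) (Z ω) y i t s| ∂μ ≤
          ∫ ω, 4 * B * treatWeight p (Z ω) i t ∂μ :=
        integral_mono (hX.integrable_comp fun z K => |idealNode p α β G K z y i t s|)
          (hX.integrable_comp fun z K => 4 * B * treatWeight p z i t)
          fun ω => abs_idealNode_le hp _ _ y i t s (hB i hi)
      rwa [integral_const_mul, hX.integral_treatWeight hp, mul_one] at this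
    intro i hi j hj
    have h2 : |(∫ ω, idealNode p α β G (H ω) (Z ω) y i t s ∂μ) *
        ∫ ω, idealNode p α β G (H ω) (Z ω) y j t s ∂μ| ≤ (4 * B) * (4 * B) := by
      rw [abs_mul]
      exact mul_le_mul (h1 i hi) (h1 j hj) (abs_nonneg _) (by positivity)
    have := (abs_le.1 h2).1
    nlinarith
  have hprod : ∀ i ∈ T, ∀ j ∈ T,
      ∫ ω, idealNode p α β G (H ω) (Z ω) y i t s * idealNode p α β G (H ω) (Z ω) y j t s ∂μ ≤
      16 * B ^ 2 * ∫ ω, treatWeight p (Z ω) i t * treatWeight p (Z ω) j t ∂μ := by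
    intro i hi j hj
    rw [← integral_const_mul]
    refine integral_mono (hX.integrable_comp fun z K =>
      idealNode p α β G K z y i t s * idealNode p α β G K z y j t s)
      (hX.integrable_comp fun z K => 16 * B ^ 2 * (treatWeight p z i t * treatWeight p z j t))
      fun ω => ?_
    refine (le_abs_self _).trans ?_
    rw [abs_mul]
    calc _ ≤ (4 * B * treatWeight p (Z ω) i t) * (4 * B * treatWeight p (Z ω) j t) :=
          mul_le_mul (abs_idealNode_le hp _ _ y i t s (hB i hi))
            (abs_idealNode_le hp _ _ y j t s (hB j hj)) (abs_nonneg _)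
            (mul_nonneg (by positivity) (treatWeight_nonneg hp' _ _ _))
      _ = _ := by ring
  have hterm : ∀ i ∈ T, ∀ j ∈ T,
      ∫ ω, (idealNode p α β G (H ω) (Z ω) y i t s - y i (level t s)) *
        (idealNode p α β G (H ω) (Z ω) y j t s - y j (level t s)) ∂μ ≤
      16 * B ^ 2 * (ε + (if i = j then 2 / treatProb p t else 0) + 2 * ind (G.Adj j i) +
        2 * ind (i ≠ j ∧ ∃ h, G.Adj h i ∧ G.Adj h j)) := by
    intro i hi j hj
    have hB2 : 0 ≤ 16 * B ^ 2 := by positivity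
    rw [hexp i hi j hj]
    have m1 := hmm i hi j hj
    have m2 := hprod i hi j hj
    have n1 := ind_nonneg (G.Adj j i)
    have n2 := ind_nonneg (i ≠ j ∧ ∃ h, G.Adj h i ∧ G.Adj h j)
    by_cases hij : i = j
    · subst hij
      simp only [treatWeight_sq] at m2
      rw [integral_const_mul, hX.integral_treatWeight hp] at m2
      have hq1 : 1 ≤ 1 / treatProb p t := by
        rw [le_div_iff₀ hq]
        cases t <;> simp [treatProb, hp.1.le, hp.2.le]
      have e1 : 16 * B ^ 2 * 1 ≤ 16 * B ^ 2 * (1 / treatProb p t) :=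
        mul_le_mul_of_nonneg_left hq1 hB2
      have e2 : 16 * B ^ 2 * (2 / treatProb p t) ≤ 16 * B ^ 2 * (ε +
          (if i = i then 2 / treatProb p t else 0) + 2 * ind (G.Adj i i) +
          2 * ind (i ≠ i ∧ ∃ h, G.Adj h i ∧ G.Adj h i)) := by
        refine mul_le_mul_of_nonneg_left ?_ hB2
        rw [if_pos rfl]
        linarith
      have e3 : 16 * B ^ 2 * (2 / treatProb p t) = 2 * (16 * B ^ 2 * (1 / treatProb p t)) := by
        ring
      linarith
    · rw [hX.integral_treatWeight_mul hp hij] at m2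
      rw [if_neg hij]
      by_cases hadj : G.Adj j i
      · rw [ind_of hadj]
        have : 16 * B ^ 2 * 2 ≤ 16 * B ^ 2 *
            (ε + 0 + 2 * 1 + 2 * ind (i ≠ j ∧ ∃ h, G.Adj h i ∧ G.Adj h j)) :=
          mul_le_mul_of_nonneg_left (by linarith) hB2
        linarith
      · by_cases hcn : ∃ h, G.Adj h i ∧ G.Adj h j
        · rw [ind_of (P := i ≠ j ∧ ∃ h, G.Adj h i ∧ G.Adj h j) ⟨hij, hcn⟩]
          have : 16 * B ^ 2 * 2 ≤ 16 * B ^ 2 * (ε + 0 + 2 * ind (G.Adj j i) + 2 * 1) :=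
            mul_le_mul_of_nonneg_left (by linarith) hB2
          linarith
        · have h1 := (le_abs_self _).trans (hX.abs_covariance_idealNode_le hp hα hβ y t s hij hadj
            (fun h hh => hcn ⟨h, hh⟩) (hB i hi) (hB j hj))
          refine h1.trans (mul_le_mul_of_nonneg_left ?_ hB2)
          have := hpair i hi j hj
          linarith
  have hnn : ∀ i j : V, 0 ≤ ε + (if i = j then 2 / treatProb p t else 0) + 2 * ind (G.Adj j i) +
        2 * ind (i ≠ j ∧ ∃ h, G.Adj h i ∧ G.Adj h j) := by
    intro i j
    have n1 := ind_nonneg (G.Adj j i)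
    have n2 := ind_nonneg (i ≠ j ∧ ∃ h, G.Adj h i ∧ G.Adj h j)
    have n3 : 0 ≤ (if i = j then 2 / treatProb p t else 0) := by split_ifs <;> positivity
    linarith
  have hrow : ∀ i : V, ∑ j : V, (ε + (if i = j then 2 / treatProb p t else 0) +
      2 * ind (G.Adj j i) + 2 * ind (i ≠ j ∧ ∃ h, G.Adj h i ∧ G.Adj h j)) =
      Fintype.card V * ε + 2 / treatProb p t + 2 * vertexDegree G i +
        2 * ∑ j : V, ind (i ≠ j ∧ ∃ h, G.Adj h i ∧ G.Adj h j) := by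
    intro i
    rw [Finset.sum_add_distrib, Finset.sum_add_distrib, Finset.sum_add_distrib, ← Finset.mul_sum,
      ← Finset.mul_sum, sum_ind_adj]
    simp
  calc _ ≤ ∑ i ∈ T, ∑ j ∈ T, 16 * B ^ 2 * (ε + (if i = j then 2 / treatProb p t else 0) +
        2 * ind (G.Adj j i) + 2 * ind (i ≠ j ∧ ∃ h, G.Adj h i ∧ G.Adj h j)) :=
        Finset.sum_le_sum fun i hi => Finset.sum_le_sum fun j hj => hterm i hi j hj
    _ = 16 * B ^ 2 * ∑ i ∈ T, ∑ j ∈ T, (ε + (if i = j then 2 / treatProb p t else 0) +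
        2 * ind (G.Adj j i) + 2 * ind (i ≠ j ∧ ∃ h, G.Adj h i ∧ G.Adj h j)) := by
        simp only [Finset.mul_sum]
    _ ≤ 16 * B ^ 2 * ∑ i ∈ T, ∑ j : V, (ε + (if i = j then 2 / treatProb p t else 0) +
        2 * ind (G.Adj j i) + 2 * ind (i ≠ j ∧ ∃ h, G.Adj h i ∧ G.Adj h j)) := by
        refine mul_le_mul_of_nonneg_left (Finset.sum_le_sum fun i _ => ?_) (by positivity)
        exact Finset.sum_le_sum_of_subset_of_nonneg (Finset.subset_univ T) fun j _ _ => hnn i j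
    _ = 16 * B ^ 2 * (∑ i ∈ T, (Fintype.card V * ε + 2 / treatProb p t +
        2 * ∑ j : V, ind (i ≠ j ∧ ∃ h, G.Adj h i ∧ G.Adj h j)) +
        2 * ∑ i ∈ T, (vertexDegree G i : ℝ)) := by
        rw [Finset.mul_sum T _ 2, ← Finset.sum_add_distrib]
        congr 1
        refine Finset.sum_congr rfl fun i _ => ?_
        rw [hrow]
        ring
    _ ≤ 16 * B ^ 2 * (∑ i : V, (Fintype.card V * ε + 2 / treatProb p t +
        2 * ∑ j : V, ind (i ≠ j ∧ ∃ h, G.Adj h i ∧ G.Adj h j)) +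
        2 * ∑ i ∈ T, (vertexDegree G i : ℝ)) := by
        refine mul_le_mul_of_nonneg_left (add_le_add_left ?_ _) (by positivity)
        refine Finset.sum_le_sum_of_subset_of_nonneg (Finset.subset_univ T) fun i _ _ => ?_
        have : 0 ≤ ∑ j : V, ind (i ≠ j ∧ ∃ h, G.Adj h i ∧ G.Adj h j) :=
          Finset.sum_nonneg fun j _ => ind_nonneg _
        positivity
    _ ≤ 16 * B ^ 2 * (2 * ((Fintype.card V : ℝ) ^ 2 * ε + Fintype.card V / treatProb p t +
        ∑ i ∈ T, (vertexDegree G i : ℝ) +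
        ((Fintype.card V : ℝ) ^ 2 - pairsWithoutCommonNeighbor G))) := by
        refine mul_le_mul_of_nonneg_left ?_ (by positivity)
        rw [Finset.sum_add_distrib, ← Finset.mul_sum, Finset.sum_const, Finset.card_univ,
          nsmul_eq_mul]
        have h1 := sum_ind_commonNeighbor G
        have h2 : 0 ≤ (Fintype.card V : ℝ) ^ 2 * ε := by positivity
        have h3 : (Fintype.card V : ℝ) * (Fintype.card V * ε + 2 / treatProb p t) =
          (Fintype.card V : ℝ) ^ 2 * ε + 2 * (Fintype.card V / treatProb p t) := by ring
        rw [h3]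
        linarith
    _ = _ := by ring

/-- The expected observed degree. -/
noncomputable def meanObservedDegree (G : SimpleGraph V) (α β : ℝ) (i : V) : ℝ :=
  vertexDegree G i * (1 - β) + ((Fintype.card V : ℝ) - 1 - vertexDegree G i) * α

lemma sum_erase_real_adj [DecidableEq V] (i : V) :
    ∑ h ∈ Finset.univ.erase i, (ind (G.Adj h i) * (1 - β) + ind (¬ G.Adj h i) * α) =
      meanObservedDegree G α β i := by
  have h1 : (ind (G.Adj i i) * (1 - β) + ind (¬ G.Adj i i) * α) = α := by simp [ind]
  have h2 := Finset.sum_erase_add Finset.univ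
    (fun h => ind (G.Adj h i) * (1 - β) + ind (¬ G.Adj h i) * α) (Finset.mem_univ i)
  simp only [h1] at h2
  have h3 : ∑ h, (ind (G.Adj h i) * (1 - β) + ind (¬ G.Adj h i) * α) =
      vertexDegree G i * (1 - β) + (Fintype.card V - vertexDegree G i) * α := by
    simp only [ind_not]
    rw [Finset.sum_add_distrib, ← Finset.sum_mul, ← Finset.sum_mul, Finset.sum_sub_distrib,
      sum_ind_adj]
    simp
  rw [h3] at h2
  unfold meanObservedDegree
  linarith

/-- Chebyshev's inequality for the observed degree. -/
lemma IsNoisyExperiment.real_degree_deviation_le (hX : IsNoisyExperiment μ G p α β Z H)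
    (hα : 0 ≤ α ∧ α ≤ 1) (hβ : 0 ≤ β ∧ β ≤ 1) (i : V) {δ : ℝ} (hδ : 0 < δ) :
    μ.real {ω | δ ≤ |(vertexDegree (H ω) i : ℝ) - meanObservedDegree G α β i|} ≤
      (vertexDegree G i + Fintype.card V * α) / δ ^ 2 := by
  classical
  set r : V → ℝ := fun h => ind (G.Adj h i) * (1 - β) + ind (¬ G.Adj h i) * α with hr
  have hr0 : ∀ h, 0 ≤ r h := fun h => add_nonneg
    (mul_nonneg (ind_nonneg _) (by linarith)) (mul_nonneg (ind_nonneg _) hα.1)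
  set U : V → SimpleGraph V → ℝ := fun h K => ind (K.Adj h i) - r h with hU
  have hdeg : ∀ ω, (vertexDegree (H ω) i : ℝ) - meanObservedDegree G α β i =
      ∑ h ∈ Finset.univ.erase i, U h (H ω) := by
    intro ω
    have h1 : ind ((H ω).Adj i i) = 0 := by simp [ind]
    have h2 := Finset.sum_erase_add Finset.univ (fun h => ind ((H ω).Adj h i)) (Finset.mem_univ i)
    simp only [h1] at h2
    rw [Finset.sum_sub_distrib, sum_erase_real_adj, ← sum_ind_adj (H ω) i]
    linarith
  have hE : ∀ h, h ≠ i → ∫ ω, ind ((H ω).Adj h i) ∂μ = r h := by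
    intro h hh
    rw [integral_ind (hX.measurable_edge h i), hX.real_adj hh]
  have hI : ∀ h, Integrable (fun ω => ind ((H ω).Adj h i)) μ := fun h =>
    integrable_ind (hX.measurable_edge h i)
  have hcross : ∀ h, h ≠ i → ∀ k, k ≠ i →
      ∫ ω, U h (H ω) * U k (H ω) ∂μ ≤ if h = k then r h else 0 := by
    intro h hh k hk
    have i1 : Integrable (fun ω => ind ((H ω).Adj h i) * ind ((H ω).Adj k i)) μ :=
      hX.integrable_comp fun z K => ind (K.Adj h i) * ind (K.Adj k i)
    simp only [hU]
    rw [integral_sub_mul_sub (hI h) (hI k) i1, hE h hh, hE k hk]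
    by_cases hhk : h = k
    · subst hhk
      rw [if_pos rfl]
      have : ∀ ω, ind ((H ω).Adj h i) * ind ((H ω).Adj h i) = ind ((H ω).Adj h i) := by
        intro ω
        rw [← ind_and]
        simp
      simp only [this]
      rw [hE h hh]
      nlinarith [mul_self_nonneg (r h)]
    · rw [if_neg hhk]
      have hd : ¬ (s(h, i) : Sym2 V).IsDiag := by simpa using hh
      have hd' : ¬ (s(k, i) : Sym2 V).IsDiag := by simpa using hk
      have hne : (s(h, i) : Sym2 V) ≠ s(k, i) := by
        intro e
        rw [Sym2.eq_iff] at e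
        rcases e with ⟨e, _⟩ | ⟨e, _⟩
        · exact hhk e
        · exact hh e
      have h2 := hX.real_inter (A := {ω | (H ω).Adj h i}) (B := {ω | (H ω).Adj k i})
        (S := {Sum.inr ⟨s(h, i), hd⟩}) (T := {Sum.inr ⟨s(k, i), hd'⟩})
        (Set.disjoint_singleton.2 (by simpa using hne))
        (measurableSet_adj hd (Set.mem_singleton _)) (measurableSet_adj hd' (Set.mem_singleton _))
      simp only [← ind_and]
      rw [integral_ind (hX.measurableSet_comp fun z K => K.Adj h i ∧ K.Adj k i)]
      have h3 : μ.real {ω | (H ω).Adj h i ∧ (H ω).Adj k i} = r h * r k := by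
        rw [← hE h hh, ← hE k hk, integral_ind (hX.measurable_edge h i),
          integral_ind (hX.measurable_edge k i), ← h2]
        rfl
      rw [h3]
      linarith
  have hvar : ∫ ω, (∑ h ∈ Finset.univ.erase i, U h (H ω)) ^ 2 ∂μ ≤
      vertexDegree G i + Fintype.card V * α := by
    rw [hX.integral_sum_sq (Finset.univ.erase i) fun h z K => U h K]
    calc _ ≤ ∑ h ∈ Finset.univ.erase i, ∑ k ∈ Finset.univ.erase i, (if h = k then r h else 0) :=
          Finset.sum_le_sum fun h hh => Finset.sum_le_sum fun k hk =>
            hcross h (Finset.ne_of_mem_erase hh) k (Finset.ne_of_mem_erase hk)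
      _ = ∑ h ∈ Finset.univ.erase i, r h := by
          refine Finset.sum_congr rfl fun h hh => ?_
          rw [Finset.sum_ite_eq, if_pos hh]
      _ = meanObservedDegree G α β i := sum_erase_real_adj i
      _ ≤ _ := by
          unfold meanObservedDegree
          have h0 : (0 : ℝ) ≤ vertexDegree G i := Nat.cast_nonneg _
          have h1 : (vertexDegree G i : ℝ) * (1 - β) ≤ vertexDegree G i * 1 :=
            mul_le_mul_of_nonneg_left (by linarith) h0
          have h2 : ((Fintype.card V : ℝ) - 1 - vertexDegree G i) * α ≤ Fintype.card V * α :=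
            mul_le_mul_of_nonneg_right (by linarith) hα.1
          linarith
  have hmarkov := mul_meas_ge_le_integral_of_nonneg (μ := μ)
    (f := fun ω => (∑ h ∈ Finset.univ.erase i, U h (H ω)) ^ 2)
    (Eventually.of_forall fun ω => sq_nonneg _)
    (hX.integrable_comp fun z K => (∑ h ∈ Finset.univ.erase i, U h K) ^ 2) (δ ^ 2)
  rw [le_div_iff₀ (by positivity), mul_comm]
  refine le_trans ?_ hvar
  refine le_trans (le_of_eq ?_) hmarkov
  congr 2
  ext ω
  simp only [Set.mem_ofPred_eq]
  rw [hdeg, ← sq_abs (∑ h ∈ Finset.univ.erase i, U h (H ω))]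
  exact (pow_le_pow_iff_left₀ hδ.le (abs_nonneg _) two_ne_zero).symm

end Moments

/-! ### Bounds for the coefficients of the inverse confusion matrix -/

lemma neg_log_one_sub_le {x : ℝ} (hx : 0 ≤ x) (hx' : x ≤ 1 / 2) :
    -Real.log (1 - x) ≤ x + 2 * x ^ 2 := by
  have h1 : 0 < 1 - x := by linarith
  have h2 := Real.one_sub_inv_le_log_of_pos h1
  have h3 : (1 - x)⁻¹ ≤ 1 + x + 2 * x ^ 2 := by
    rw [inv_le_iff_one_le_mul₀ h1]
    nlinarith [mul_nonneg hx hx, mul_nonneg (mul_nonneg hx hx) (by linarith : 0 ≤ 1 / 2 - x)]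
  linarith

lemma neg_log_one_sub_le_two_mul {x : ℝ} (hx : 0 ≤ x) (hx' : x ≤ 1 / 2) :
    -Real.log (1 - x) ≤ 2 * x := by
  have := neg_log_one_sub_le hx hx'
  nlinarith

lemma neg_log_one_sub_nonneg {x : ℝ} (hx : 0 ≤ x) (hx' : x ≤ 1 / 2) :
    0 ≤ -Real.log (1 - x) := by
  have := Real.log_nonpos (x := 1 - x) (by linarith) (by linarith)
  linarith

lemma abs_log_one_sub_sub_le {x w : ℝ} (hx : x ≤ 1 / 2) (hw : w ≤ 1 / 2) :
    |Real.log (1 - x) - Real.log (1 - w)| ≤ 2 * |x - w| := by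
  have key : ∀ a b : ℝ, a ≤ 1 / 2 → b ≤ 1 / 2 →
      Real.log (1 - a) - Real.log (1 - b) ≤ 2 * |a - b| := by
    intro a b ha hb
    have h1 : 0 < 1 - a := by linarith
    have h2 : 0 < 1 - b := by linarith
    rw [← Real.log_div h1.ne' h2.ne']
    have h3 := Real.log_le_sub_one_of_pos (div_pos h1 h2)
    have h4 : (1 - a) / (1 - b) - 1 = (b - a) / (1 - b) := by field_simp; ring
    have h5 : (b - a) / (1 - b) ≤ 2 * |a - b| := by
      rw [div_le_iff₀ h2]
      have h6 : b - a ≤ |a - b| := by rw [abs_sub_comm]; exact le_abs_self _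
      nlinarith [abs_nonneg (a - b)]
    linarith
  rw [abs_le]
  have h1 := key x w hx hw
  have h2 := key w x hw hx
  rw [abs_sub_comm w x] at h2
  constructor <;> linarith

lemma invUntreatedProb_eq_exp {p : ℝ} (hp : p < 1) (d : ℝ) :
    invUntreatedProb p d = Real.exp (d * -Real.log (1 - p)) := by
  rw [invUntreatedProb, Real.rpow_def_of_pos (by linarith), ← Real.exp_neg]
  congr 1
  ring

lemma invNoiseProb_eq_exp {α p : ℝ} (h : α * p < 1) (N : ℕ) (d : ℝ) :
    invNoiseProb N p d α = Real.exp (((N : ℝ) - 1 - d) * -Real.log (1 - α * p)) := by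
  rw [invNoiseProb, Real.rpow_def_of_pos (by linarith), ← Real.exp_neg]
  congr 1
  ring

lemma noHitProb_eq_exp {β p : ℝ} (h : (1 - β) * p < 1) (d : ℝ) :
    noHitProb p d β = Real.exp (-(d * -Real.log (1 - (1 - β) * p))) := by
  rw [noHitProb, Real.rpow_def_of_pos (by linarith)]
  congr 1
  ring

lemma one_le_invUntreatedProb {p d : ℝ} (hp : 0 ≤ p) (hp' : p ≤ 1 / 2) (hd : 0 ≤ d) :
    1 ≤ invUntreatedProb p d := by
  rw [invUntreatedProb_eq_exp (by linarith), Real.one_le_exp_iff]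
  exact mul_nonneg hd (neg_log_one_sub_nonneg hp hp')

lemma invUntreatedProb_le_exp {p d X : ℝ} (hp : 0 ≤ p) (hp' : p ≤ 1 / 2)
    (hd : p * d ≤ X) (hX : 0 ≤ X) (hpX : 2 * p * X ≤ 1) :
    invUntreatedProb p d ≤ Real.exp (X + 1) := by
  rw [invUntreatedProb_eq_exp (by linarith), Real.exp_le_exp]
  have h1 := neg_log_one_sub_le hp hp'
  have h2 := neg_log_one_sub_nonneg hp hp'
  by_cases hd0 : 0 ≤ d
  · have h3 := mul_le_mul_of_nonneg_left h1 hd0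
    have h4 : p * (p * d) ≤ p * X := mul_le_mul_of_nonneg_left hd hp
    nlinarith
  · have h3 : d * -Real.log (1 - p) ≤ 0 := mul_nonpos_of_nonpos_of_nonneg (by linarith) h2
    linarith

lemma one_le_invNoiseProb {p d α : ℝ} {N : ℕ} (hα : 0 ≤ α * p) (hα' : α * p ≤ 1 / 2)
    (hd : d ≤ (N : ℝ) - 1) : 1 ≤ invNoiseProb N p d α := by
  rw [invNoiseProb_eq_exp (by linarith), Real.one_le_exp_iff]
  exact mul_nonneg (by linarith) (neg_log_one_sub_nonneg hα hα')

lemma invNoiseProb_le_exp {p d α A : ℝ} {N : ℕ} (hα : 0 ≤ α * p) (hα' : α * p ≤ 1 / 2)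
    (hd0 : 0 ≤ d) (hA : p * N * α ≤ A) : invNoiseProb N p d α ≤ Real.exp (2 * A) := by
  rw [invNoiseProb_eq_exp (by linarith), Real.exp_le_exp]
  have h1 := neg_log_one_sub_le_two_mul hα hα'
  have h2 := neg_log_one_sub_nonneg hα hα'
  calc ((N : ℝ) - 1 - d) * -Real.log (1 - α * p) ≤ N * -Real.log (1 - α * p) :=
        mul_le_mul_of_nonneg_right (by linarith) h2
    _ ≤ N * (2 * (α * p)) := mul_le_mul_of_nonneg_left h1 (Nat.cast_nonneg N)
    _ ≤ 2 * A := by linarith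

/-- Bernoulli's inequality `(1 - p) ^ α ≤ 1 - α p` bounds the noise factor by the observed degree
`D`, whatever the error rate: if the rate explains `(N - 1) α ≤ D + s` observed edges, then `1 / g`
is at most the inverse of the probability that `D + s` vertices are untreated. -/
lemma invNoiseProb_le_rpow {p d α D s : ℝ} {N : ℕ} (hp : 0 ≤ p) (hp' : p ≤ 1 / 2)
    (hα : 0 ≤ α) (hα' : α ≤ 1) (hd0 : 0 ≤ d) (hd : d ≤ (N : ℝ) - 1)
    (hD : ((N : ℝ) - 1) * α ≤ D + s) :
    invNoiseProb N p d α ≤ invUntreatedProb p (D + s) := by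
  have h1 : 0 < 1 - p := by linarith
  have hB := rpow_one_add_le_one_add_mul_self (s := -p) (by linarith) hα hα'
  have h2 : (1 - p) ^ α ≤ 1 - α * p := by
    have e1 : 1 + -p = 1 - p := by ring
    have e2 : 1 + α * -p = 1 - α * p := by ring
    rwa [e1, e2] at hB
  have h3 : 0 < (1 - p) ^ α := Real.rpow_pos_of_pos h1 α
  have h4 : (1 - p) ^ (D + s) ≤ (1 - α * p) ^ ((N : ℝ) - 1 - d) := by
    calc (1 - p) ^ (D + s) ≤ (1 - p) ^ (α * ((N : ℝ) - 1 - d)) := by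
          refine Real.rpow_le_rpow_of_exponent_ge h1 (by linarith) ?_
          nlinarith
      _ = ((1 - p) ^ α) ^ ((N : ℝ) - 1 - d) := Real.rpow_mul h1.le _ _
      _ ≤ _ := Real.rpow_le_rpow h3.le h2 (by linarith)
  unfold invNoiseProb invUntreatedProb
  exact inv_anti₀ (Real.rpow_pos_of_pos h1 _) h4

lemma invUntreatedProb_add {p : ℝ} (hp' : p ≤ 1 / 2) (d s : ℝ) :
    invUntreatedProb p (d + s) = invUntreatedProb p d * invUntreatedProb p s := by
  rw [invUntreatedProb_eq_exp (by linarith), invUntreatedProb_eq_exp (by linarith),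
    invUntreatedProb_eq_exp (by linarith), ← Real.exp_add]
  congr 1
  ring

lemma inv_one_sub_exp_neg_le {s : ℝ} (hs : 0 < s) : (1 - Real.exp (-s))⁻¹ ≤ 1 + 1 / s := by
  have h1 := Real.add_one_le_exp s
  have h2 : Real.exp (-s) ≤ (1 + s)⁻¹ := by
    rw [Real.exp_neg]
    exact inv_anti₀ (by linarith) (by linarith)
  have h3 : s / (1 + s) ≤ 1 - Real.exp (-s) := by
    have : s / (1 + s) = 1 - (1 + s)⁻¹ := by field_simp; ring
    linarith
  calc (1 - Real.exp (-s))⁻¹ ≤ (s / (1 + s))⁻¹ := inv_anti₀ (by positivity) h3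
    _ = 1 + 1 / s := by field_simp; ring

lemma noHitProb_le_exp {p d β b : ℝ} (hp : 0 ≤ p) (hb : b ≤ 1 - β)
    (hβp : (1 - β) * p ≤ 1 / 2) (hd : 0 ≤ d) : noHitProb p d β ≤ Real.exp (-(b * (p * d))) := by
  rw [noHitProb_eq_exp (by linarith), Real.exp_le_exp, neg_le_neg_iff]
  have h1 := Real.log_le_sub_one_of_pos (x := 1 - (1 - β) * p) (by linarith)
  have h2 : b * p ≤ -Real.log (1 - (1 - β) * p) := by
    have := mul_le_mul_of_nonneg_right hb hp
    linarith
  have := mul_le_mul_of_nonneg_left h2 hd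
  linarith

lemma noHitProb_lt_one {p d β b : ℝ} (hp : 0 < p) (hb0 : 0 < b) (hb : b ≤ 1 - β)
    (hβp : (1 - β) * p ≤ 1 / 2) (hd : 0 < d) : noHitProb p d β < 1 := by
  refine (noHitProb_le_exp hp.le hb hβp hd.le).trans_lt ?_
  rw [Real.exp_lt_one_iff]
  have : 0 < b * (p * d) := by positivity
  linarith

lemma inv_one_sub_noHitProb_le {p d β b y : ℝ} (hp : 0 < p) (hb0 : 0 < b) (hb : b ≤ 1 - β)
    (hβp : (1 - β) * p ≤ 1 / 2) (hy : 0 < y) (hd : y ≤ p * d) :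
    (1 - noHitProb p d β)⁻¹ ≤ 1 + 1 / (b * y) := by
  have hd0 : 0 < d := by
    by_contra h
    have := mul_nonpos_of_nonneg_of_nonpos hp.le (not_lt.1 h)
    linarith
  have h1 := noHitProb_le_exp hp.le hb hβp hd0.le
  have hby : 0 < b * y := by positivity
  have h2 : Real.exp (-(b * (p * d))) ≤ Real.exp (-(b * y)) := by
    rw [Real.exp_le_exp, neg_le_neg_iff]
    exact mul_le_mul_of_nonneg_left hd hb0.le
  have h3 : Real.exp (-(b * y)) < 1 := by
    rw [Real.exp_lt_one_iff]; linarith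
  refine le_trans (inv_anti₀ (by linarith) (by linarith)) (inv_one_sub_exp_neg_le hby)

lemma noHitProb_nonneg {p d β : ℝ} (hβp : (1 - β) * p ≤ 1 / 2) : 0 ≤ noHitProb p d β :=
  Real.rpow_nonneg (by linarith) _

lemma abs_invCoeff_true_le {u v b W : ℝ} (hv : 1 ≤ v) (hb : 0 ≤ b) (hb1 : b < 1)
    (hW : (1 - b)⁻¹ ≤ W) (s : Bool) : |invCoeff u v b s true| ≤ v * W := by
  have h0 : 0 < (1 - b)⁻¹ := inv_pos.2 (by linarith)
  cases s
  · simp only [invCoeff, div_eq_mul_inv]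
    rw [abs_mul, abs_of_pos h0]
    refine mul_le_mul ?_ hW h0.le (by linarith)
    rw [abs_le]
    constructor <;> nlinarith
  · simp only [invCoeff, div_eq_mul_inv, one_mul]
    rw [abs_of_pos h0]
    nlinarith

lemma abs_invCoeff_false_le {u v b W : ℝ} (hu : 1 ≤ u) (hv : 1 ≤ v) (hb : 0 ≤ b) (hb1 : b < 1)
    (hW : (1 - b)⁻¹ ≤ W) (s : Bool) : |invCoeff u v b s false| ≤ 2 * (u * (v * W)) := by
  have h0 : 0 < (1 - b)⁻¹ := inv_pos.2 (by linarith)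
  have huv : 1 ≤ u * v := by nlinarith
  have hu' : u ≤ u * v := by nlinarith
  have hv' : v ≤ u * v := by nlinarith
  have hbv : b * v ≤ v := by nlinarith
  have hbv0 : 0 ≤ b * v := by positivity
  have e : 2 * (u * (v * W)) = (2 * (u * v)) * W := by ring
  rw [e]
  cases s <;> simp only [invCoeff, div_eq_mul_inv] <;> rw [abs_mul, abs_of_pos h0] <;>
    refine mul_le_mul ?_ hW h0.le (by linarith) <;> rw [abs_le] <;> constructor <;> linarith

/-- Lipschitz dependence of the coefficients on `u`, `v`, `b`. -/
lemma abs_invCoeff_sub_le {u v b u' v' b' W η : ℝ} (hu : 1 ≤ u) (hv : 1 ≤ v) (hb : 0 ≤ b)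
    (hb1 : b < 1) (hb1' : b' < 1) (hW : (1 - b)⁻¹ ≤ W) (hW' : (1 - b')⁻¹ ≤ W) (hW1 : 1 ≤ W)
    (hη : 0 ≤ η) (hη1 : η ≤ 1) (du : |u' - u| ≤ 2 * η * u) (dv : |v' - v| ≤ 2 * η * v)
    (db : |b' - b| ≤ 2 * η) (s s' : Bool) :
    |invCoeff u' v' b' s s' - invCoeff u v b s s'| ≤ 22 * η * (u * v) * W ^ 2 := by
  have huv : 1 ≤ u * v := by nlinarith
  have hu' : u ≤ u * v := by nlinarith
  have hv' : v ≤ u * v := by nlinarith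
  have h0 : 0 < (1 - b)⁻¹ := inv_pos.2 (by linarith)
  have h0' : 0 < (1 - b')⁻¹ := inv_pos.2 (by linarith)
  have hv3 : |v'| ≤ 3 * v := by
    have := abs_sub_abs_le_abs_sub v' v
    rw [abs_of_nonneg (by linarith : 0 ≤ v)] at this
    have := mul_le_mul_of_nonneg_right hη1 (by linarith : 0 ≤ v)
    linarith
  -- the general estimate for a quotient `n / (1 - b)`
  have key : ∀ n n' : ℝ, |n| ≤ 2 * (u * v) → |n' - n| ≤ 18 * η * (u * v) →
      |n' / (1 - b') - n / (1 - b)| ≤ 22 * η * (u * v) * W ^ 2 := by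
    intro n n' hn hn'
    have h1 : (1 - b) ≠ 0 := by linarith
    have h1' : (1 - b') ≠ 0 := by linarith
    have e : n' / (1 - b') - n / (1 - b) =
        (n' - n) * (1 - b')⁻¹ + n * ((b' - b) * ((1 - b)⁻¹ * (1 - b')⁻¹)) := by
      field_simp
      ring
    rw [e]
    refine (abs_add_le _ _).trans ?_
    rw [abs_mul, abs_mul, abs_mul, abs_mul, abs_of_pos h0, abs_of_pos h0']
    have t1 : |n' - n| * (1 - b')⁻¹ ≤ 18 * η * (u * v) * W :=
      mul_le_mul hn' hW' h0'.le (by positivity)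
    have t2 : (1 - b)⁻¹ * (1 - b')⁻¹ ≤ W * W := mul_le_mul hW hW' h0'.le (by linarith)
    have t3 : |b' - b| * ((1 - b)⁻¹ * (1 - b')⁻¹) ≤ (2 * η) * (W * W) :=
      mul_le_mul db t2 (by positivity) (by positivity)
    have t4 : |n| * (|b' - b| * ((1 - b)⁻¹ * (1 - b')⁻¹)) ≤
        (2 * (u * v)) * ((2 * η) * (W * W)) :=
      mul_le_mul hn t3 (by positivity) (by positivity)
    have t5 : 18 * η * (u * v) * W ≤ 18 * η * (u * v) * (W * W) :=
      mul_le_mul_of_nonneg_left (le_mul_of_one_le_left (by linarith) hW1) (by positivity)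
    linarith
  have hηuv : 0 ≤ η * (u * v) := by positivity
  have hηu : η * u ≤ η * (u * v) := mul_le_mul_of_nonneg_left hu' hη
  have hηv : η * v ≤ η * (u * v) := mul_le_mul_of_nonneg_left hv' hη
  have hbv : b * v ≤ v := by nlinarith
  have hbv0 : 0 ≤ b * v := by positivity
  have duv : |u' * v' - u * v| ≤ 8 * (η * (u * v)) := by
    have e : u' * v' - u * v = (u' - u) * v' + u * (v' - v) := by ring
    rw [e]
    refine (abs_add_le _ _).trans ?_
    rw [abs_mul, abs_mul, abs_of_nonneg (by linarith : 0 ≤ u)]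
    have t1 : |u' - u| * |v'| ≤ (2 * η * u) * (3 * v) :=
      mul_le_mul du hv3 (abs_nonneg _) (by positivity)
    have t2 : u * |v' - v| ≤ u * (2 * η * v) := mul_le_mul_of_nonneg_left dv (by linarith)
    linarith
  have dbv : |b' * v' - b * v| ≤ 8 * (η * (u * v)) := by
    have e : b' * v' - b * v = (b' - b) * v' + b * (v' - v) := by ring
    rw [e]
    refine (abs_add_le _ _).trans ?_
    rw [abs_mul, abs_mul, abs_of_nonneg hb]
    have t1 : |b' - b| * |v'| ≤ (2 * η) * (3 * v) :=
      mul_le_mul db hv3 (abs_nonneg _) (by positivity)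
    have t2 : b * |v' - v| ≤ 1 * (2 * η * v) :=
      mul_le_mul hb1.le dv (abs_nonneg _) zero_le_one
    linarith
  have du' : |u' - u| ≤ 2 * (η * (u * v)) := by linarith
  have a1 := abs_le.1 duv
  have a2 := abs_le.1 dbv
  have a3 := abs_le.1 du'
  cases s <;> cases s' <;> refine key _ _ ?_ ?_ <;> rw [abs_le] <;> constructor <;> linarith

lemma abs_exp_sub_exp_le {s t η : ℝ} (h : |s - t| ≤ η) (hη : η ≤ 1) :
    |Real.exp s - Real.exp t| ≤ 2 * η * Real.exp t := by
  have h1 : Real.exp s - Real.exp t = (Real.exp (s - t) - 1) * Real.exp t := by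
    rw [sub_mul, ← Real.exp_add]; simp
  rw [h1, abs_mul, Real.abs_exp]
  refine mul_le_mul_of_nonneg_right ?_ (Real.exp_pos t).le
  exact (Real.abs_exp_sub_one_le (h.trans hη)).trans (by linarith)

/-- The coefficients at estimated arguments are close to those at the true ones. Here `θ` bounds
the scaled error of the degree, `e` the errors of the rates, and `y` the scaled degrees from
below. -/
lemma abs_mmeCoeff_sub_le {N : ℕ} {p d α β d' α' β' θ e A R b y : ℝ} (hp : 0 < p) (hp' : p ≤ 1 / 4)
    (hd : p * d ≤ R) (hdN : d ≤ (N : ℝ) - 1)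
    (hα : 0 ≤ α ∧ α ≤ 1) (hα' : 0 ≤ α' ∧ α' ≤ 1) (hb : 0 < b) (hβ : b ≤ 1 - β ∧ 1 - β ≤ 2)
    (hβ' : b ≤ 1 - β' ∧ 1 - β' ≤ 2) (hy : 0 < y) (hyd : y ≤ p * d) (hyd' : y ≤ p * d')
    (hA : p * N * α ≤ A) (hR : 0 ≤ R) (he : 0 ≤ e)
    (hdd : p * |d' - d| ≤ θ) (hαα : |α' - α| ≤ e * α) (hββ : |β' - β| ≤ e)
    (hη1 : 4 * θ + 2 * (R + A) * e ≤ 1) (s s' : Bool) :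
    |mmeCoeff N p d' α' β' s s' - mmeCoeff N p d α β s s'| ≤
      22 * (4 * θ + 2 * (R + A) * e) * (Real.exp (2 * A) * invUntreatedProb p d) *
        (1 + 1 / (b * y)) ^ 2 := by
  have hθ : 0 ≤ θ := (mul_nonneg hp.le (abs_nonneg _)).trans hdd
  have hA0 : 0 ≤ A := (by have := hα.1; positivity : 0 ≤ p * N * α).trans hA
  set η := 4 * θ + 2 * (R + A) * e with hη
  have hη0 : 0 ≤ η := by positivity
  have pos_of : ∀ x, y ≤ p * x → 0 < x := by
    intro x hx
    by_contra h
    have := mul_nonpos_of_nonneg_of_nonpos hp.le (not_lt.1 h)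
    linarith
  have hd0 := pos_of d hyd
  have hd0' := pos_of d' hyd'
  have hαp : 0 ≤ α * p ∧ α * p ≤ 1 / 4 :=
    ⟨mul_nonneg hα.1 hp.le, by linarith [mul_le_mul_of_nonneg_right hα.2 hp.le]⟩
  have hαp' : 0 ≤ α' * p ∧ α' * p ≤ 1 / 4 :=
    ⟨mul_nonneg hα'.1 hp.le, by linarith [mul_le_mul_of_nonneg_right hα'.2 hp.le]⟩
  have hβp : 0 ≤ (1 - β) * p ∧ (1 - β) * p ≤ 1 / 2 :=
    ⟨mul_nonneg (by linarith) hp.le, by linarith [mul_le_mul_of_nonneg_right hβ.2 hp.le]⟩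
  have hβp' : 0 ≤ (1 - β') * p ∧ (1 - β') * p ≤ 1 / 2 :=
    ⟨mul_nonneg (by linarith) hp.le, by linarith [mul_le_mul_of_nonneg_right hβ'.2 hp.le]⟩
  have hu1 : 1 ≤ invNoiseProb N p d α := one_le_invNoiseProb hαp.1 (by linarith) hdN
  have huA : invNoiseProb N p d α ≤ Real.exp (2 * A) :=
    invNoiseProb_le_exp hαp.1 (by linarith) hd0.le hA
  have hv1 : 1 ≤ invUntreatedProb p d := one_le_invUntreatedProb hp.le (by linarith) hd0.le
  -- differences of the exponents
  have dv : |invUntreatedProb p d' - invUntreatedProb p d| ≤ 2 * η * invUntreatedProb p d := by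
    rw [invUntreatedProb_eq_exp (by linarith), invUntreatedProb_eq_exp (by linarith)]
    refine abs_exp_sub_exp_le ?_ hη1
    have h2 := neg_log_one_sub_nonneg hp.le (by linarith)
    rw [← sub_mul, abs_mul, abs_of_nonneg h2]
    calc |d' - d| * -Real.log (1 - p) ≤ |d' - d| * (2 * p) :=
          mul_le_mul_of_nonneg_left (neg_log_one_sub_le_two_mul hp.le (by linarith)) (abs_nonneg _)
      _ ≤ 2 * θ := by linarith
      _ ≤ η := by
          have := mul_nonneg (add_nonneg hR hA0) he
          rw [hη]
          linarith
  have du : |invNoiseProb N p d' α' - invNoiseProb N p d α| ≤ 2 * η * invNoiseProb N p d α := by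
    rw [invNoiseProb_eq_exp (by linarith), invNoiseProb_eq_exp (by linarith)]
    refine abs_exp_sub_exp_le ?_ hη1
    have h2 := neg_log_one_sub_nonneg hαp'.1 (by linarith)
    have e1 : ((N : ℝ) - 1 - d') * -Real.log (1 - α' * p) - (N - 1 - d) * -Real.log (1 - α * p) =
        (d - d') * -Real.log (1 - α' * p) -
          (N - 1 - d) * (Real.log (1 - α' * p) - Real.log (1 - α * p)) := by ring
    rw [e1]
    refine (abs_sub _ _).trans ?_
    rw [abs_mul, abs_mul, abs_of_nonneg h2, abs_of_nonneg (by linarith : 0 ≤ (N : ℝ) - 1 - d),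
      abs_sub_comm d d']
    have t1 : |d' - d| * -Real.log (1 - α' * p) ≤ |d' - d| * (2 * p) := by
      refine mul_le_mul_of_nonneg_left ?_ (abs_nonneg _)
      have := neg_log_one_sub_le_two_mul hαp'.1 (by linarith)
      have := mul_le_mul_of_nonneg_right hα'.2 hp.le
      linarith
    have t2 : |Real.log (1 - α' * p) - Real.log (1 - α * p)| ≤ 2 * (e * α * p) := by
      refine (abs_log_one_sub_sub_le (by linarith) (by linarith)).trans ?_
      rw [← sub_mul, abs_mul, abs_of_pos hp]
      have := mul_le_mul_of_nonneg_right hαα hp.le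
      linarith
    have t3 : ((N : ℝ) - 1 - d) * |Real.log (1 - α' * p) - Real.log (1 - α * p)| ≤
        N * (2 * (e * α * p)) :=
      mul_le_mul (by linarith) t2 (abs_nonneg _) (Nat.cast_nonneg N)
    have t4 : (N : ℝ) * (2 * (e * α * p)) = 2 * e * (p * N * α) := by ring
    have t5 : 2 * e * (p * N * α) ≤ 2 * e * A := mul_le_mul_of_nonneg_left hA (by positivity)
    have := mul_nonneg hR he
    rw [hη]
    linarith
  have hb0 := noHitProb_nonneg (p := p) (d := d) (β := β) hβp.2
  have hb1 := noHitProb_lt_one hp hb hβ.1 hβp.2 hd0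
  have hb1' := noHitProb_lt_one hp hb hβ'.1 hβp'.2 hd0'
  have db : |noHitProb p d' β' - noHitProb p d β| ≤ 2 * η := by
    have : |noHitProb p d' β' - noHitProb p d β| ≤ 2 * η * noHitProb p d β := by
      rw [noHitProb_eq_exp (by linarith), noHitProb_eq_exp (by linarith)]
      refine abs_exp_sub_exp_le ?_ hη1
      have h2 := neg_log_one_sub_nonneg hβp'.1 (by linarith)
      have e1 : -(d' * -Real.log (1 - (1 - β') * p)) - -(d * -Real.log (1 - (1 - β) * p)) =
          (d - d') * -Real.log (1 - (1 - β') * p) +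
            d * (Real.log (1 - (1 - β') * p) - Real.log (1 - (1 - β) * p)) := by ring
      rw [e1]
      refine (abs_add_le _ _).trans ?_
      rw [abs_mul, abs_mul, abs_of_nonneg h2, abs_of_pos hd0, abs_sub_comm d d']
      have t1 : |d' - d| * -Real.log (1 - (1 - β') * p) ≤ |d' - d| * (4 * p) := by
        refine mul_le_mul_of_nonneg_left ?_ (abs_nonneg _)
        have := neg_log_one_sub_le_two_mul hβp'.1 (by linarith)
        have := mul_le_mul_of_nonneg_right hβ'.2 hp.le
        linarith
      have t2 : |Real.log (1 - (1 - β') * p) - Real.log (1 - (1 - β) * p)| ≤ 2 * (e * p) := by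
        refine (abs_log_one_sub_sub_le (by linarith) (by linarith)).trans ?_
        rw [← sub_mul, abs_mul, abs_of_pos hp]
        have e2 : |1 - β' - (1 - β)| = |β' - β| := by rw [abs_sub_comm]; congr 1; ring
        rw [e2]
        have := mul_le_mul_of_nonneg_right hββ hp.le
        linarith
      have t3 := mul_le_mul_of_nonneg_left t2 hd0.le
      have t4 : d * (2 * (e * p)) = 2 * e * (p * d) := by ring
      have t5 : 2 * e * (p * d) ≤ 2 * e * R := mul_le_mul_of_nonneg_left hd (by positivity)
      have := mul_nonneg hA0 he
      rw [hη]
      linarith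
    exact this.trans (mul_le_of_le_one_right (by positivity) hb1.le)
  have hW := inv_one_sub_noHitProb_le hp hb hβ.1 hβp.2 hy hyd
  have hW' := inv_one_sub_noHitProb_le hp hb hβ'.1 hβp'.2 hy hyd'
  have hby : 0 < 1 / (b * y) := by positivity
  refine (abs_invCoeff_sub_le hu1 hv1 hb0 hb1 hb1' hW hW' (by linarith) hη0 hη1 du dv db s s').trans
    ?_
  have : invNoiseProb N p d α * invUntreatedProb p d ≤ Real.exp (2 * A) * invUntreatedProb p d :=
    mul_le_mul_of_nonneg_right huA (by linarith)
  exact mul_le_mul_of_nonneg_right (mul_le_mul_of_nonneg_left this (by positivity)) (sq_nonneg _)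

/-! ### Bounds for the estimator of a single vertex -/

section Node

variable {V : Type*} [Fintype V] {G K : SimpleGraph V} {p α β : ℝ} {z : Finset V}
  {y : V → ExposureLevel → ℝ} {i : V} {c : ℝ}

lemma abs_observedVector_le (hc : ∀ k, |y i k| ≤ c) (t s : Bool) :
    |observedVector G K z y i (level t s)| ≤
      c * (ind (i ∈ z ↔ t = true) * ind (Exposed K z i ↔ s = true)) := by
  rw [observedVector_eq, exposure_eq_level_iff, ind_and, abs_mul,
    abs_of_nonneg (mul_nonneg (ind_nonneg _) (ind_nonneg _)), mul_comm]
  exact mul_le_mul_of_nonneg_right (hc _) (mul_nonneg (ind_nonneg _) (ind_nonneg _))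

lemma ipw_level_false (hp : 0 < p ∧ p < 1) (t : Bool) :
    ipw p K z i (level t false) =
      treatWeight p z i t * ind (¬ Exposed K z i) * invUntreatedProb p (vertexDegree K i) := by
  have hq := treatProb_pos hp t
  have h1 : 0 < (1 - p) ^ vertexDegree K i := pow_pos (by linarith) _
  unfold ipw
  rw [exposureProb_level_false, ind_of (mul_pos hq h1), exposure_eq_level_iff, ind_and,
    invUntreatedProb, Real.rpow_natCast, treatWeight]
  simp only [Bool.false_eq_true, iff_false]
  field_simp

lemma ipw_level_true (hp : 0 < p ∧ p < 1) (t : Bool) :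
    ipw p K z i (level t true) = treatWeight p z i t * ind (Exposed K z i) *
      (1 - (1 - p) ^ vertexDegree K i)⁻¹ := by
  have hq := treatProb_pos hp t
  unfold ipw
  rw [exposureProb_level_true, exposure_eq_level_iff, ind_and, treatWeight]
  simp only [iff_true]
  by_cases h : Exposed K z i
  · have hd : vertexDegree K i ≠ 0 := by
      classical
      obtain ⟨j, _, hj⟩ := h
      rw [vertexDegree_eq_card]
      exact (Finset.card_pos.2 ⟨j, by simpa using hj⟩).ne'
    have h1 : (1 - p) ^ vertexDegree K i < 1 := pow_lt_one₀ (by linarith) (by linarith) hd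
    have h2 : 0 < 1 - (1 - p) ^ vertexDegree K i := by linarith
    rw [ind_of (mul_pos hq h2)]
    field_simp
  · rw [ind_of_not h]
    ring

lemma treatWeight_mul_ind_exposed_le (hp : 0 < p ∧ p < 1) (t : Bool) :
    treatWeight p z i t * ind (Exposed K z i) ≤ ipw p K z i (level t true) := by
  have hw := treatWeight_nonneg ⟨hp.1.le, hp.2.le⟩ z i t
  rw [ipw_level_true hp]
  by_cases h : Exposed K z i
  · rw [ind_of h]
    have hd : vertexDegree K i ≠ 0 := by
      classical
      obtain ⟨j, _, hj⟩ := h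
      rw [vertexDegree_eq_card]
      exact (Finset.card_pos.2 ⟨j, by simpa using hj⟩).ne'
    have h1 : (1 - p) ^ vertexDegree K i < 1 := pow_lt_one₀ (by linarith) (by linarith) hd
    have h0 : 0 < (1 - p) ^ vertexDegree K i := pow_pos (by linarith) _
    have h2 : 1 ≤ (1 - (1 - p) ^ vertexDegree K i)⁻¹ :=
      (one_le_inv₀ (by linarith)).2 (by linarith)
    exact le_mul_of_one_le_right (by linarith) h2
  · rw [ind_of_not h]
    simp

lemma treatWeight_mul_ind_not_exposed_le (hp : 0 < p ∧ p ≤ 1 / 2) (t : Bool) :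
    treatWeight p z i t * ind (¬ Exposed K z i) ≤ ipw p K z i (level t false) := by
  have hp' : 0 < p ∧ p < 1 := ⟨hp.1, by linarith⟩
  rw [ipw_level_false hp']
  exact le_mul_of_one_le_right (mul_nonneg (treatWeight_nonneg ⟨hp'.1.le, hp'.2.le⟩ z i t)
    (ind_nonneg _)) (one_le_invUntreatedProb hp.1.le hp.2 (Nat.cast_nonneg _))

lemma ipw_add_le_totalWeight (t : Bool) :
    ipw p K z i (level t true) + ipw p K z i (level t false) ≤ totalWeight p K z i := by
  unfold totalWeight
  rw [sum_exposureLevel]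
  have h1 := ipw_nonneg p K z i .c11
  have h2 := ipw_nonneg p K z i .c10
  have h3 := ipw_nonneg p K z i .c01
  have h4 := ipw_nonneg p K z i .c00
  cases t <;> simp only [level] <;> linarith

lemma treatWeight_le_totalWeight (hp : 0 < p ∧ p ≤ 1 / 2) (t : Bool) :
    treatWeight p z i t ≤ totalWeight p K z i := by
  have h1 := treatWeight_mul_ind_exposed_le (K := K) (z := z) (i := i)
    ⟨hp.1, by linarith⟩ t
  have h2 := treatWeight_mul_ind_not_exposed_le (K := K) (z := z) (i := i) hp t
  have h3 := ipw_add_le_totalWeight (p := p) (K := K) (z := z) (i := i) t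
  rw [ind_not] at h2
  linarith

lemma totalWeight_le (hp : 0 < p ∧ p ≤ 1 / 2) {Q : ℝ}
    (h1 : invUntreatedProb p (vertexDegree K i) ≤ Q)
    (h2 : (1 - (1 - p) ^ vertexDegree K i)⁻¹ ≤ Q) :
    totalWeight p K z i ≤ Q * (treatWeight p z i true + treatWeight p z i false) := by
  have hp' : 0 < p ∧ p < 1 := ⟨hp.1, by linarith⟩
  have key : ∀ t, ipw p K z i (level t true) + ipw p K z i (level t false) ≤
      Q * treatWeight p z i t := by
    intro t
    have hw := treatWeight_nonneg ⟨hp'.1.le, hp'.2.le⟩ z i t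
    rw [ipw_level_true hp', ipw_level_false hp', ind_not]
    have i0 := ind_nonneg (Exposed K z i)
    have i1 := ind_le_one (Exposed K z i)
    have e1 : treatWeight p z i t * ind (Exposed K z i) * (1 - (1 - p) ^ vertexDegree K i)⁻¹ ≤
        treatWeight p z i t * ind (Exposed K z i) * Q :=
      mul_le_mul_of_nonneg_left h2 (mul_nonneg hw i0)
    have e2 : treatWeight p z i t * (1 - ind (Exposed K z i)) *
        invUntreatedProb p (vertexDegree K i) ≤
        treatWeight p z i t * (1 - ind (Exposed K z i)) * Q :=
      mul_le_mul_of_nonneg_left h1 (mul_nonneg hw (by linarith))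
    nlinarith
  have a := key true
  have b := key false
  unfold totalWeight
  rw [sum_exposureLevel]
  simp only [level] at a b
  linarith

lemma abs_aronowSamiiNode_le (hc : ∀ k, |y i k| ≤ c) (k : ExposureLevel) :
    |aronowSamiiNode p G K z y i k| ≤ c * totalWeight p K z i := by
  have hc0 : 0 ≤ c := (abs_nonneg _).trans (hc k)
  rw [aronowSamiiNode_eq, abs_mul, abs_of_nonneg (ipw_nonneg _ _ _ _ _), mul_comm]
  exact mul_le_mul (hc _) (ipw_le_totalWeight _ _ _ _ _) (ipw_nonneg _ _ _ _ _) hc0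

/-- The facts under which the inverse confusion matrix has its explicit form and moderate size:
the estimates of the rates are admissible, and the estimated degree lies in the window
`[w / p, X / p]`. -/
structure Admissible (N : ℕ) (p αh βh dh b w X : ℝ) : Prop where
  p_pos : 0 < p
  p_le : p ≤ 1 / 4
  rate_nonneg : 0 ≤ αh
  rate_le : αh ≤ 1
  b_pos : 0 < b
  b_le : b ≤ 1 - βh
  le_two : 1 - βh ≤ 2
  w_pos : 0 < w
  w_le : w ≤ p * dh
  le_X : p * dh ≤ X
  pX_le : 2 * p * X ≤ 1
  le_N : dh ≤ (N : ℝ) - 1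

lemma Admissible.degree_pos {N : ℕ} {αh βh dh b w X : ℝ} (h : Admissible N p αh βh dh b w X) :
    0 < dh := by
  by_contra h'
  have := mul_nonpos_of_nonneg_of_nonpos h.p_pos.le (not_lt.1 h')
  linarith [h.w_le, h.w_pos]

lemma Admissible.rate_mul_le {N : ℕ} {αh βh dh b w X : ℝ} (h : Admissible N p αh βh dh b w X) :
    αh * p ≤ 1 / 2 := by
  have := mul_le_mul_of_nonneg_right h.rate_le h.p_pos.le
  linarith [h.p_le]

lemma Admissible.hit_mul_le {N : ℕ} {αh βh dh b w X : ℝ} (h : Admissible N p αh βh dh b w X) :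
    (1 - βh) * p ≤ 1 / 2 := by
  have := mul_le_mul_of_nonneg_right h.le_two h.p_pos.le
  linarith [h.p_le]

lemma Admissible.mmeNode_eq {αh βh b w X : ℝ}
    (h : Admissible (Fintype.card V) p αh βh (estimatedDegree K αh βh i) b w X) (t s : Bool) :
    mmeNode p G K z y αh βh i (level t s) = (1 / treatProb p t) * ∑ s' : Bool,
      mmeCoeff (Fintype.card V) p (estimatedDegree K αh βh i) αh βh s s' *
        observedVector G K z y i (level t s') := by
  have h1 := h.p_pos
  have h2 := h.p_le
  have h3 := h.rate_mul_le
  refine mmeNode_level h1.ne' (by linarith) (Real.rpow_pos_of_pos (by linarith) _).ne'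
    (Real.rpow_pos_of_pos (by linarith) _).ne' ?_ t s
  have := noHitProb_lt_one h1 h.b_pos h.b_le h.hit_mul_le h.degree_pos
  linarith

/-- The method-of-moments estimator of a vertex is dominated by its inverse probability weights. The
factor `1 / g` of the inverse matrix may be huge at a poor estimate of the rate, but it only enters
when no observed neighbour is treated; the weight of that level contains the reciprocal of the
probability that all observed neighbours are untreated, which absorbs `1 / g` up to `s`. -/
lemma Admissible.abs_mmeNode_le {αh βh b w X : ℝ}
    (h : Admissible (Fintype.card V) p αh βh (estimatedDegree K αh βh i) b w X)
    (hc : ∀ k, |y i k| ≤ c) {s : ℝ} (hs : 0 ≤ s)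
    (hD : ((Fintype.card V : ℝ) - 1) * αh ≤ vertexDegree K i + s) (t s' : Bool) :
    |mmeNode p G K z y αh βh i (level t s')| ≤
      3 * c * (Real.exp (X + 1) * (1 + 1 / (b * w)) * invUntreatedProb p s) *
        totalWeight p K z i := by
  have hp := h.p_pos
  have hp4 := h.p_le
  have hp1 : 0 < p ∧ p < 1 := ⟨hp, by linarith⟩
  have hc0 : 0 ≤ c := (abs_nonneg _).trans (hc .c11)
  have hd := h.degree_pos
  have hαp := h.rate_mul_le
  have hβp := h.hit_mul_le
  have hX0 : 0 ≤ X := by linarith [h.w_pos, h.w_le, h.le_X]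
  have hbw : 0 < 1 / (b * w) := by have := h.b_pos; have := h.w_pos; positivity
  rw [h.mmeNode_eq]
  set N := Fintype.card V
  set d := estimatedDegree K αh βh i
  set u := invNoiseProb N p d αh
  set v := invUntreatedProb p d
  set W := 1 + 1 / (b * w) with hWdef
  set τ := invUntreatedProb p s with hτ
  set D : ℝ := (vertexDegree K i : ℝ) with hDdef
  have hu1 : 1 ≤ u := one_le_invNoiseProb (mul_nonneg h.rate_nonneg hp.le) hαp h.le_N
  have hv1 : 1 ≤ v := one_le_invUntreatedProb hp.le (by linarith) hd.le
  have hvX : v ≤ Real.exp (X + 1) := invUntreatedProb_le_exp hp.le (by linarith) h.le_X hX0 h.pX_le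
  have huD : u ≤ invUntreatedProb p D * τ := by
    rw [hτ, ← invUntreatedProb_add (by linarith)]
    exact invNoiseProb_le_rpow hp.le (by linarith) h.rate_nonneg h.rate_le hd.le h.le_N hD
  have hτ1 : 1 ≤ τ := one_le_invUntreatedProb hp.le (by linarith) hs
  have hb0 := noHitProb_nonneg (d := d) hβp
  have hb1 := noHitProb_lt_one hp h.b_pos h.b_le hβp hd
  have hW : (1 - noHitProb p d βh)⁻¹ ≤ W :=
    inv_one_sub_noHitProb_le hp h.b_pos h.b_le hβp h.w_pos h.w_le
  have hW1 : 1 ≤ W := by linarith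
  have k1 : |mmeCoeff N p d αh βh s' true| ≤ v * W := abs_invCoeff_true_le hv1 hb0 hb1 hW s'
  have k2 : |mmeCoeff N p d αh βh s' false| ≤ 2 * (u * (v * W)) :=
    abs_invCoeff_false_le hu1 hv1 hb0 hb1 hW s'
  have o1 := abs_observedVector_le (G := G) (K := K) (z := z) hc t true
  have o2 := abs_observedVector_le (G := G) (K := K) (z := z) hc t false
  have e1 : ind (Exposed K z i ↔ true = true) = ind (Exposed K z i) := by simp
  have e2 : ind (Exposed K z i ↔ false = true) = ind (¬ Exposed K z i) := by simp
  rw [e1] at o1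
  rw [e2] at o2
  have hq := treatProb_pos hp1 t
  have hq' : 0 < 1 / treatProb p t := by positivity
  have hw := treatWeight_nonneg ⟨hp.le, hp1.2.le⟩ z i t
  have hvW : 0 ≤ v * W := by positivity
  rw [Fintype.sum_bool, abs_mul, abs_of_pos hq']
  have f1 := treatWeight_mul_ind_exposed_le (K := K) (z := z) (i := i) hp1 t
  have f2 := ipw_level_false (K := K) (z := z) (i := i) hp1 t
  have f3 := ipw_add_le_totalWeight (p := p) (K := K) (z := z) (i := i) t
  have f4 := ipw_nonneg p K z i (level t true)
  have f5 := ipw_nonneg p K z i (level t false)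
  have hI0 := ind_nonneg (i ∈ z ↔ t = true)
  have hE0 := ind_nonneg (Exposed K z i)
  have hE1 := ind_nonneg (¬ Exposed K z i)
  have g1 : 1 / treatProb p t * |mmeCoeff N p d αh βh s' true *
      observedVector G K z y i (level t true)| ≤ c * (v * W) * ipw p K z i (level t true) := by
    rw [abs_mul]
    calc 1 / treatProb p t * (|mmeCoeff N p d αh βh s' true| *
          |observedVector G K z y i (level t true)|)
        ≤ 1 / treatProb p t * ((v * W) * (c * (ind (i ∈ z ↔ t = true) * ind (Exposed K z i)))) :=
          mul_le_mul_of_nonneg_left (mul_le_mul k1 o1 (abs_nonneg _) hvW) hq'.le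
      _ = c * (v * W) * (treatWeight p z i t * ind (Exposed K z i)) := by
          unfold treatWeight; ring
      _ ≤ _ := mul_le_mul_of_nonneg_left f1 (by positivity)
  have g2 : 1 / treatProb p t * |mmeCoeff N p d αh βh s' false *
      observedVector G K z y i (level t false)| ≤
      2 * c * (v * W) * τ * ipw p K z i (level t false) := by
    rw [abs_mul]
    calc 1 / treatProb p t * (|mmeCoeff N p d αh βh s' false| *
          |observedVector G K z y i (level t false)|)
        ≤ 1 / treatProb p t * ((2 * (u * (v * W))) *
            (c * (ind (i ∈ z ↔ t = true) * ind (¬ Exposed K z i)))) :=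
          mul_le_mul_of_nonneg_left (mul_le_mul k2 o2 (abs_nonneg _) (by positivity)) hq'.le
      _ = 2 * c * (v * W) * (treatWeight p z i t * ind (¬ Exposed K z i)) * u := by
          unfold treatWeight; ring
      _ ≤ 2 * c * (v * W) * (treatWeight p z i t * ind (¬ Exposed K z i)) *
            (invUntreatedProb p D * τ) :=
          mul_le_mul_of_nonneg_left huD (by positivity)
      _ = _ := by rw [f2]; ring
  have hcW : 0 ≤ c * (v * W) := by positivity
  calc 1 / treatProb p t * |mmeCoeff N p d αh βh s' true *
        observedVector G K z y i (level t true) + mmeCoeff N p d αh βh s' false *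
        observedVector G K z y i (level t false)|
      ≤ 1 / treatProb p t * (|mmeCoeff N p d αh βh s' true *
        observedVector G K z y i (level t true)| + |mmeCoeff N p d αh βh s' false *
        observedVector G K z y i (level t false)|) :=
        mul_le_mul_of_nonneg_left (abs_add_le _ _) hq'.le
    _ ≤ c * (v * W) * ipw p K z i (level t true) +
        2 * c * (v * W) * τ * ipw p K z i (level t false) := by rw [mul_add]; linarith
    _ ≤ 3 * (c * (v * W)) * τ * (ipw p K z i (level t true) + ipw p K z i (level t false)) := by
        have h1 : c * (v * W) * ipw p K z i (level t true) ≤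
            c * (v * W) * τ * ipw p K z i (level t true) :=
          mul_le_mul_of_nonneg_right (le_mul_of_one_le_right hcW hτ1) f4
        have h2 : 0 ≤ c * (v * W) * τ * ipw p K z i (level t true) := by positivity
        have h3 : 0 ≤ c * (v * W) * τ * ipw p K z i (level t false) := by positivity
        linarith
    _ ≤ 3 * (c * (v * W)) * τ * totalWeight p K z i :=
        mul_le_mul_of_nonneg_left f3 (by positivity)
    _ ≤ 3 * (c * (Real.exp (X + 1) * W)) * τ * totalWeight p K z i := by
        have ht := totalWeight_nonneg p K z i
        gcongr
    _ = _ := by ring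

/-- At estimated parameters close to the true ones, the method-of-moments estimator is close to the
ideal one. -/
lemma abs_mmeNode_sub_idealNode_le {αh βh b w X A R θ e : ℝ}
    (h : Admissible (Fintype.card V) p αh βh (estimatedDegree K αh βh i) b w X)
    (h' : Admissible (Fintype.card V) p α β (vertexDegree G i) b w R)
    (hc : ∀ k, |y i k| ≤ c)
    (hA : p * Fintype.card V * α ≤ A) (he : 0 ≤ e)
    (hdd : p * |estimatedDegree K αh βh i - vertexDegree G i| ≤ θ) (hαα : |αh - α| ≤ e * α)
    (hββ : |βh - β| ≤ e) (hη1 : 4 * θ + 2 * (R + A) * e ≤ 1) (t s : Bool) :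
    |mmeNode p G K z y αh βh i (level t s) - idealNode p α β G K z y i t s| ≤
      44 * c * (4 * θ + 2 * (R + A) * e) * (Real.exp (2 * A) * Real.exp (R + 1)) *
        (1 + 1 / (b * w)) ^ 2 * treatWeight p z i t := by
  have hp := h.p_pos
  have hp4 := h.p_le
  have hp1 : 0 < p ∧ p < 1 := ⟨hp, by linarith⟩
  have hc0 : 0 ≤ c := (abs_nonneg _).trans (hc .c11)
  have hR : 0 ≤ R := by linarith [h'.w_pos, h'.w_le, h'.le_X]
  have hq := treatProb_pos hp1 t
  have hq' : 0 < 1 / treatProb p t := by positivity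
  have hθ : 0 ≤ θ := (mul_nonneg hp.le (abs_nonneg _)).trans hdd
  have hA0 : 0 ≤ A := (by have := h'.rate_nonneg; positivity :
    0 ≤ p * Fintype.card V * α).trans hA
  have hvX : invUntreatedProb p (vertexDegree G i) ≤ Real.exp (R + 1) :=
    invUntreatedProb_le_exp hp.le (by linarith) h'.le_X hR h'.pX_le
  rw [h.mmeNode_eq, idealNode, ← mul_sub, ← Finset.sum_sub_distrib, abs_mul, abs_of_pos hq']
  set E := 22 * (4 * θ + 2 * (R + A) * e) * (Real.exp (2 * A) * Real.exp (R + 1)) *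
        (1 + 1 / (b * w)) ^ 2 with hE
  have hE0 : 0 ≤ E := by positivity
  have key : ∀ s' ∈ (Finset.univ : Finset Bool),
      |mmeCoeff (Fintype.card V) p (estimatedDegree K αh βh i) αh βh s s' *
        observedVector G K z y i (level t s') -
        mmeCoeff (Fintype.card V) p (vertexDegree G i) α β s s' *
        observedVector G K z y i (level t s')| ≤ E * (c * ind (i ∈ z ↔ t = true)) := by
    intro s' _
    rw [← sub_mul, abs_mul]
    refine mul_le_mul ?_ ?_ (abs_nonneg _) hE0
    · refine (abs_mmeCoeff_sub_le hp hp4 h'.le_X h'.le_N ⟨h'.rate_nonneg, h'.rate_le⟩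
        ⟨h.rate_nonneg, h.rate_le⟩ h.b_pos ⟨h'.b_le, h'.le_two⟩ ⟨h.b_le, h.le_two⟩ h.w_pos
        h'.w_le h.w_le hA hR he hdd hαα hββ hη1 s s').trans ?_
      rw [hE]
      gcongr
    · refine (abs_observedVector_le hc t s').trans (mul_le_mul_of_nonneg_left ?_ hc0)
      exact mul_le_of_le_one_right (ind_nonneg _) (ind_le_one _)
  calc _ ≤ 1 / treatProb p t * ∑ s' : Bool, E * (c * ind (i ∈ z ↔ t = true)) :=
        mul_le_mul_of_nonneg_left
          ((Finset.abs_sum_le_sum_abs _ _).trans (Finset.sum_le_sum key)) hq'.le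
    _ = _ := by
        rw [hE, treatWeight]
        simp
        ring

lemma Admissible.abs_idealCoeff_le {b w X A : ℝ}
    (h : Admissible (Fintype.card V) p α β (vertexDegree G i) b w X) (hc : ∀ k, |y i k| ≤ c)
    (hA : p * Fintype.card V * α ≤ A) (t s : Bool) (x : Bool × Bool) :
    |idealCoeff p α β G y i t s x| ≤
      6 * c * (Real.exp (2 * A) * Real.exp (X + 1) * (1 + 1 / (b * w))) := by
  have hp := h.p_pos
  have hp4 := h.p_le
  have hc0 : 0 ≤ c := (abs_nonneg _).trans (hc .c11)
  have hd := h.degree_pos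
  have hαp := h.rate_mul_le
  have hβp := h.hit_mul_le
  have hX0 : 0 ≤ X := by linarith [h.w_pos, h.w_le, h.le_X]
  have hbw : 0 < 1 / (b * w) := by have := h.b_pos; have := h.w_pos; positivity
  have hα0 : 0 ≤ α * p := mul_nonneg h.rate_nonneg hp.le
  set N := Fintype.card V
  set d : ℝ := (vertexDegree G i : ℝ)
  set u := invNoiseProb N p d α
  set v := invUntreatedProb p d
  set W := 1 + 1 / (b * w) with hWdef
  have hu1 : 1 ≤ u := one_le_invNoiseProb hα0 hαp h.le_N
  have hv1 : 1 ≤ v := one_le_invUntreatedProb hp.le (by linarith) hd.le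
  have hvX : v ≤ Real.exp (X + 1) := invUntreatedProb_le_exp hp.le (by linarith) h.le_X hX0 h.pX_le
  have huA : u ≤ Real.exp (2 * A) := invNoiseProb_le_exp hα0 hαp hd.le hA
  have hb0 := noHitProb_nonneg (d := d) hβp
  have hb1 := noHitProb_lt_one hp h.b_pos h.b_le hβp hd
  have hW : (1 - noHitProb p d β)⁻¹ ≤ W :=
    inv_one_sub_noHitProb_le hp h.b_pos h.b_le hβp h.w_pos h.w_le
  have k1 : |mmeCoeff N p d α β s true| ≤ v * W := abs_invCoeff_true_le hv1 hb0 hb1 hW s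
  have k2 : |mmeCoeff N p d α β s false| ≤ 2 * (u * (v * W)) :=
    abs_invCoeff_false_le hu1 hv1 hb0 hb1 hW s
  set E := Real.exp (2 * A) * Real.exp (X + 1) * W with hE
  have hW0 : 0 < W := by linarith
  have hE2 : u * (v * W) ≤ E := by
    rw [hE, ← mul_assoc]
    gcongr
  have hvW : v * W ≤ u * (v * W) := le_mul_of_one_le_left (by positivity) hu1
  have a1 : |if x.2 then mmeCoeff N p d α β s false - mmeCoeff N p d α β s true
      else mmeCoeff N p d α β s true| ≤ 3 * E := by
    split_ifs
    · exact (abs_sub _ _).trans (by linarith)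
    · have : 0 ≤ E := (mul_nonneg (by linarith) (by positivity)).trans hE2
      linarith
  have a2 : |if x.1 then y i (level t false) - y i (level t true) else y i (level t true)| ≤
      2 * c := by
    split_ifs
    · exact (abs_sub _ _).trans (by linarith [hc (level t false), hc (level t true)])
    · linarith [hc (level t true)]
  have hE0 : 0 ≤ E := by positivity
  unfold idealCoeff
  rw [abs_mul]
  calc _ ≤ (3 * E) * (2 * c) := mul_le_mul a1 a2 (abs_nonneg _) (by positivity)
    _ = _ := by ring

/-- Accuracy of the estimated degree. -/
lemma abs_estimatedDegree_sub_le {αh βh b A R e δ : ℝ} (hp : 0 < p) (hb : 0 < b)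
    (hbβ : b ≤ 1 - αh - βh) (hα1 : α ≤ 1) (he : 0 ≤ e) (hR : p * vertexDegree G i ≤ R)
    (hA : p * Fintype.card V * α ≤ A) (hαα : |αh - α| ≤ e * α) (hββ : |βh - β| ≤ e)
    (hdev : p * |(vertexDegree K i : ℝ) - meanObservedDegree G α β i| ≤ δ) :
    p * |estimatedDegree K αh βh i - vertexDegree G i| ≤ (2 * R * e + A * e + δ) / b := by
  have hD : 0 < 1 - αh - βh := by linarith
  set d : ℝ := (vertexDegree G i : ℝ) with hd
  set N : ℝ := (Fintype.card V : ℝ) with hN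
  have hN1 : 1 ≤ N := by
    rw [hN]
    exact_mod_cast Fintype.card_pos_iff.2 ⟨i⟩
  have hd0 : 0 ≤ d := Nat.cast_nonneg _
  have e1 : estimatedDegree K αh βh i - d =
      (d * ((αh - α) + (βh - β)) - (N - 1) * (αh - α) +
        ((vertexDegree K i : ℝ) - meanObservedDegree G α β i)) / (1 - αh - βh) := by
    unfold estimatedDegree meanObservedDegree
    field_simp
    ring
  rw [e1, abs_div, abs_of_pos hD, ← mul_div_assoc]
  set dev := (vertexDegree K i : ℝ) - meanObservedDegree G α β i
  have h1 : |d * ((αh - α) + (βh - β))| ≤ d * (2 * e) := by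
    rw [abs_mul, abs_of_nonneg hd0]
    refine mul_le_mul_of_nonneg_left ((abs_add_le _ _).trans ?_) hd0
    have : e * α ≤ e * 1 := mul_le_mul_of_nonneg_left hα1 he
    linarith
  have h2 : |(N - 1) * (αh - α)| ≤ N * (e * α) := by
    rw [abs_mul, abs_of_nonneg (by linarith)]
    exact mul_le_mul (by linarith) hαα (abs_nonneg _) (by linarith)
  have h3 : |d * ((αh - α) + (βh - β)) - (N - 1) * (αh - α) + dev| ≤
      d * (2 * e) + N * (e * α) + |dev| :=
    (abs_add_le _ _).trans (by linarith [abs_sub (d * ((αh - α) + (βh - β))) ((N - 1) * (αh - α))])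
  have h4 : p * |d * ((αh - α) + (βh - β)) - (N - 1) * (αh - α) + dev| ≤
      2 * R * e + A * e + δ := by
    have t1 := mul_le_mul_of_nonneg_left h3 hp.le
    have t2 : p * d * e ≤ R * e := mul_le_mul_of_nonneg_right hR he
    have t3 : p * N * α * e ≤ A * e := mul_le_mul_of_nonneg_right hA he
    linarith
  have h5 : 0 ≤ 2 * R * e + A * e + δ := (mul_nonneg hp.le (abs_nonneg _)).trans h4
  exact (div_le_div_of_nonneg_right h4 hD.le).trans (div_le_div_of_nonneg_left h5 hb hbβ)

end Node

/-! ### The estimation error for a fixed network -/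

section Fixed

variable {V : Type*} [Fintype V] {G K : SimpleGraph V} {p α β b A w Ct R δ : ℝ} {z : Finset V}
  {y : V → ExposureLevel → ℝ} {i : V} {c : ℝ}

/-- The total relative error of the ingredients of the inverse confusion matrix. -/
noncomputable def paramError (b A R δ : ℝ) : ℝ :=
  4 * ((2 * R + A + 1) * δ / b) + 2 * (R + A) * δ

/-- The quantitative assumptions on one network: `δ` is a small error level, `R` a slowly growing
truncation of the scaled degrees `p d_i`, which are typically at least `2 w`, and have a tail of
order `exp (-m) / m` with constant `Ct`. The constant `b` keeps `1 - β` and its estimates away from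
zero, and `A` bounds the mean number of treated false neighbours. -/
structure Regime (G : SimpleGraph V) (p α β b A w Ct R δ : ℝ) : Prop where
  p_pos : 0 < p
  p_le : p ≤ δ ^ 4
  δ_pos : 0 < δ
  δ_le : δ ≤ 1 / 4
  δ_le_b : δ ≤ b
  b_le : 4 * b ≤ 1 - β
  β_nonneg : 0 ≤ β
  α_nonneg : 0 ≤ α
  α_le : α ≤ δ ^ 4
  A_nonneg : 0 ≤ A
  α_mul_le : p * Fintype.card V * α ≤ A
  one_le : 1 ≤ δ ^ 4 * (p * Fintype.card V)
  one_le_R : 1 ≤ R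
  w_pos : 0 < w
  w_le : w ≤ 1
  error_le : paramError b A R δ ≤ w
  Ct_nonneg : 0 ≤ Ct
  low : ∑ i, ind (p * vertexDegree G i < 2 * w) ≤ Fintype.card V * δ
  tail : ∀ m : ℝ, 1 ≤ m →
    ∑ i, ind (m < p * vertexDegree G i) ≤ Fintype.card V * (δ + Ct * Real.exp (-m) / m)
  pairs : (Fintype.card V : ℝ) ^ 2 - pairsWithoutCommonNeighbor G ≤ δ ^ 4 * Fintype.card V ^ 2

/-- The estimates of the error rates are close to the truth. -/
def GoodRates (α β δ αh βh : ℝ) : Prop := |αh - α| ≤ δ ^ 4 * α ∧ |βh - β| ≤ δ ^ 4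

/-- The observed degree of a vertex of moderate degree deviates from its mean. -/
def DegreeDeviates (G : SimpleGraph V) (p α β R δ : ℝ) (i : V) (K : SimpleGraph V) : Prop :=
  p * vertexDegree G i ≤ R ∧ δ ≤ p * |(vertexDegree K i : ℝ) - meanObservedDegree G α β i|

namespace Regime

lemma b_pos (h : Regime G p α β b A w Ct R δ) : 0 < b := h.δ_pos.trans_le h.δ_le_b

lemma pow_le (h : Regime G p α β b A w Ct R δ) : δ ^ 4 ≤ δ / 64 := by
  have h1 := h.δ_pos
  have h2 : δ ^ 3 ≤ (1 / 4) ^ 3 := pow_le_pow_left₀ h1.le h.δ_le 3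
  have : δ ^ 4 = δ * δ ^ 3 := by ring
  nlinarith

lemma p_le_quarter (h : Regime G p α β b A w Ct R δ) : p ≤ 1 / 256 := by
  have := h.pow_le
  have := h.p_le
  have := h.δ_le
  linarith

lemma R_mul_le (h : Regime G p α β b A w Ct R δ) : R * δ ≤ 1 / 8 := by
  have h1 := h.error_le
  have hb := h.b_pos
  have hb1 : b ≤ 1 := by linarith [h.b_le, h.β_nonneg]
  have hR := h.one_le_R
  have hA := h.A_nonneg
  have hδ := h.δ_pos
  have h2 : (2 * R + A + 1) * δ ≤ (2 * R + A + 1) * δ / b := by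
    rw [le_div_iff₀ hb]
    exact mul_le_of_le_one_right (by positivity) hb1
  have h3 : 0 ≤ (R + A) * δ := by positivity
  have h4 : 0 ≤ (A + 1) * δ := by positivity
  unfold paramError at h1
  linarith [h.w_le]

lemma R_add_one_le (h : Regime G p α β b A w Ct R δ) : R + 1 ≤ p * Fintype.card V := by
  have h1 := h.one_le
  have h2 := h.pow_le
  have h3 := h.R_mul_le
  have hp : 0 ≤ p * Fintype.card V := mul_nonneg h.p_pos.le (Nat.cast_nonneg _)
  have hδ := h.δ_pos
  have hR := h.one_le_R
  have h4 : 64 ≤ δ * (p * Fintype.card V) := by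
    have := mul_le_mul_of_nonneg_right h2 hp
    linarith
  by_contra hlt
  have h5 : δ * (p * Fintype.card V) ≤ δ * (R + 1) :=
    mul_le_mul_of_nonneg_left (by linarith) hδ.le
  have := h.δ_le
  nlinarith

lemma p_mul_le (h : Regime G p α β b A w Ct R δ) {X : ℝ} (hX0 : 0 ≤ X) (hX : X ≤ R) :
    2 * p * X ≤ 1 := by
  have h1 := h.p_le
  have h2 := h.pow_le
  have h3 := h.R_mul_le
  have hδ := h.δ_pos
  have h4 : p * X ≤ δ * R := mul_le_mul (by linarith) hX hX0 hδ.le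
  linarith

lemma rates (h : Regime G p α β b A w Ct R δ) {αh βh : ℝ} (hg : GoodRates α β δ αh βh) :
    0 ≤ αh ∧ αh ≤ 1 ∧ b ≤ 1 - βh ∧ 1 - βh ≤ 2 ∧ b ≤ 1 - αh - βh := by
  obtain ⟨h1, h2⟩ := hg
  have h3 := h.pow_le
  have h4 := h.δ_le
  have h5 := h.δ_le_b
  have h6 := h.α_le
  have h7 := h.α_nonneg
  have h8 := h.b_le
  have h9 := h.β_nonneg
  have hδ := h.δ_pos
  have e1 : δ ^ 4 * α ≤ 1 * α := mul_le_mul_of_nonneg_right (by linarith) h7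
  rw [abs_le] at h1 h2
  refine ⟨?_, ?_, ?_, ?_, ?_⟩ <;> linarith

lemma degree_le_cutoff (h : Regime G p α β b A w Ct R δ) {C₂ : ℝ} (hC : p * C₂ ≤ R) :
    C₂ ≤ (Fintype.card V : ℝ) - 1 := by
  have h1 := h.R_add_one_le
  have hp := h.p_pos
  have hp1 := h.p_le_quarter
  by_contra hlt
  have : p * ((Fintype.card V : ℝ) - 1) < p * C₂ := mul_lt_mul_of_pos_left (not_le.1 hlt) hp
  linarith

end Regime

/-- A bound for the ratio of the method-of-moments estimator to the total weight that holds for all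
admissible estimates of the rates. -/
noncomputable def crudeBound (b R X c : ℝ) : ℝ := 3 * c * (Real.exp (X + 1) ^ 2 * (1 + R / b)) + c

/-- The corresponding sharper bound at good estimates and large degrees. -/
noncomputable def upperBound (b w X c : ℝ) : ℝ := 3 * c * (Real.exp (X + 1) * (1 + 1 / (b * w))) + c

/-- A bound for the coefficients of the ideal estimator. -/
noncomputable def idealBound (b A w X c : ℝ) : ℝ :=
  6 * c * (Real.exp (2 * A) * Real.exp (X + 1) * (1 + 1 / (b * w)))

/-- A bound for the deviation of the estimator of a typical vertex from the ideal one. -/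
noncomputable def lipschitzBound (b A w R δ X c : ℝ) : ℝ :=
  44 * c * paramError b A R δ * (Real.exp (2 * A) * Real.exp (X + 1)) * (1 + 1 / (b * w)) ^ 2

open Classical in
/-- The contribution of the vertex `i` to the estimator. -/
noncomputable def nodeEstimator (p : ℝ) (G K : SimpleGraph V) (z : Finset V)
    (y : V → ExposureLevel → ℝ) (αh βh C₁ C₂ : ℝ) (k : ExposureLevel) (i : V) : ℝ :=
  if C₁ ≤ estimatedDegree K αh βh i ∧ estimatedDegree K αh βh i < C₂ then
    mmeNode p G K z y αh βh i k
  else aronowSamiiNode p G K z y i k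

/-- The cutoffs are of the right order. -/
structure Cutoffs (p w R X C₁ C₂ : ℝ) : Prop where
  low : 1 / R ≤ p * C₁
  low_le : p * C₁ ≤ w
  up : p * C₂ = X
  four_le : 4 ≤ X
  X_le : X ≤ R

lemma mul_rate_eq {αh βh : ℝ} (hd : 0 < estimatedDegree K αh βh i) :
    ((Fintype.card V : ℝ) - 1) * αh =
      vertexDegree K i - (1 - αh - βh) * estimatedDegree K αh βh i := by
  have hD : 1 - αh - βh ≠ 0 := by
    intro h0
    rw [estimatedDegree, h0, div_zero] at hd
    exact lt_irrefl _ hd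
  unfold estimatedDegree
  field_simp
  ring

lemma Regime.admissible_of_cutoffs (h : Regime G p α β b A w Ct R δ) {X C₁ C₂ αh βh : ℝ}
    (hC : Cutoffs p w R X C₁ C₂) (hα0 : 0 ≤ αh) (hα1 : αh ≤ 1) (hb : b ≤ 1 - βh)
    (hβ2 : 1 - βh ≤ 2) {w' : ℝ} (hw' : 0 < w') (hw : w' ≤ p * estimatedDegree K αh βh i)
    (h2 : estimatedDegree K αh βh i < C₂) :
    Admissible (Fintype.card V) p αh βh (estimatedDegree K αh βh i) b w' X where
  p_pos := h.p_pos
  p_le := by linarith [h.p_le_quarter]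
  rate_nonneg := hα0
  rate_le := hα1
  b_pos := h.b_pos
  b_le := hb
  le_two := hβ2
  w_pos := hw'
  w_le := hw
  le_X := by rw [← hC.up]; exact mul_le_mul_of_nonneg_left h2.le h.p_pos.le
  pX_le := h.p_mul_le (by linarith [hC.four_le]) hC.X_le
  le_N := h2.le.trans (h.degree_le_cutoff (by rw [hC.up]; exact hC.X_le))

/-- The bound at arbitrary admissible estimates of the rates: the estimated degree is at least
`1 / (R p)` whenever the method-of-moments estimator is used. -/
lemma Regime.abs_nodeEstimator_le (h : Regime G p α β b A w Ct R δ) {X C₁ C₂ αh βh : ℝ}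
    (hC : Cutoffs p w R X C₁ C₂) (hα0 : 0 ≤ αh) (hα1 : αh ≤ 1) (hb : b ≤ 1 - βh)
    (hβ2 : 1 - βh ≤ 2) (hc : ∀ k, |y i k| ≤ c) (t s : Bool) :
    |nodeEstimator p G K z y αh βh C₁ C₂ (level t s) i| ≤
      crudeBound b R X c * totalWeight p K z i := by
  have hc0 : 0 ≤ c := (abs_nonneg _).trans (hc .c11)
  have hp := h.p_pos
  have ht := totalWeight_nonneg p K z i
  have hR := h.one_le_R
  have hb0 := h.b_pos
  have hX := hC.four_le
  unfold nodeEstimator crudeBound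
  split_ifs with hcase
  · obtain ⟨h1, h2⟩ := hcase
    have hw' : 1 / R ≤ p * estimatedDegree K αh βh i :=
      hC.low.trans (mul_le_mul_of_nonneg_left h1 hp.le)
    have had := h.admissible_of_cutoffs hC hα0 hα1 hb hβ2 (by positivity) hw' h2
    have hd := had.degree_pos
    have hrate := mul_rate_eq hd
    have hD : ((Fintype.card V : ℝ) - 1) * αh ≤ vertexDegree K i + C₂ := by
      rw [hrate]
      nlinarith
    have hC2 : 0 ≤ C₂ := hd.le.trans h2.le
    have key := had.abs_mmeNode_le (z := z) (G := G) hc hC2 hD t s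
    have hv : invUntreatedProb p C₂ ≤ Real.exp (X + 1) :=
      invUntreatedProb_le_exp hp.le (by linarith [h.p_le_quarter]) hC.up.le (by linarith)
        (h.p_mul_le (by linarith) hC.X_le)
    refine key.trans (mul_le_mul_of_nonneg_right ?_ ht)
    have e1 : 1 / (b * (1 / R)) = R / b := by field_simp
    rw [e1]
    have e2 : Real.exp (X + 1) * (1 + R / b) * invUntreatedProb p C₂ ≤
        Real.exp (X + 1) * (1 + R / b) * Real.exp (X + 1) :=
      mul_le_mul_of_nonneg_left hv (by positivity)
    have e3 : Real.exp (X + 1) * (1 + R / b) * Real.exp (X + 1) =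
      Real.exp (X + 1) ^ 2 * (1 + R / b) := by ring
    have e4 := mul_le_mul_of_nonneg_left (e2.trans_eq e3) (by positivity : 0 ≤ 3 * c)
    linarith
  · refine (abs_aronowSamiiNode_le hc _).trans (mul_le_mul_of_nonneg_right ?_ ht)
    have : 0 ≤ 3 * c * (Real.exp (X + 1) ^ 2 * (1 + R / b)) := by positivity
    linarith

lemma Regime.degree_error (h : Regime G p α β b A w Ct R δ) {αh βh : ℝ}
    (hg : GoodRates α β δ αh βh) (hx : p * vertexDegree G i ≤ R)
    (hdev : ¬ DegreeDeviates G p α β R δ i K) :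
    p * |estimatedDegree K αh βh i - vertexDegree G i| ≤ (2 * R + A + 1) * δ / b := by
  obtain ⟨r1, r2, r3, r4, r5⟩ := h.rates hg
  have hδ := h.δ_pos
  have hR := h.one_le_R
  have hA := h.A_nonneg
  have hdev' : p * |(vertexDegree K i : ℝ) - meanObservedDegree G α β i| ≤ δ := by
    by_contra hlt
    exact hdev ⟨hx, (not_le.1 hlt).le⟩
  have hα1 : α ≤ 1 := by linarith [h.α_le, h.pow_le, h.δ_le]
  refine (abs_estimatedDegree_sub_le h.p_pos h.b_pos r5 hα1 (by positivity) hx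
    h.α_mul_le hg.1 hg.2 hdev').trans (div_le_div_of_nonneg_right ?_ h.b_pos.le)
  have h4 : δ ^ 4 ≤ δ := by linarith [h.pow_le]
  have e1 : 2 * R * δ ^ 4 ≤ 2 * R * δ := mul_le_mul_of_nonneg_left h4 (by positivity)
  have e2 : A * δ ^ 4 ≤ A * δ := mul_le_mul_of_nonneg_left h4 hA
  linarith

lemma Regime.theta_le (h : Regime G p α β b A w Ct R δ) :
    (2 * R + A + 1) * δ / b ≤ w / 4 := by
  have h1 := h.error_le
  have hδ := h.δ_pos
  have hR := h.one_le_R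
  have hA := h.A_nonneg
  have : 0 ≤ (R + A) * δ := by positivity
  unfold paramError at h1
  linarith

lemma Regime.abs_nodeEstimator_le_of_large (h : Regime G p α β b A w Ct R δ)
    {X C₁ C₂ αh βh : ℝ} (hC : Cutoffs p w R X C₁ C₂) (hg : GoodRates α β δ αh βh)
    (hc : ∀ k, |y i k| ≤ c) (t s : Bool) (hx : p * vertexDegree G i ≤ R)
    (hx' : X - 1 ≤ p * vertexDegree G i) (hdev : ¬ DegreeDeviates G p α β R δ i K) :
    |nodeEstimator p G K z y αh βh C₁ C₂ (level t s) i| ≤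
      upperBound b w X c * totalWeight p K z i := by
  have hc0 : 0 ≤ c := (abs_nonneg _).trans (hc .c11)
  have hp := h.p_pos
  have ht := totalWeight_nonneg p K z i
  have hw := h.w_pos
  have hb0 := h.b_pos
  unfold nodeEstimator upperBound
  split_ifs with hcase
  · obtain ⟨h1, h2⟩ := hcase
    obtain ⟨r1, r2, r3, r4, r5⟩ := h.rates hg
    have herr := h.degree_error hg hx hdev
    have hθ := h.theta_le
    have hw1 := h.w_le
    rw [← abs_of_pos hp, ← abs_mul, abs_le] at herr
    have hw' : w ≤ p * estimatedDegree K αh βh i := by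
      linarith [hC.four_le, herr.1, mul_sub p (estimatedDegree K αh βh i) (vertexDegree G i)]
    have had := h.admissible_of_cutoffs hC r1 r2 r3 r4 hw hw' h2
    have hd := had.degree_pos
    have hD : ((Fintype.card V : ℝ) - 1) * αh ≤ vertexDegree K i + 0 := by
      rw [mul_rate_eq hd]
      have : 0 ≤ (1 - αh - βh) * estimatedDegree K αh βh i :=
        mul_nonneg (by linarith) hd.le
      linarith
    have key := had.abs_mmeNode_le (z := z) (G := G) hc le_rfl hD t s
    refine key.trans (mul_le_mul_of_nonneg_right ?_ ht)
    have e1 : invUntreatedProb p 0 = 1 := by simp [invUntreatedProb]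
    rw [e1]
    linarith
  · refine (abs_aronowSamiiNode_le hc _).trans (mul_le_mul_of_nonneg_right ?_ ht)
    have : 0 ≤ 3 * c * (Real.exp (X + 1) * (1 + 1 / (b * w))) := by positivity
    linarith

lemma Regime.admissible_true (h : Regime G p α β b A w Ct R δ) {X : ℝ} (hX : X ≤ R)
    (hx : 2 * w ≤ p * vertexDegree G i) (hx' : p * vertexDegree G i ≤ X) :
    Admissible (Fintype.card V) p α β (vertexDegree G i) b w X where
  p_pos := h.p_pos
  p_le := by linarith [h.p_le_quarter]
  rate_nonneg := h.α_nonneg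
  rate_le := by linarith [h.α_le, h.pow_le, h.δ_le]
  b_pos := h.b_pos
  b_le := by linarith [h.b_le, h.b_pos]
  le_two := by linarith [h.β_nonneg]
  w_pos := h.w_pos
  w_le := by linarith [h.w_pos]
  le_X := hx'
  pX_le := h.p_mul_le (by linarith [h.w_pos]) hX
  le_N := vertexDegree_le G i

lemma Regime.abs_nodeEstimator_sub_idealNode_le (h : Regime G p α β b A w Ct R δ)
    {X C₁ C₂ αh βh : ℝ} (hC : Cutoffs p w R X C₁ C₂) (hg : GoodRates α β δ αh βh)
    (hc : ∀ k, |y i k| ≤ c) (t s : Bool) (hx : 2 * w ≤ p * vertexDegree G i)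
    (hx' : p * vertexDegree G i ≤ X - 1) (hdev : ¬ DegreeDeviates G p α β R δ i K) :
    |nodeEstimator p G K z y αh βh C₁ C₂ (level t s) i - idealNode p α β G K z y i t s| ≤
      lipschitzBound b A w R δ X c * totalWeight p K z i := by
  have hc0 : 0 ≤ c := (abs_nonneg _).trans (hc .c11)
  have hp := h.p_pos
  have hw := h.w_pos
  have hw1 := h.w_le
  have hb0 := h.b_pos
  have hδ := h.δ_pos
  have hA := h.A_nonneg
  have hR := h.one_le_R
  obtain ⟨r1, r2, r3, r4, r5⟩ := h.rates hg
  have herr := h.degree_error hg (by linarith [hC.X_le]) hdev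
  have hθ := h.theta_le
  have herr' := herr
  rw [← abs_of_pos hp, ← abs_mul, abs_le, mul_sub] at herr'
  have hw' : w ≤ p * estimatedDegree K αh βh i := by linarith [herr'.1]
  have h1 : C₁ ≤ estimatedDegree K αh βh i := by
    by_contra hlt
    have := mul_lt_mul_of_pos_left (not_le.1 hlt) hp
    linarith [hC.low_le]
  have h2 : estimatedDegree K αh βh i < C₂ := by
    by_contra hlt
    have := mul_le_mul_of_nonneg_left (not_lt.1 hlt) hp.le
    linarith [hC.up, herr'.2]
  unfold nodeEstimator
  rw [if_pos ⟨h1, h2⟩]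
  have had := h.admissible_of_cutoffs hC r1 r2 r3 r4 hw hw' h2
  have had' := h.admissible_true (i := i) hC.X_le hx (by linarith)
  have hX4 := hC.four_le
  have h4 : δ ^ 4 ≤ δ := by linarith [h.pow_le]
  have hη : 4 * ((2 * R + A + 1) * δ / b) + 2 * (X + A) * δ ^ 4 ≤ paramError b A R δ := by
    unfold paramError
    have : (X + A) * δ ^ 4 ≤ (R + A) * δ :=
      mul_le_mul (by linarith [hC.X_le]) h4 (by positivity) (by linarith)
    linarith
  refine (abs_mmeNode_sub_idealNode_le had had' hc h.α_mul_le (by positivity) herr hg.1 hg.2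
    (hη.trans (h.error_le.trans hw1)) t s).trans ?_
  unfold lipschitzBound
  have hη0 : 0 ≤ 4 * ((2 * R + A + 1) * δ / b) + 2 * (X + A) * δ ^ 4 := by positivity
  have htw := treatWeight_nonneg ⟨hp.le, by linarith [h.p_le_quarter]⟩ z i t
  have htt := treatWeight_le_totalWeight (K := K) (z := z) (i := i)
    ⟨hp, by linarith [h.p_le_quarter]⟩ t
  have hη1 : 0 ≤ paramError b A R δ := hη0.trans hη
  gcongr

lemma Regime.abs_idealNode_le (h : Regime G p α β b A w Ct R δ) {X : ℝ} (hX : X ≤ R)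
    (hc : ∀ k, |y i k| ≤ c) (t s : Bool) (hx : 2 * w ≤ p * vertexDegree G i)
    (hx' : p * vertexDegree G i ≤ X) :
    |idealNode p α β G K z y i t s| ≤ 4 * idealBound b A w X c * totalWeight p K z i := by
  have hp := h.p_pos
  have hp4 := h.p_le_quarter
  have hc0 : 0 ≤ c := (abs_nonneg _).trans (hc .c11)
  have hB : 0 ≤ idealBound b A w X c := by
    have := h.b_pos
    have := h.w_pos
    unfold idealBound
    positivity
  refine (_root_.abs_idealNode_le ⟨hp, by linarith⟩ K z y i t s
    fun x => (h.admissible_true hX hx hx').abs_idealCoeff_le hc h.α_mul_le t s x).trans ?_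
  exact mul_le_mul_of_nonneg_left (treatWeight_le_totalWeight ⟨hp, by linarith⟩ t)
    (by unfold idealBound at hB; linarith)

/-- The part of the error bound of a single vertex that does not cancel in the average. -/
noncomputable def nodeError (G : SimpleGraph V) (p α β b A w R δ X c : ℝ) (z : Finset V)
    (K : SimpleGraph V) (i : V) : ℝ :=
  lipschitzBound b A w R δ X c * totalWeight p K z i +
  (crudeBound b R X c + 4 * idealBound b A w X c) *
    (totalWeight p K z i * ind (DegreeDeviates G p α β R δ i K)) +
  ind (X - 1 < p * vertexDegree G i) * (upperBound b w X c * totalWeight p K z i + c) +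
  (ind (p * vertexDegree G i < 2 * w) + ind (R < p * vertexDegree G i)) *
    (crudeBound b R X c * totalWeight p K z i + c)

lemma Regime.bounds_nonneg (h : Regime G p α β b A w Ct R δ) (X : ℝ) (hc : 0 ≤ c) :
    0 ≤ crudeBound b R X c ∧ 0 ≤ upperBound b w X c ∧ 0 ≤ idealBound b A w X c ∧
      0 ≤ lipschitzBound b A w R δ X c := by
  have := h.b_pos
  have := h.w_pos
  have := h.one_le_R
  have := h.A_nonneg
  have := h.δ_pos
  unfold crudeBound upperBound idealBound lipschitzBound paramError
  refine ⟨?_, ?_, ?_, ?_⟩ <;> positivity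

open Classical in
/-- The vertices of typical degree. The upper limit `X - 1` instead of `X` leaves room for the error
of the estimated degree, so that these vertices pass the cutoffs. -/
noncomputable def typicalVertices (G : SimpleGraph V) (p w X : ℝ) : Finset V :=
  Finset.univ.filter fun i => 2 * w ≤ p * vertexDegree G i ∧ p * vertexDegree G i ≤ X - 1

lemma mem_typicalVertices {X : ℝ} : i ∈ typicalVertices G p w X ↔
    2 * w ≤ p * vertexDegree G i ∧ p * vertexDegree G i ≤ X - 1 := by
  simp [typicalVertices]

/-- The error of a vertex is at most `nodeError`, up to the error of the ideal estimator if the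
vertex is typical. -/
lemma Regime.abs_nodeEstimator_sub_le (h : Regime G p α β b A w Ct R δ)
    {X C₁ C₂ αh βh : ℝ} (hC : Cutoffs p w R X C₁ C₂) (hg : GoodRates α β δ αh βh)
    (hc : ∀ k, |y i k| ≤ c) (t s : Bool) :
    |nodeEstimator p G K z y αh βh C₁ C₂ (level t s) i - y i (level t s) -
      (open Classical in if i ∈ typicalVertices G p w X then
        idealNode p α β G K z y i t s - y i (level t s) else 0)| ≤
      nodeError G p α β b A w R δ X c z K i := by
  have hc0 : 0 ≤ c := (abs_nonneg _).trans (hc .c11)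
  obtain ⟨b1, b2, b3, b4⟩ := h.bounds_nonneg X hc0
  obtain ⟨r1, r2, r3, r4, r5⟩ := h.rates hg
  have ht := totalWeight_nonneg p K z i
  have hcrude := h.abs_nodeEstimator_le (K := K) (z := z) (i := i) hC r1 r2 r3 r4 hc t s
  have hy := hc (level t s)
  have n1 := ind_nonneg (X - 1 < p * vertexDegree G i)
  have n2 := ind_nonneg (p * vertexDegree G i < 2 * w)
  have n3 := ind_nonneg (R < p * vertexDegree G i)
  have n4 := ind_nonneg (DegreeDeviates G p α β R δ i K)
  set T := totalWeight p K z i with hT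
  -- the four nonnegative summands of `nodeError`
  have m1 : 0 ≤ lipschitzBound b A w R δ X c * T := by positivity
  have m2 : 0 ≤ (crudeBound b R X c + 4 * idealBound b A w X c) *
    (T * ind (DegreeDeviates G p α β R δ i K)) := by positivity
  have m3 : 0 ≤ ind (X - 1 < p * vertexDegree G i) * (upperBound b w X c * T + c) := by positivity
  have m4' : 0 ≤ crudeBound b R X c * T + c := by positivity
  have m4 : 0 ≤ (ind (p * vertexDegree G i < 2 * w) + ind (R < p * vertexDegree G i)) *
    (crudeBound b R X c * T + c) := by positivity
  unfold nodeError
  rw [← hT]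
  set E := nodeEstimator p G K z y αh βh C₁ C₂ (level t s) i
  by_cases hmid : i ∈ typicalVertices G p w X
  · rw [if_pos hmid]
    rw [mem_typicalVertices] at hmid
    have e : E - y i (level t s) - (idealNode p α β G K z y i t s - y i (level t s)) =
        E - idealNode p α β G K z y i t s := by ring
    rw [e]
    by_cases hdev : DegreeDeviates G p α β R δ i K
    · rw [ind_of hdev, mul_one] at *
      have hI := h.abs_idealNode_le (K := K) (z := z) hC.X_le hc t s hmid.1 (by linarith [hmid.2])
      refine (abs_sub _ _).trans ?_
      rw [add_mul]
      linarith
    · have := h.abs_nodeEstimator_sub_idealNode_le (z := z) hC hg hc t s hmid.1 hmid.2 hdev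
      linarith
  · rw [if_neg hmid, sub_zero]
    rw [mem_typicalVertices] at hmid
    refine (abs_sub _ _).trans ?_
    by_cases hlow : p * vertexDegree G i < 2 * w
    · have : crudeBound b R X c * T + c ≤
          (ind (p * vertexDegree G i < 2 * w) + ind (R < p * vertexDegree G i)) *
            (crudeBound b R X c * T + c) :=
        le_mul_of_one_le_left m4' (by rw [ind_of hlow]; linarith)
      linarith
    · by_cases hfar : R < p * vertexDegree G i
      · have : crudeBound b R X c * T + c ≤
          (ind (p * vertexDegree G i < 2 * w) + ind (R < p * vertexDegree G i)) *
            (crudeBound b R X c * T + c) :=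
          le_mul_of_one_le_left m4' (by rw [ind_of hfar]; linarith)
        linarith
      · have hup : X - 1 < p * vertexDegree G i := by
          by_contra hle
          exact hmid ⟨not_lt.1 hlow, not_lt.1 hle⟩
        rw [ind_of hup, one_mul] at *
        by_cases hdev : DegreeDeviates G p α β R δ i K
        · rw [ind_of hdev, mul_one] at *
          have i1 : 0 ≤ idealBound b A w X c * T := by positivity
          have i2 : 0 ≤ upperBound b w X c * T := by positivity
          rw [add_mul]
          linarith
        · have := h.abs_nodeEstimator_le_of_large (z := z) hC hg hc t s (not_lt.1 hfar) hup.le hdev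
          linarith

/-- On the event that the rates are estimated well, the error is at most a function of the
treatment and the observed network. -/
lemma Regime.abs_mmeEstimator_sub_le (h : Regime G p α β b A w Ct R δ)
    {X C₁ C₂ αh βh : ℝ} (hC : Cutoffs p w R X C₁ C₂) (hg : GoodRates α β δ αh βh)
    (hc : ∀ i k, |y i k| ≤ c) (t s : Bool) :
    |mmeEstimator p G K z y αh βh C₁ C₂ (level t s) - meanOutcome y (level t s)| ≤
      (1 / (Fintype.card V : ℝ)) * ∑ i, nodeError G p α β b A w R δ X c z K i +
      |(1 / (Fintype.card V : ℝ)) * ∑ i ∈ typicalVertices G p w X,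
        (idealNode p α β G K z y i t s - y i (level t s))| := by
  classical
  have hN : (0 : ℝ) ≤ 1 / (Fintype.card V : ℝ) := by positivity
  have e1 : mmeEstimator p G K z y αh βh C₁ C₂ (level t s) - meanOutcome y (level t s) =
      (1 / (Fintype.card V : ℝ)) * ∑ i, (nodeEstimator p G K z y αh βh C₁ C₂ (level t s) i -
        y i (level t s) - (if i ∈ typicalVertices G p w X then
        idealNode p α β G K z y i t s - y i (level t s) else 0)) +
      (1 / (Fintype.card V : ℝ)) * ∑ i ∈ typicalVertices G p w X,
        (idealNode p α β G K z y i t s - y i (level t s)) := by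
    have e2 : ∑ i ∈ typicalVertices G p w X,
        (idealNode p α β G K z y i t s - y i (level t s)) =
        ∑ i, (if i ∈ typicalVertices G p w X then
        idealNode p α β G K z y i t s - y i (level t s) else 0) := by
      rw [Finset.sum_ite_mem, Finset.univ_inter]
    rw [e2, ← mul_add, ← Finset.sum_add_distrib]
    unfold mmeEstimator meanOutcome nodeEstimator
    rw [← mul_sub, ← Finset.sum_sub_distrib]
    congr 1
    refine Finset.sum_congr rfl fun i _ => ?_
    ring
  rw [e1]
  refine (abs_add_le _ _).trans (add_le_add_left ?_ _)
  rw [abs_mul, abs_of_nonneg hN]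
  refine mul_le_mul_of_nonneg_left ((Finset.abs_sum_le_sum_abs _ _).trans
    (Finset.sum_le_sum fun i _ => ?_)) hN
  have := h.abs_nodeEstimator_sub_le (K := K) (z := z) (i := i) hC hg (hc i) t s
  convert this

/-- The error at arbitrary admissible estimates of the rates. -/
lemma Regime.abs_mmeEstimator_sub_le_crude (h : Regime G p α β b A w Ct R δ)
    {X C₁ C₂ αh βh : ℝ} (hC : Cutoffs p w R X C₁ C₂) (hα0 : 0 ≤ αh) (hα1 : αh ≤ 1)
    (hb : b ≤ 1 - βh) (hβ2 : 1 - βh ≤ 2) (hc : ∀ i k, |y i k| ≤ c) (t s : Bool) :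
    |mmeEstimator p G K z y αh βh C₁ C₂ (level t s) - meanOutcome y (level t s)| ≤
      (1 / (Fintype.card V : ℝ)) * ∑ i, (crudeBound b R X c * totalWeight p K z i + c) := by
  have hN : (0 : ℝ) ≤ 1 / (Fintype.card V : ℝ) := by positivity
  unfold mmeEstimator meanOutcome
  rw [← mul_sub, ← Finset.sum_sub_distrib, abs_mul, abs_of_nonneg hN]
  refine mul_le_mul_of_nonneg_left ((Finset.abs_sum_le_sum_abs _ _).trans
    (Finset.sum_le_sum fun i _ => (abs_sub _ _).trans (add_le_add ?_ (hc i _)))) hN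
  exact h.abs_nodeEstimator_le hC hα0 hα1 hb hβ2 (hc i) t s

end Fixed

/-! ### The expected error for a fixed network -/

section Expected

variable {Ω : Type*} [MeasurableSpace Ω] {μ : Measure Ω} [IsProbabilityMeasure μ]
  {V : Type*} [Fintype V] {G : SimpleGraph V} {p α β b A w Ct R δ X c : ℝ}
  {Z : Ω → Finset V} {H : Ω → SimpleGraph V} {y : V → ExposureLevel → ℝ}

lemma Regime.p_lt_one (h : Regime G p α β b A w Ct R δ) : 0 < p ∧ p < 1 :=
  ⟨h.p_pos, by linarith [h.p_le_quarter]⟩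

lemma Regime.α_mem (h : Regime G p α β b A w Ct R δ) : 0 ≤ α ∧ α ≤ 1 :=
  ⟨h.α_nonneg, by linarith [h.α_le, h.pow_le, h.δ_le]⟩

lemma Regime.β_mem (h : Regime G p α β b A w Ct R δ) : 0 ≤ β ∧ β ≤ 1 :=
  ⟨h.β_nonneg, by linarith [h.b_le, h.b_pos]⟩

lemma Regime.card_pos (h : Regime G p α β b A w Ct R δ) : (0 : ℝ) < Fintype.card V := by
  have h1 := h.R_add_one_le
  have h2 := h.one_le_R
  by_contra hlt
  have := mul_nonpos_of_nonneg_of_nonpos h.p_pos.le (not_lt.1 hlt)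
  linarith

lemma Regime.real_deviates_le (h : Regime G p α β b A w Ct R δ)
    (hX : IsNoisyExperiment μ G p α β Z H) (i : V) :
    μ.real {ω | DegreeDeviates G p α β R δ i (H ω)} ≤ (R + A) * δ ^ 2 := by
  have hp := h.p_pos
  have hδ := h.δ_pos
  have hR := h.one_le_R
  have hA := h.A_nonneg
  by_cases hx : p * vertexDegree G i ≤ R
  · have h1 := hX.real_degree_deviation_le h.α_mem h.β_mem i (div_pos hδ hp)
    have h2 : μ.real {ω | DegreeDeviates G p α β R δ i (H ω)} ≤
        μ.real {ω | δ / p ≤ |(vertexDegree (H ω) i : ℝ) - meanObservedDegree G α β i|} := by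
      refine measureReal_mono fun ω hω => ?_
      simp only [Set.mem_ofPred_eq]
      rw [div_le_iff₀ hp, mul_comm]
      exact hω.2
    refine h2.trans (h1.trans ?_)
    rw [div_le_iff₀ (by positivity), div_pow, ← mul_div_assoc, le_div_iff₀ (by positivity)]
    have e1 : p * vertexDegree G i + p * Fintype.card V * α ≤ R + A :=
      add_le_add hx h.α_mul_le
    have e2 : p * (p * vertexDegree G i + p * Fintype.card V * α) ≤ δ ^ 4 * (R + A) :=
      mul_le_mul h.p_le e1 (by have := h.α_nonneg; positivity) (by positivity)
    calc (vertexDegree G i + Fintype.card V * α) * p ^ 2 =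
          p * (p * vertexDegree G i + p * Fintype.card V * α) := by ring
      _ ≤ δ ^ 4 * (R + A) := e2
      _ = _ := by ring
  · have : {ω | DegreeDeviates G p α β R δ i (H ω)} = ∅ := by
      ext ω
      simp only [Set.mem_ofPred_eq, Set.mem_empty_iff_false, iff_false]
      exact fun hω => hx hω.1
    rw [this, measureReal_empty]
    positivity

lemma Regime.integral_nodeError_le (h : Regime G p α β b A w Ct R δ)
    (hX : IsNoisyExperiment μ G p α β Z H) (hc : 0 ≤ c) (i : V) :
    ∫ ω, nodeError G p α β b A w R δ X c (Z ω) (H ω) i ∂μ ≤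
      4 * lipschitzBound b A w R δ X c +
      4 * (crudeBound b R X c + 4 * idealBound b A w X c) * ((R + A) * δ ^ 2) +
      ind (X - 1 < p * vertexDegree G i) * (4 * upperBound b w X c + c) +
      (ind (p * vertexDegree G i < 2 * w) + ind (R < p * vertexDegree G i)) *
        (4 * crudeBound b R X c + c) := by
  obtain ⟨b1, b2, b3, b4⟩ := h.bounds_nonneg X hc
  have hT := hX.integral_totalWeight_le i
  have hD := (hX.integral_totalWeight_mul_le i (DegreeDeviates G p α β R δ i)).trans
    (mul_le_mul_of_nonneg_left (h.real_deviates_le hX i) (by norm_num))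
  have iT : Integrable (fun ω => totalWeight p (H ω) (Z ω) i) μ :=
    hX.integrable_comp fun z K => totalWeight p K z i
  have iD : Integrable (fun ω => totalWeight p (H ω) (Z ω) i *
      ind (DegreeDeviates G p α β R δ i (H ω))) μ :=
    hX.integrable_comp fun z K => totalWeight p K z i * ind (DegreeDeviates G p α β R δ i K)
  have iU : Integrable (fun ω => upperBound b w X c * totalWeight p (H ω) (Z ω) i + c) μ :=
    (iT.const_mul _).add (integrable_const _)
  have iC : Integrable (fun ω => crudeBound b R X c * totalWeight p (H ω) (Z ω) i + c) μ :=
    (iT.const_mul _).add (integrable_const _)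
  have hU : ∫ ω, (upperBound b w X c * totalWeight p (H ω) (Z ω) i + c) ∂μ ≤
      4 * upperBound b w X c + c := by
    rw [integral_add (iT.const_mul _) (integrable_const _), integral_const_mul, integral_const]
    simp only [probReal_univ, one_smul]
    nlinarith
  have hC : ∫ ω, (crudeBound b R X c * totalWeight p (H ω) (Z ω) i + c) ∂μ ≤
      4 * crudeBound b R X c + c := by
    rw [integral_add (iT.const_mul _) (integrable_const _), integral_const_mul, integral_const]
    simp only [probReal_univ, one_smul]
    nlinarith
  unfold nodeError
  have j1 : Integrable (fun ω => lipschitzBound b A w R δ X c * totalWeight p (H ω) (Z ω) i) μ :=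
    iT.const_mul _
  have j2 : Integrable (fun ω => (crudeBound b R X c + 4 * idealBound b A w X c) *
    (totalWeight p (H ω) (Z ω) i * ind (DegreeDeviates G p α β R δ i (H ω)))) μ := iD.const_mul _
  have j3 : Integrable (fun ω => ind (X - 1 < p * vertexDegree G i) *
    (upperBound b w X c * totalWeight p (H ω) (Z ω) i + c)) μ := iU.const_mul _
  have j4 : Integrable (fun ω => (ind (p * vertexDegree G i < 2 * w) +
    ind (R < p * vertexDegree G i)) * (crudeBound b R X c * totalWeight p (H ω) (Z ω) i + c)) μ :=
    iC.const_mul _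
  have j12 : Integrable (fun ω => lipschitzBound b A w R δ X c * totalWeight p (H ω) (Z ω) i +
    (crudeBound b R X c + 4 * idealBound b A w X c) *
    (totalWeight p (H ω) (Z ω) i * ind (DegreeDeviates G p α β R δ i (H ω)))) μ := j1.add j2
  have j123 : Integrable (fun ω => lipschitzBound b A w R δ X c * totalWeight p (H ω) (Z ω) i +
    (crudeBound b R X c + 4 * idealBound b A w X c) *
    (totalWeight p (H ω) (Z ω) i * ind (DegreeDeviates G p α β R δ i (H ω))) +
    ind (X - 1 < p * vertexDegree G i) *
    (upperBound b w X c * totalWeight p (H ω) (Z ω) i + c)) μ := j12.add j3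
  rw [integral_add j123 j4, integral_add j12 j3, integral_add j1 j2,
    integral_const_mul, integral_const_mul, integral_const_mul, integral_const_mul]
  have n1 := ind_nonneg (X - 1 < p * vertexDegree G i)
  have n2 := ind_nonneg (p * vertexDegree G i < 2 * w)
  have n3 := ind_nonneg (R < p * vertexDegree G i)
  have e1 := mul_le_mul_of_nonneg_left hT b4
  have e2 := mul_le_mul_of_nonneg_left hD
    (by positivity : 0 ≤ crudeBound b R X c + 4 * idealBound b A w X c)
  have e3 := mul_le_mul_of_nonneg_left hU n1
  have e4 := mul_le_mul_of_nonneg_left hC (add_nonneg n2 n3)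
  linarith

/-- A bound for the fraction of vertices of atypical degree. -/
noncomputable def tailBound (Ct δ m : ℝ) : ℝ := δ + Ct * Real.exp (-m) / m

/-- The expected average of `nodeError`. -/
noncomputable def nodeErrorBound (b A w Ct R δ X c : ℝ) : ℝ :=
  4 * lipschitzBound b A w R δ X c +
  4 * (crudeBound b R X c + 4 * idealBound b A w X c) * ((R + A) * δ ^ 2) +
  tailBound Ct δ (X - 1) * (4 * upperBound b w X c + c) +
  (δ + tailBound Ct δ R) * (4 * crudeBound b R X c + c)

lemma Regime.integral_average_nodeError_le (h : Regime G p α β b A w Ct R δ)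
    (hX : IsNoisyExperiment μ G p α β Z H) (hc : 0 ≤ c) (hX4 : 4 ≤ X) :
    ∫ ω, (1 / (Fintype.card V : ℝ)) * ∑ i, nodeError G p α β b A w R δ X c (Z ω) (H ω) i ∂μ ≤
      nodeErrorBound b A w Ct R δ X c := by
  obtain ⟨b1, b2, b3, b4⟩ := h.bounds_nonneg X hc
  have hN := h.card_pos
  rw [integral_const_mul, integral_finsetSum _ fun i _ =>
    hX.integrable_comp fun z K => nodeError G p α β b A w R δ X c z K i]
  rw [one_div, inv_mul_le_iff₀ hN]
  refine (Finset.sum_le_sum fun i _ => h.integral_nodeError_le hX hc i).trans ?_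
  rw [Finset.sum_add_distrib, Finset.sum_add_distrib, Finset.sum_const, ← Finset.sum_mul,
    ← Finset.sum_mul, Finset.sum_add_distrib, Finset.card_univ, nsmul_eq_mul]
  have t1 := h.tail (X - 1) (by linarith)
  have t2 := h.tail R h.one_le_R
  have t3 := h.low
  have e1 := mul_le_mul_of_nonneg_right t1 (by positivity : 0 ≤ 4 * upperBound b w X c + c)
  have e2 := mul_le_mul_of_nonneg_right (add_le_add t3 t2)
    (by positivity : 0 ≤ 4 * crudeBound b R X c + c)
  unfold nodeErrorBound tailBound
  calc _ ≤ _ := add_le_add (add_le_add le_rfl e1) e2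
    _ = _ := by ring

/-- The expected error of the average of the ideal estimators. -/
noncomputable def idealErrorBound (b A w R δ X c : ℝ) : ℝ :=
  16 * idealBound b A w X c ^ 2 * ((7 + 3 * R + A) * δ ^ 3) + δ / 2

lemma Regime.integral_abs_average_idealNode_le (h : Regime G p α β b A w Ct R δ)
    (hX : IsNoisyExperiment μ G p α β Z H) (hc : ∀ i k, |y i k| ≤ c) (hXR : X ≤ R)
    (t s : Bool) :
    ∫ ω, |(1 / (Fintype.card V : ℝ)) * ∑ i ∈ typicalVertices G p w X,
        (idealNode p α β G (H ω) (Z ω) y i t s - y i (level t s))| ∂μ ≤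
      idealErrorBound b A w R δ X c := by
  have hN := h.card_pos
  have hV : Nonempty V := Fintype.card_pos_iff.1 (by exact_mod_cast hN)
  have hc0 : 0 ≤ c := (abs_nonneg _).trans (hc hV.some .c11)
  obtain ⟨b1, b2, b3, b4⟩ := h.bounds_nonneg X hc0
  have hp := h.p_lt_one
  have hδ := h.δ_pos
  have hR := h.one_le_R
  have hA := h.A_nonneg
  set N : ℝ := (Fintype.card V : ℝ) with hNdef
  set T := typicalVertices G p w X with hT
  set S : Finset V → SimpleGraph V → ℝ := fun z K =>
    ∑ i ∈ T, (idealNode p α β G K z y i t s - y i (level t s)) with hS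
  have hadm : ∀ i ∈ T, Admissible (Fintype.card V) p α β (vertexDegree G i) b w X := by
    intro i hi
    rw [hT, mem_typicalVertices] at hi
    exact h.admissible_true hXR hi.1 (by linarith [hi.2])
  have hdeg : ∀ i ∈ T, p * vertexDegree G i ≤ R := by
    intro i hi
    rw [hT, mem_typicalVertices] at hi
    linarith [hi.2]
  have hpair : ∀ i ∈ T, ∀ j ∈ T, pairError G p α i j ≤ (3 + 2 * R + A) * δ ^ 4 := by
    intro i hi j hj
    have d1 := hdeg i hi
    have d2 := hdeg j hj
    have hα := h.α_nonneg
    have e : pairError G p α i j =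
        α * (3 + p * vertexDegree G i + p * vertexDegree G j + p * Fintype.card V * α) := by
      unfold pairError
      ring
    rw [e, mul_comm]
    refine mul_le_mul ?_ h.α_le hα (by positivity)
    linarith [h.α_mul_le]
  have hvar := hX.integral_sum_idealNode_sub_sq_le hp h.α_mem h.β_mem y t s T
    (B := idealBound b A w X c) (ε := (3 + 2 * R + A) * δ ^ 4) b3 (by positivity)
    (fun i hi x => (hadm i hi).abs_idealCoeff_le (hc i) h.α_mul_le t s x)
    (fun i hi => by
      have had := hadm i hi
      refine hX.integral_idealNode hp y i t s (Real.rpow_pos_of_pos (by linarith) _).ne'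
        (Real.rpow_pos_of_pos (by linarith [had.rate_mul_le]) _).ne' ?_
      have := noHitProb_lt_one hp.1 had.b_pos had.b_le had.hit_mul_le had.degree_pos
      linarith) hpair
  rw [← hNdef] at hvar
  have hq : p ≤ treatProb p t := by
    have := h.p_le_quarter
    cases t <;> simp only [treatProb] <;> linarith
  have hpN : 1 ≤ δ ^ 4 * (p * N) := h.one_le
  have v1 : N / treatProb p t ≤ N ^ 2 * δ ^ 4 := by
    rw [div_le_iff₀ (treatProb_pos hp t)]
    have : N * 1 ≤ N * (δ ^ 4 * (p * N)) := mul_le_mul_of_nonneg_left hpN hN.le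
    have h2 : N ^ 2 * δ ^ 4 * p ≤ N ^ 2 * δ ^ 4 * treatProb p t :=
      mul_le_mul_of_nonneg_left hq (by positivity)
    linarith
  have v2 : ∑ i ∈ T, (vertexDegree G i : ℝ) ≤ N ^ 2 * (R * δ ^ 4) := by
    have e1 : ∀ i ∈ T, (vertexDegree G i : ℝ) ≤ R * δ ^ 4 * N := by
      intro i hi
      have d1 := hdeg i hi
      by_contra hlt
      have e2 := mul_lt_mul_of_pos_left (not_le.1 hlt) hp.1
      have e3 := mul_le_mul_of_nonneg_left hpN (by positivity : 0 ≤ R)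
      linarith
    calc ∑ i ∈ T, (vertexDegree G i : ℝ) ≤ ∑ i ∈ T, R * δ ^ 4 * N := Finset.sum_le_sum e1
      _ = T.card * (R * δ ^ 4 * N) := by rw [Finset.sum_const, nsmul_eq_mul]
      _ ≤ N * (R * δ ^ 4 * N) := by
          refine mul_le_mul_of_nonneg_right ?_ (by positivity)
          rw [hNdef]
          exact_mod_cast Finset.card_le_univ T
      _ = _ := by ring
  have v3 := h.pairs
  rw [← hNdef] at v3
  have hvar2 : ∫ ω, S (Z ω) (H ω) ^ 2 ∂μ ≤
      32 * idealBound b A w X c ^ 2 * (N ^ 2 * ((7 + 3 * R + A) * δ ^ 4)) := by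
    refine hvar.trans (mul_le_mul_of_nonneg_left ?_ (by positivity))
    have : 0 ≤ N ^ 2 * δ ^ 4 := by positivity
    linarith
  -- the first moment is bounded by the second one through `x ≤ x ^ 2 / (2 δ) + δ / 2`
  have hpt : ∀ ω, |1 / N * S (Z ω) (H ω)| ≤
      1 / (2 * δ * N ^ 2) * S (Z ω) (H ω) ^ 2 + δ / 2 := by
    intro ω
    set x := |1 / N * S (Z ω) (H ω)| with hx
    have e1 : 1 / (2 * δ * N ^ 2) * S (Z ω) (H ω) ^ 2 = x ^ 2 / (2 * δ) := by
      rw [hx, sq_abs]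
      field_simp
    rw [e1]
    have e2 : x ^ 2 / (2 * δ) + δ / 2 - x = (x - δ) ^ 2 / (2 * δ) := by
      field_simp
      ring
    have e3 : 0 ≤ (x - δ) ^ 2 / (2 * δ) := by positivity
    linarith
  have iS : Integrable (fun ω => S (Z ω) (H ω) ^ 2) μ :=
    hX.integrable_comp fun z K => S z K ^ 2
  calc ∫ ω, |1 / N * S (Z ω) (H ω)| ∂μ
      ≤ ∫ ω, (1 / (2 * δ * N ^ 2) * S (Z ω) (H ω) ^ 2 + δ / 2) ∂μ :=
        integral_mono (hX.integrable_comp fun z K => |1 / N * S z K|)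
          ((iS.const_mul _).add (integrable_const _)) hpt
    _ = 1 / (2 * δ * N ^ 2) * ∫ ω, S (Z ω) (H ω) ^ 2 ∂μ + δ / 2 := by
        rw [integral_add (iS.const_mul _) (integrable_const _), integral_const_mul,
          integral_const]
        simp
    _ ≤ 1 / (2 * δ * N ^ 2) *
          (32 * idealBound b A w X c ^ 2 * (N ^ 2 * ((7 + 3 * R + A) * δ ^ 4))) + δ / 2 := by
        have := mul_le_mul_of_nonneg_left hvar2 (by positivity : 0 ≤ 1 / (2 * δ * N ^ 2))
        linarith
    _ = _ := by
        unfold idealErrorBound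
        field_simp
        ring

/-- The bound for the error as a function of the treatment and the observed network. -/
noncomputable def errorMajorant (G : SimpleGraph V) (p α β b A w R δ X c : ℝ)
    (y : V → ExposureLevel → ℝ) (t s : Bool) (z : Finset V) (K : SimpleGraph V) : ℝ :=
  (1 / (Fintype.card V : ℝ)) * ∑ i, nodeError G p α β b A w R δ X c z K i +
    |(1 / (Fintype.card V : ℝ)) * ∑ i ∈ typicalVertices G p w X,
      (idealNode p α β G K z y i t s - y i (level t s))|

lemma Regime.integral_errorMajorant_le (h : Regime G p α β b A w Ct R δ)
    (hX : IsNoisyExperiment μ G p α β Z H) (hc : ∀ i k, |y i k| ≤ c) (hXR : X ≤ R) (hX4 : 4 ≤ X)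
    (t s : Bool) :
    ∫ ω, errorMajorant G p α β b A w R δ X c y t s (Z ω) (H ω) ∂μ ≤
      nodeErrorBound b A w Ct R δ X c + idealErrorBound b A w R δ X c := by
  have hV : Nonempty V := Fintype.card_pos_iff.1 (by exact_mod_cast h.card_pos)
  have hc0 : 0 ≤ c := (abs_nonneg _).trans (hc hV.some .c11)
  unfold errorMajorant
  rw [integral_add (hX.integrable_comp fun z K =>
    (1 / (Fintype.card V : ℝ)) * ∑ i, nodeError G p α β b A w R δ X c z K i)
    (hX.integrable_comp fun z K => |(1 / (Fintype.card V : ℝ)) * ∑ i ∈ typicalVertices G p w X,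
      (idealNode p α β G K z y i t s - y i (level t s))|)]
  exact add_le_add (h.integral_average_nodeError_le hX hc0 hX4)
    (h.integral_abs_average_idealNode_le hX hc hXR t s)

lemma Regime.nodeError_nonneg (h : Regime G p α β b A w Ct R δ) (hc : 0 ≤ c) (z : Finset V)
    (K : SimpleGraph V) (i : V) : 0 ≤ nodeError G p α β b A w R δ X c z K i := by
  obtain ⟨b1, b2, b3, b4⟩ := h.bounds_nonneg X hc
  have := totalWeight_nonneg p K z i
  have n1 := ind_nonneg (X - 1 < p * vertexDegree G i)
  have n2 := ind_nonneg (p * vertexDegree G i < 2 * w)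
  have n3 := ind_nonneg (R < p * vertexDegree G i)
  have n4 := ind_nonneg (DegreeDeviates G p α β R δ i K)
  unfold nodeError
  positivity

lemma Regime.errorMajorant_nonneg (h : Regime G p α β b A w Ct R δ) (hc : 0 ≤ c) (t s : Bool)
    (z : Finset V) (K : SimpleGraph V) :
    0 ≤ errorMajorant G p α β b A w R δ X c y t s z K :=
  add_nonneg (mul_nonneg (by positivity)
    (Finset.sum_nonneg fun i _ => h.nodeError_nonneg hc z K i)) (abs_nonneg _)

/-- The probability of an error of size `ε`. -/
lemma Regime.real_error_ge_le (h : Regime G p α β b A w Ct R δ)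
    (hX : IsNoisyExperiment μ G p α β Z H) (hc : ∀ i k, |y i k| ≤ c) {C₁ C₂ : ℝ}
    (hC : Cutoffs p w R X C₁ C₂) (αh βh : Ω → ℝ) (t s : Bool) {ε : ℝ} (hε : 0 < ε) :
    μ.real {ω | ε ≤ |mmeEstimator p G (H ω) (Z ω) y (αh ω) (βh ω) C₁ C₂ (level t s) -
      meanOutcome y (level t s)|} ≤ μ.real {ω | ¬ GoodRates α β δ (αh ω) (βh ω)} +
      (nodeErrorBound b A w Ct R δ X c + idealErrorBound b A w R δ X c) / ε := by
  have hV : Nonempty V := Fintype.card_pos_iff.1 (by exact_mod_cast h.card_pos)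
  have hc0 : 0 ≤ c := (abs_nonneg _).trans (hc hV.some .c11)
  have hm := mul_meas_ge_le_integral_of_nonneg (μ := μ)
    (f := fun ω => errorMajorant G p α β b A w R δ X c y t s (Z ω) (H ω))
    (Eventually.of_forall fun ω => h.errorMajorant_nonneg hc0 t s _ _)
    (hX.integrable_comp fun z K => errorMajorant G p α β b A w R δ X c y t s z K) ε
  have hm2 : μ.real {ω | ε ≤ errorMajorant G p α β b A w R δ X c y t s (Z ω) (H ω)} ≤
      (nodeErrorBound b A w Ct R δ X c + idealErrorBound b A w R δ X c) / ε := by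
    rw [le_div_iff₀ hε, mul_comm]
    exact hm.trans (h.integral_errorMajorant_le hX hc hC.X_le hC.four_le t s)
  refine le_trans ?_ (add_le_add le_rfl hm2)
  refine le_trans (measureReal_mono fun ω hω => ?_) (measureReal_union_le _ _)
  have hω' : ε ≤ |mmeEstimator p G (H ω) (Z ω) y (αh ω) (βh ω) C₁ C₂ (level t s) -
      meanOutcome y (level t s)| := hω
  by_cases hg : GoodRates α β δ (αh ω) (βh ω)
  · exact Or.inr (hω'.trans (h.abs_mmeEstimator_sub_le hC hg hc t s))
  · exact Or.inl hg

/-! ### The contribution of poor estimates of the rates -/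

/-- A bound for the ratio of the total weight to the treatment weights at typical vertices. -/
noncomputable def weightBound (b A w R : ℝ) : ℝ := Real.exp (R + A + 2) * (1 + 1 / (b * w))

/-- Away from atypical degrees, the total weight is controlled by the treatment weights, which do not
depend on the observed network. -/
lemma Regime.totalWeight_le (h : Regime G p α β b A w Ct R δ) (z : Finset V) (K : SimpleGraph V)
    (i : V) : totalWeight p K z i ≤
      totalWeight p K z i * ind (DegreeDeviates G p α β R δ i K) +
      (ind (p * vertexDegree G i < 2 * w) + ind (R < p * vertexDegree G i)) *
        totalWeight p K z i +
      weightBound b A w R * (treatWeight p z i true + treatWeight p z i false) := by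
  have hp := h.p_lt_one
  have hp4 := h.p_le_quarter
  have ht := totalWeight_nonneg p K z i
  have n2 := ind_nonneg (p * vertexDegree G i < 2 * w)
  have n3 := ind_nonneg (R < p * vertexDegree G i)
  have n4 := ind_nonneg (DegreeDeviates G p α β R δ i K)
  have w1 := treatWeight_nonneg ⟨hp.1.le, hp.2.le⟩ z i true
  have w2 := treatWeight_nonneg ⟨hp.1.le, hp.2.le⟩ z i false
  have hb := h.b_pos
  have hw := h.w_pos
  have hw1 := h.w_le
  have hδ := h.δ_pos
  have hR := h.one_le_R
  have hA := h.A_nonneg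
  have hQ0 : 0 ≤ weightBound b A w R := by unfold weightBound; positivity
  have m1 : 0 ≤ totalWeight p K z i * ind (DegreeDeviates G p α β R δ i K) := by positivity
  have m3 : 0 ≤ weightBound b A w R * (treatWeight p z i true + treatWeight p z i false) := by
    positivity
  by_cases hlow : p * vertexDegree G i < 2 * w
  · rw [ind_of hlow] at *
    nlinarith
  by_cases hfar : R < p * vertexDegree G i
  · rw [ind_of hfar] at *
    nlinarith
  have m2 : 0 ≤ (ind (p * vertexDegree G i < 2 * w) + ind (R < p * vertexDegree G i)) *
        totalWeight p K z i := by positivity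
  by_cases hdev : DegreeDeviates G p α β R δ i K
  · rw [ind_of hdev] at *
    linarith
  have hdev' : p * |(vertexDegree K i : ℝ) - meanObservedDegree G α β i| ≤ δ := by
    by_contra hlt
    exact hdev ⟨not_lt.1 hfar, (not_le.1 hlt).le⟩
  rw [← abs_of_pos hp.1, ← abs_mul, abs_le, mul_sub] at hdev'
  -- the observed degree is of order `1 / p`
  have hθ := h.theta_le
  have hb1 : b ≤ 1 := by linarith [h.b_le, h.β_nonneg]
  have hd0 : (0 : ℝ) ≤ vertexDegree G i := Nat.cast_nonneg _
  have hdN := vertexDegree_le G i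
  have hα := h.α_nonneg
  have hmean_le : p * meanObservedDegree G α β i ≤ R + A := by
    unfold meanObservedDegree
    have e1 : p * (vertexDegree G i * (1 - β)) ≤ p * vertexDegree G i := by
      have := mul_nonneg (mul_nonneg hp.1.le hd0) h.β_nonneg
      linarith
    have e2 : p * (((Fintype.card V : ℝ) - 1 - vertexDegree G i) * α) ≤
        p * Fintype.card V * α := by
      have : 0 ≤ p * (1 + vertexDegree G i) * α := by
        have := hp.1
        positivity
      linarith
    linarith [h.α_mul_le, not_lt.1 hfar]
  have hmean_ge : 2 * w * (4 * b) ≤ p * meanObservedDegree G α β i := by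
    unfold meanObservedDegree
    have e1 : 2 * w * (4 * b) ≤ p * vertexDegree G i * (1 - β) :=
      mul_le_mul (not_lt.1 hlow) h.b_le (by positivity) (mul_nonneg hp.1.le hd0)
    have e2 : 0 ≤ p * (((Fintype.card V : ℝ) - 1 - vertexDegree G i) * α) :=
      mul_nonneg hp.1.le (mul_nonneg (by linarith) hα)
    linarith
  have hδbw : δ ≤ b * w := by
    have e1 : δ / b ≤ w := by
      have : δ / b ≤ (2 * R + A + 1) * δ / b := by
        refine div_le_div_of_nonneg_right ?_ hb.le
        nlinarith
      linarith
    rw [div_le_iff₀ hb] at e1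
    linarith
  have hle : p * vertexDegree K i ≤ R + A + 1 := by linarith [hdev'.2, h.δ_le]
  have hbw : 0 < b * w := by positivity
  have hge : b * w ≤ p * vertexDegree K i := by linarith [hdev'.1]
  have q1 : invUntreatedProb p (vertexDegree K i) ≤ weightBound b A w R := by
    have hpX : 2 * p * (R + A + 1) ≤ 1 := by
      have e0 := h.error_le
      have e1 : (2 * R + A + 1) * δ ≤ (2 * R + A + 1) * δ / b := by
        rw [le_div_iff₀ hb]
        exact mul_le_of_le_one_right (by positivity) hb1
      have e2 : p * (R + A + 1) ≤ δ / 64 * (2 * R + A + 1) :=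
        mul_le_mul (h.p_le.trans h.pow_le) (by linarith) (by positivity) (by positivity)
      linarith
    have e1 : invUntreatedProb p (vertexDegree K i) ≤ Real.exp (R + A + 1 + 1) :=
      invUntreatedProb_le_exp hp.1.le (by linarith) hle (by positivity) hpX
    have e2 : R + A + 1 + 1 = R + A + 2 := by ring
    rw [e2] at e1
    unfold weightBound
    have : 0 < 1 / (b * w) := by positivity
    exact e1.trans (le_mul_of_one_le_right (Real.exp_pos _).le (by linarith))
  have q2 : (1 - (1 - p) ^ vertexDegree K i)⁻¹ ≤ weightBound b A w R := by
    have e1 := inv_one_sub_noHitProb_le (β := 0) hp.1 zero_lt_one (by norm_num : (1 : ℝ) ≤ 1 - 0)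
      (by linarith) hbw hge
    have e2 : noHitProb p (vertexDegree K i) 0 = (1 - p) ^ vertexDegree K i := by
      simp [noHitProb]
    rw [e2, one_mul] at e1
    unfold weightBound
    have : 0 < 1 / (b * w) := by positivity
    exact e1.trans (le_mul_of_one_le_left (by positivity)
      (Real.one_le_exp (by linarith)))
  have := _root_.totalWeight_le ⟨hp.1, by linarith⟩ q1 q2 (z := z)
  linarith

/-- A bound for the expected average total weight on an event of probability at most `2 δ ^ 4`. -/
noncomputable def badWeightBound (b A w Ct R δ : ℝ) : ℝ :=
  4 * ((R + A) * δ ^ 2) + 4 * (δ + tailBound Ct δ R) + 4 * weightBound b A w R * δ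

lemma Regime.integral_bad_treatWeight_le (h : Regime G p α β b A w Ct R δ)
    (hX : IsNoisyExperiment μ G p α β Z H) {B : Ω → Prop} (hB : MeasurableSet {ω | B ω})
    (hBμ : μ.real {ω | B ω} ≤ 2 * δ ^ 4) (t : Bool) :
    ∫ ω, ind (B ω) * ((1 / (Fintype.card V : ℝ)) * ∑ i, treatWeight p (Z ω) i t) ∂μ ≤ 2 * δ := by
  have hN := h.card_pos
  have hp := h.p_lt_one
  have hδ := h.δ_pos
  set N : ℝ := (Fintype.card V : ℝ) with hNdef
  have hsq := hX.integral_sum_treatWeight_sq hp t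
  rw [← hNdef] at hsq
  have hq : p ≤ treatProb p t := by
    have := h.p_le_quarter
    cases t <;> simp only [treatProb] <;> linarith
  have hpN : 1 ≤ p * N := by linarith [h.R_add_one_le, h.one_le_R]
  have v1 : N / treatProb p t ≤ N ^ 2 := by
    rw [div_le_iff₀ (treatProb_pos hp t)]
    have : N * 1 ≤ N * (p * N) := mul_le_mul_of_nonneg_left hpN hN.le
    have h2 : N ^ 2 * p ≤ N ^ 2 * treatProb p t := mul_le_mul_of_nonneg_left hq (by positivity)
    linarith
  set T : Finset V → ℝ := fun z => ∑ i, treatWeight p z i t with hT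
  -- `x ≤ 1 / (2 δ) + δ x ^ 2 / 2` on the event, whose probability beats the factor `1 / δ`
  have hpt : ∀ ω, ind (B ω) * (1 / N * T (Z ω)) ≤
      1 / (2 * δ) * ind (B ω) + δ / (2 * N ^ 2) * T (Z ω) ^ 2 := by
    intro ω
    have e1 : 0 ≤ δ / (2 * N ^ 2) * T (Z ω) ^ 2 := by positivity
    by_cases hb : B ω
    · rw [ind_of hb]
      have e2 : 1 / (2 * δ) * 1 + δ / (2 * N ^ 2) * T (Z ω) ^ 2 - 1 * (1 / N * T (Z ω)) =
          (δ * (T (Z ω) / N) - 1) ^ 2 / (2 * δ) := by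
        field_simp
        ring
      have e3 : 0 ≤ (δ * (T (Z ω) / N) - 1) ^ 2 / (2 * δ) := by positivity
      linarith
    · rw [ind_of_not hb]
      linarith
  have iT : Integrable (fun ω => T (Z ω) ^ 2) μ := hX.integrable_comp fun z _ => T z ^ 2
  have iB := integrable_ind (μ := μ) hB
  have iT1 : Integrable (fun ω => 1 / N * T (Z ω)) μ := hX.integrable_comp fun z _ => 1 / N * T z
  have iL : Integrable (fun ω => ind (B ω) * (1 / N * T (Z ω))) μ := by
    refine iT1.bdd_mul (c := 1) iB.aestronglyMeasurable (Eventually.of_forall fun ω => ?_)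
    rw [Real.norm_of_nonneg (ind_nonneg _)]
    exact ind_le_one _
  calc ∫ ω, ind (B ω) * (1 / N * T (Z ω)) ∂μ
      ≤ ∫ ω, (1 / (2 * δ) * ind (B ω) + δ / (2 * N ^ 2) * T (Z ω) ^ 2) ∂μ :=
        integral_mono iL ((iB.const_mul _).add (iT.const_mul _)) hpt
    _ = 1 / (2 * δ) * μ.real {ω | B ω} + δ / (2 * N ^ 2) * ∫ ω, T (Z ω) ^ 2 ∂μ := by
        rw [integral_add (iB.const_mul _) (iT.const_mul _), integral_const_mul,
          integral_const_mul, integral_ind hB]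
    _ ≤ 1 / (2 * δ) * (2 * δ ^ 4) + δ / (2 * N ^ 2) * (N ^ 2 + N ^ 2) := by
        refine add_le_add (mul_le_mul_of_nonneg_left hBμ (by positivity))
          (mul_le_mul_of_nonneg_left (hsq.trans (by linarith)) (by positivity))
    _ = δ ^ 3 + δ := by
        field_simp
        ring
    _ ≤ 2 * δ := by
        have : δ ^ 3 ≤ δ ^ 1 := pow_le_pow_of_le_one hδ.le (by linarith [h.δ_le]) (by norm_num)
        linarith

/-- The total weights are uniformly integrable on average: on an event of small probability, which
may depend on everything, their average has small expectation. -/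
lemma Regime.integral_bad_totalWeight_le (h : Regime G p α β b A w Ct R δ)
    (hX : IsNoisyExperiment μ G p α β Z H) {B : Ω → Prop} (hB : MeasurableSet {ω | B ω})
    (hBμ : μ.real {ω | B ω} ≤ 2 * δ ^ 4) :
    ∫ ω, ind (B ω) * ((1 / (Fintype.card V : ℝ)) * ∑ i, totalWeight p (H ω) (Z ω) i) ∂μ ≤
      badWeightBound b A w Ct R δ := by
  have hN := h.card_pos
  have hp := h.p_lt_one
  have hδ := h.δ_pos
  have hb := h.b_pos
  have hw := h.w_pos
  have hQ0 : 0 ≤ weightBound b A w R := by unfold weightBound; positivity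
  set N : ℝ := (Fintype.card V : ℝ) with hNdef
  have iB := integrable_ind (μ := μ) hB
  have hbdd : ∀ F : Finset V → SimpleGraph V → ℝ,
      Integrable (fun ω => ind (B ω) * F (Z ω) (H ω)) μ := by
    intro F
    refine (hX.integrable_comp F).bdd_mul (c := 1) iB.aestronglyMeasurable
      (Eventually.of_forall fun ω => ?_)
    rw [Real.norm_of_nonneg (ind_nonneg _)]
    exact ind_le_one _
  set F₁ : V → Finset V → SimpleGraph V → ℝ := fun i z K =>
    totalWeight p K z i * ind (DegreeDeviates G p α β R δ i K) +
      (ind (p * vertexDegree G i < 2 * w) + ind (R < p * vertexDegree G i)) *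
        totalWeight p K z i with hF₁
  have hF₁0 : ∀ i z K, 0 ≤ F₁ i z K := by
    intro i z K
    have := totalWeight_nonneg p K z i
    have n2 := ind_nonneg (p * vertexDegree G i < 2 * w)
    have n3 := ind_nonneg (R < p * vertexDegree G i)
    have n4 := ind_nonneg (DegreeDeviates G p α β R δ i K)
    simp only [hF₁]
    positivity
  have hpt : ∀ ω, ind (B ω) * (1 / N * ∑ i, totalWeight p (H ω) (Z ω) i) ≤
      1 / N * ∑ i, F₁ i (Z ω) (H ω) + weightBound b A w R *
        (ind (B ω) * (1 / N * ∑ i, treatWeight p (Z ω) i true) +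
          ind (B ω) * (1 / N * ∑ i, treatWeight p (Z ω) i false)) := by
    intro ω
    have e1 : ∑ i, totalWeight p (H ω) (Z ω) i ≤ ∑ i, F₁ i (Z ω) (H ω) +
        weightBound b A w R * (∑ i, treatWeight p (Z ω) i true +
          ∑ i, treatWeight p (Z ω) i false) := by
      rw [← Finset.sum_add_distrib, Finset.mul_sum, ← Finset.sum_add_distrib]
      exact Finset.sum_le_sum fun i _ => h.totalWeight_le _ _ _
    have e2 : 0 ≤ 1 / N * ∑ i, F₁ i (Z ω) (H ω) :=
      mul_nonneg (by positivity) (Finset.sum_nonneg fun i _ => hF₁0 _ _ _)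
    by_cases hBω : B ω
    · rw [ind_of hBω]
      have := mul_le_mul_of_nonneg_left e1 (by positivity : 0 ≤ 1 / N)
      linarith
    · rw [ind_of_not hBω]
      linarith
  have i1 : Integrable (fun ω => 1 / N * ∑ i, F₁ i (Z ω) (H ω)) μ :=
    hX.integrable_comp fun z K => 1 / N * ∑ i, F₁ i z K
  have i2 : ∀ t, Integrable (fun ω => ind (B ω) * (1 / N * ∑ i, treatWeight p (Z ω) i t)) μ :=
    fun t => hbdd fun z _ => 1 / N * ∑ i, treatWeight p z i t
  have hF₁le : ∀ i, ∫ ω, F₁ i (Z ω) (H ω) ∂μ ≤ 4 * ((R + A) * δ ^ 2) +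
      (ind (p * vertexDegree G i < 2 * w) + ind (R < p * vertexDegree G i)) * 4 := by
    intro i
    have n2 := ind_nonneg (p * vertexDegree G i < 2 * w)
    have n3 := ind_nonneg (R < p * vertexDegree G i)
    have hD := (hX.integral_totalWeight_mul_le i (DegreeDeviates G p α β R δ i)).trans
      (mul_le_mul_of_nonneg_left (h.real_deviates_le hX i) (by norm_num))
    have iT : Integrable (fun ω => totalWeight p (H ω) (Z ω) i) μ :=
      hX.integrable_comp fun z K => totalWeight p K z i
    have iD : Integrable (fun ω => totalWeight p (H ω) (Z ω) i *
        ind (DegreeDeviates G p α β R δ i (H ω))) μ :=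
      hX.integrable_comp fun z K => totalWeight p K z i * ind (DegreeDeviates G p α β R δ i K)
    simp only [hF₁]
    rw [integral_add iD (iT.const_mul _), integral_const_mul]
    exact add_le_add hD
      (mul_le_mul_of_nonneg_left (hX.integral_totalWeight_le i) (add_nonneg n2 n3))
  have hsum : ∫ ω, 1 / N * ∑ i, F₁ i (Z ω) (H ω) ∂μ ≤
      4 * ((R + A) * δ ^ 2) + 4 * (δ + tailBound Ct δ R) := by
    rw [integral_const_mul, integral_finsetSum _ fun i _ => hX.integrable_comp fun z K => F₁ i z K,
      one_div, inv_mul_le_iff₀ hN]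
    refine (Finset.sum_le_sum fun i _ => hF₁le i).trans ?_
    rw [Finset.sum_add_distrib, Finset.sum_const, ← Finset.sum_mul, Finset.sum_add_distrib,
      Finset.card_univ, nsmul_eq_mul]
    have t2 := h.tail R h.one_le_R
    have t3 := h.low
    unfold tailBound
    rw [← hNdef] at *
    linarith
  calc _ ≤ ∫ ω, (1 / N * ∑ i, F₁ i (Z ω) (H ω) + weightBound b A w R *
        (ind (B ω) * (1 / N * ∑ i, treatWeight p (Z ω) i true) +
          ind (B ω) * (1 / N * ∑ i, treatWeight p (Z ω) i false))) ∂μ :=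
        integral_mono (hbdd fun z K => 1 / N * ∑ i, totalWeight p K z i)
          (i1.add (((i2 true).add (i2 false)).const_mul _)) hpt
    _ = ∫ ω, 1 / N * ∑ i, F₁ i (Z ω) (H ω) ∂μ + weightBound b A w R *
        (∫ ω, ind (B ω) * (1 / N * ∑ i, treatWeight p (Z ω) i true) ∂μ +
          ∫ ω, ind (B ω) * (1 / N * ∑ i, treatWeight p (Z ω) i false) ∂μ) := by
        have i22 : Integrable (fun ω => ind (B ω) * (1 / N * ∑ i, treatWeight p (Z ω) i true) +
          ind (B ω) * (1 / N * ∑ i, treatWeight p (Z ω) i false)) μ := (i2 true).add (i2 false)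
        rw [integral_add i1 (i22.const_mul _)]
        congr 1
        rw [integral_const_mul, integral_add (i2 true) (i2 false)]
    _ ≤ (4 * ((R + A) * δ ^ 2) + 4 * (δ + tailBound Ct δ R)) +
        weightBound b A w R * (2 * δ + 2 * δ) :=
        add_le_add hsum (mul_le_mul_of_nonneg_left (add_le_add
          (h.integral_bad_treatWeight_le hX hB hBμ true)
          (h.integral_bad_treatWeight_le hX hB hBμ false)) hQ0)
    _ = _ := by unfold badWeightBound; ring

end Expected

/-! ### Measurability and the bias for a fixed network -/

section Measurability

lemma measurable_matrix_det {S n : Type*} [MeasurableSpace S] [Fintype n] [DecidableEq n]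
    {M : S → Matrix n n ℝ} (hM : ∀ k l, Measurable fun x => M x k l) :
    Measurable fun x => (M x).det := by
  simp only [Matrix.det_apply']
  exact Finset.measurable_fun_sum _ fun σ _ =>
    (Finset.measurable_fun_prod _ fun i _ => hM _ _).const_mul _

lemma measurable_matrix_inv_apply {S n : Type*} [MeasurableSpace S] [Fintype n] [DecidableEq n]
    {M : S → Matrix n n ℝ} (hM : ∀ k l, Measurable fun x => M x k l) (k l : n) :
    Measurable fun x => (M x)⁻¹ k l := by
  simp only [Matrix.inv_def, Matrix.smul_apply, Ring.inverse_eq_inv', smul_eq_mul,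
    Matrix.adjugate_apply]
  refine (measurable_matrix_det hM).inv.mul (measurable_matrix_det fun i j => ?_)
  simp only [Matrix.updateRow_apply]
  split_ifs
  · exact measurable_const
  · exact hM i j

lemma measurable_confusionMatrix_apply {S : Type*} [MeasurableSpace S] (N : ℕ) (p : ℝ)
    {d α β : S → ℝ} (hd : Measurable d) (hα : Measurable α) (hβ : Measurable β)
    (k l : ExposureLevel) :
    Measurable fun x => confusionMatrix N p (d x) (α x) (β x) k l := by
  cases k <;> cases l <;> simp only [confusionMatrix, Matrix.of_apply] <;> fun_prop

variable {V : Type*} [Fintype V]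

lemma measurable_mmeEstimator (p : ℝ) (G K : SimpleGraph V) (z : Finset V)
    (y : V → ExposureLevel → ℝ) (C₁ C₂ : ℝ) (k : ExposureLevel) :
    Measurable fun r : ℝ × ℝ => mmeEstimator p G K z y r.1 r.2 C₁ C₂ k := by
  have hd : ∀ i, Measurable fun r : ℝ × ℝ => estimatedDegree K r.1 r.2 i := by
    intro i
    unfold estimatedDegree
    fun_prop
  unfold mmeEstimator
  refine (Finset.measurable_fun_sum _ fun i _ => ?_).const_mul _
  refine Measurable.ite ((measurableSet_le measurable_const (hd i)).inter
    (measurableSet_lt (hd i) measurable_const)) ?_ measurable_const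
  unfold mmeNode
  simp only [Matrix.mulVec, dotProduct]
  exact Finset.measurable_fun_sum _ fun l _ => (measurable_matrix_inv_apply
    (fun k l => measurable_confusionMatrix_apply _ _ (hd i) measurable_fst measurable_snd k l)
      _ _).mul_const _

lemma IsNoisyExperiment.measurable_mmeEstimator {Ω : Type*} [MeasurableSpace Ω] {μ : Measure Ω}
    {G : SimpleGraph V} {p α β : ℝ} {Z : Ω → Finset V} {H : Ω → SimpleGraph V}
    (hX : IsNoisyExperiment μ G p α β Z H) (y : V → ExposureLevel → ℝ) {αh βh : Ω → ℝ}
    (hα : Measurable αh) (hβ : Measurable βh) (C₁ C₂ : ℝ) (k : ExposureLevel) :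
    Measurable fun ω => mmeEstimator p G (H ω) (Z ω) y (αh ω) (βh ω) C₁ C₂ k := by
  have : Finite (SimpleGraph V) := inferInstance
  intro s hs
  have : (fun ω => mmeEstimator p G (H ω) (Z ω) y (αh ω) (βh ω) C₁ C₂ k) ⁻¹' s =
      ⋃ z : Finset V, ⋃ K : SimpleGraph V, {ω | Z ω = z ∧ H ω = K} ∩
        (fun ω => mmeEstimator p G K z y (αh ω) (βh ω) C₁ C₂ k) ⁻¹' s := by
    ext ω
    simp
  rw [this]
  exact MeasurableSet.iUnion fun z => MeasurableSet.iUnion fun K =>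
    (hX.measurableSet_fiber z K).inter
      (((_root_.measurable_mmeEstimator p G K z y C₁ C₂ k).comp (hα.prodMk hβ)) hs)

end Measurability

section Bias

variable {Ω : Type*} [MeasurableSpace Ω] {μ : Measure Ω} [IsProbabilityMeasure μ]
  {V : Type*} [Fintype V] {G : SimpleGraph V} {p α β b A w Ct R δ X c : ℝ}
  {Z : Ω → Finset V} {H : Ω → SimpleGraph V} {y : V → ExposureLevel → ℝ}

/-- A bound for the bias when the estimates of the error rates are admissible. -/
noncomputable def biasBound (b A w Ct R δ X c : ℝ) : ℝ :=
  nodeErrorBound b A w Ct R δ X c + idealErrorBound b A w R δ X c +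
    (crudeBound b R X c * badWeightBound b A w Ct R δ + c * (2 * δ ^ 4))

lemma Regime.nodeErrorBound_add_le (h : Regime G p α β b A w Ct R δ) (hc : 0 ≤ c) :
    nodeErrorBound b A w Ct R δ X c + idealErrorBound b A w R δ X c ≤
      biasBound b A w Ct R δ X c := by
  have b1 := (h.bounds_nonneg X hc).1
  have hb := h.b_pos
  have hw := h.w_pos
  have hR := h.one_le_R
  have hA := h.A_nonneg
  have hδ := h.δ_pos
  have hCt := h.Ct_nonneg
  have : 0 ≤ crudeBound b R X c * badWeightBound b A w Ct R δ + c * (2 * δ ^ 4) := by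
    unfold badWeightBound tailBound weightBound
    positivity
  unfold biasBound
  linarith

/-- Existence of the expectation and the size of the bias. If the estimates of the rates are poor,
the error is still bounded by the total weights, which are uniformly integrable. -/
lemma Regime.integrable_and_abs_integral_sub_le (h : Regime G p α β b A w Ct R δ)
    (hX : IsNoisyExperiment μ G p α β Z H) (hc : ∀ i k, |y i k| ≤ c) {C₁ C₂ : ℝ}
    (hC : Cutoffs p w R X C₁ C₂) {αh βh : Ω → ℝ} (hα : Measurable αh) (hβ : Measurable βh)
    (hadm : ∀ᵐ ω ∂μ, (0 ≤ αh ω ∧ αh ω ≤ 1) ∧ (0 ≤ βh ω ∧ βh ω ≤ 1 - b))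
    (hgood : μ.real {ω | ¬ GoodRates α β δ (αh ω) (βh ω)} ≤ 2 * δ ^ 4) (t s : Bool) :
    Integrable (fun ω => mmeEstimator p G (H ω) (Z ω) y (αh ω) (βh ω) C₁ C₂ (level t s)) μ ∧
    |∫ ω, mmeEstimator p G (H ω) (Z ω) y (αh ω) (βh ω) C₁ C₂ (level t s) ∂μ -
      meanOutcome y (level t s)| ≤ biasBound b A w Ct R δ X c := by
  have hN := h.card_pos
  have hV : Nonempty V := Fintype.card_pos_iff.1 (by exact_mod_cast hN)
  have hc0 : 0 ≤ c := (abs_nonneg _).trans (hc hV.some .c11)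
  obtain ⟨b1, b2, b3, b4⟩ := h.bounds_nonneg X hc0
  set N : ℝ := (Fintype.card V : ℝ) with hNdef
  set E : Ω → ℝ := fun ω => mmeEstimator p G (H ω) (Z ω) y (αh ω) (βh ω) C₁ C₂ (level t s) with hE
  have hEm : Measurable E := hX.measurable_mmeEstimator y hα hβ C₁ C₂ _
  set B : Ω → Prop := fun ω => ¬ GoodRates α β δ (αh ω) (βh ω) with hBdef
  have hB : MeasurableSet {ω | B ω} := by
    have : MeasurableSet {ω | GoodRates α β δ (αh ω) (βh ω)} :=
      (measurableSet_le (hα.sub_const α).abs measurable_const).inter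
        (measurableSet_le (hβ.sub_const β).abs measurable_const)
    exact this.compl
  set W : Finset V → SimpleGraph V → ℝ := fun z K => 1 / N * ∑ i, totalWeight p K z i with hW
  have hcrude : ∀ᵐ ω ∂μ, |E ω - meanOutcome y (level t s)| ≤
      crudeBound b R X c * W (Z ω) (H ω) + c := by
    filter_upwards [hadm] with ω hω
    refine (h.abs_mmeEstimator_sub_le_crude hC hω.1.1 hω.1.2 (by linarith [hω.2.2])
      (by linarith [hω.2.1]) hc t s).trans (le_of_eq ?_)
    rw [← hNdef, Finset.sum_add_distrib, ← Finset.mul_sum, Finset.sum_const, Finset.card_univ,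
      nsmul_eq_mul, ← hNdef]
    simp only [hW]
    field_simp
  have hpt : ∀ᵐ ω ∂μ, |E ω - meanOutcome y (level t s)| ≤
      errorMajorant G p α β b A w R δ X c y t s (Z ω) (H ω) +
        (crudeBound b R X c * (ind (B ω) * W (Z ω) (H ω)) + c * ind (B ω)) := by
    filter_upwards [hcrude] with ω hω
    by_cases hb : B ω
    · rw [ind_of hb]
      have := h.errorMajorant_nonneg (X := X) (y := y) hc0 t s (Z ω) (H ω)
      linarith
    · rw [ind_of_not hb]
      have := h.abs_mmeEstimator_sub_le (K := H ω) (z := Z ω) hC (not_not.1 hb) hc t s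
      simp only [zero_mul, mul_zero, add_zero]
      exact this
  have iB := integrable_ind (μ := μ) hB
  have iM : Integrable (fun ω => errorMajorant G p α β b A w R δ X c y t s (Z ω) (H ω)) μ :=
    hX.integrable_comp fun z K => errorMajorant G p α β b A w R δ X c y t s z K
  have iW : Integrable (fun ω => ind (B ω) * W (Z ω) (H ω)) μ := by
    refine (hX.integrable_comp W).bdd_mul (c := 1) iB.aestronglyMeasurable
      (Eventually.of_forall fun ω => ?_)
    rw [Real.norm_of_nonneg (ind_nonneg _)]
    exact ind_le_one _
  have iR : Integrable (fun ω =>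
      crudeBound b R X c * (ind (B ω) * W (Z ω) (H ω)) + c * ind (B ω)) μ :=
    (iW.const_mul _).add (iB.const_mul _)
  have iD : Integrable (fun ω => E ω - meanOutcome y (level t s)) μ :=
    (iM.add iR).mono' (hEm.sub_const _).aestronglyMeasurable hpt
  have iE : Integrable E μ := by
    have := iD.add (integrable_const (meanOutcome y (level t s)))
    refine this.congr (Eventually.of_forall fun ω => ?_)
    simp
  refine ⟨iE, ?_⟩
  have e1 : ∫ ω, E ω ∂μ - meanOutcome y (level t s) =
      ∫ ω, (E ω - meanOutcome y (level t s)) ∂μ := by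
    rw [integral_sub iE (integrable_const _), integral_const]
    simp
  rw [e1]
  refine (abs_integral_le_integral_abs).trans ((integral_mono_ae iD.abs (iM.add iR) hpt).trans ?_)
  simp only [Pi.add_apply]
  rw [integral_add iM iR, integral_add (iW.const_mul _) (iB.const_mul _), integral_const_mul,
    integral_const_mul, integral_ind hB]
  exact add_le_add (h.integral_errorMajorant_le hX hc hC.X_le hC.four_le t s)
    (add_le_add (mul_le_mul_of_nonneg_left (h.integral_bad_totalWeight_le hX hB hgood) b1)
      (mul_le_mul_of_nonneg_left hgood hc0))

end Bias

/-! ### The Pareto law with exponential cutoff -/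

section Pareto

variable {lam ζ lo hi : ℝ}

lemma paretoCutoffWeight_pos (lam ζ : ℝ) {x : ℝ} (hx : 0 < x) : 0 < paretoCutoffWeight lam ζ x :=
  mul_pos (Real.exp_pos _) (Real.rpow_pos_of_pos hx _)

lemma continuousOn_paretoCutoffWeight (lam ζ : ℝ) {a b : ℝ} (ha : 0 < a) :
    ContinuousOn (paretoCutoffWeight lam ζ) (Set.Icc a b) := by
  unfold paretoCutoffWeight
  refine ContinuousOn.mul (by fun_prop) (ContinuousOn.rpow_const continuousOn_id fun x hx => ?_)
  exact Or.inl (ha.trans_le hx.1).ne'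

lemma intervalIntegrable_paretoCutoffWeight (lam ζ : ℝ) {a b : ℝ} (ha : 0 < a) (hab : a ≤ b) :
    IntervalIntegrable (paretoCutoffWeight lam ζ) volume a b := by
  refine ContinuousOn.intervalIntegrable ?_
  rw [Set.uIcc_of_le hab]
  exact continuousOn_paretoCutoffWeight lam ζ ha

lemma intervalIntegrable_mul_paretoCutoffWeight (lam ζ : ℝ) {a b : ℝ} (ha : 0 < a) (hab : a ≤ b) :
    IntervalIntegrable (fun x => x * paretoCutoffWeight lam ζ x) volume a b := by
  refine ContinuousOn.intervalIntegrable ?_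
  rw [Set.uIcc_of_le hab]
  exact continuousOn_id.mul (continuousOn_paretoCutoffWeight lam ζ ha)

lemma integral_exp_neg_mul_le (hlam : 0 < lam) (a b : ℝ) :
    ∫ x in a..b, Real.exp (-(lam * x)) ≤ Real.exp (-(lam * a)) / lam := by
  have h : ∀ x ∈ Set.uIcc a b, HasDerivAt (fun x => -(Real.exp (-(lam * x)) / lam))
      (Real.exp (-(lam * x))) x := by
    intro x _
    have h1 : HasDerivAt (fun x : ℝ => -(lam * x)) (-lam) x := by
      simpa using ((hasDerivAt_id x).const_mul lam).fun_neg
    have h2 := (h1.exp.div_const lam).fun_neg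
    have e : -(Real.exp (-(lam * x)) * -lam / lam) = Real.exp (-(lam * x)) := by field_simp
    rwa [e] at h2
  rw [intervalIntegral.integral_eq_sub_of_hasDerivAt h
    (Continuous.intervalIntegrable (by fun_prop) _ _)]
  have : 0 < Real.exp (-(lam * b)) / lam := by positivity
  linarith

lemma integral_paretoCutoffWeight_pos (lam ζ : ℝ) (hlo : 0 < lo) (hlt : lo < hi) :
    0 < ∫ x in lo..hi, paretoCutoffWeight lam ζ x :=
  intervalIntegral.intervalIntegral_pos_of_pos_on
    (intervalIntegrable_paretoCutoffWeight lam ζ hlo hlt.le)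
    (fun _ hx => paretoCutoffWeight_pos lam ζ (hlo.trans hx.1)) hlt

/-- The normalising constant is at least of the order `lo ^ (-ζ)`, which is the contribution of
the interval from `lo` to `2 * lo`. -/
lemma le_integral_paretoCutoffWeight (hlam : 0 < lam) (hζ : 0 < ζ) (hlo : 0 < lo)
    (h2 : 2 * lo ≤ hi) {C : ℝ} (hC : lam * lo ≤ C) :
    Real.exp (-(2 * C)) * 2 ^ (-(ζ + 1)) * lo ^ (-ζ) ≤
      ∫ x in lo..hi, paretoCutoffWeight lam ζ x := by
  have h1 : ∫ x in lo..(2 * lo), paretoCutoffWeight lam ζ x ≤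
      ∫ x in lo..hi, paretoCutoffWeight lam ζ x := by
    refine intervalIntegral.integral_mono_interval le_rfl (by linarith) h2 ?_
      (intervalIntegrable_paretoCutoffWeight lam ζ hlo (by linarith))
    filter_upwards [self_mem_ae_restrict measurableSet_Ioc] with x hx
    exact (paretoCutoffWeight_pos lam ζ (hlo.trans hx.1)).le
  have hq : ∀ x ∈ Set.Icc lo (2 * lo),
      Real.exp (-(2 * C)) * (2 * lo) ^ (-(ζ + 1)) ≤ paretoCutoffWeight lam ζ x := by
    intro x hx
    unfold paretoCutoffWeight
    refine mul_le_mul (Real.exp_le_exp.2 ?_) ?_ (by positivity) (by positivity)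
    · have := mul_le_mul_of_nonneg_left hx.2 hlam.le
      linarith
    · exact Real.rpow_le_rpow_of_nonpos (hlo.trans_le hx.1) hx.2 (by linarith)
  have h3 := intervalIntegral.integral_mono_on (by linarith : lo ≤ 2 * lo)
    (intervalIntegrable_const (c := Real.exp (-(2 * C)) * (2 * lo) ^ (-(ζ + 1))))
    (intervalIntegrable_paretoCutoffWeight lam ζ hlo (by linarith)) hq
  rw [intervalIntegral.integral_const, smul_eq_mul] at h3
  refine le_trans (le_of_eq ?_) (h3.trans h1)
  rw [Real.mul_rpow (by norm_num) hlo.le]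
  have : lo ^ (-ζ) = lo * lo ^ (-(ζ + 1)) := by
    rw [← Real.rpow_one_add' hlo.le (by linarith)]
    congr 1
    ring
  rw [this]
  ring

lemma integral_paretoCutoffWeight_tail_le (hlam : 0 < lam) (hζ : 0 < ζ) {x : ℝ} (hx : 0 < x)
    (hxhi : x ≤ hi) :
    ∫ t in x..hi, paretoCutoffWeight lam ζ t ≤
      x ^ (-(ζ + 1)) * (Real.exp (-(lam * x)) / lam) := by
  have h1 : ∫ t in x..hi, paretoCutoffWeight lam ζ t ≤
      ∫ t in x..hi, x ^ (-(ζ + 1)) * Real.exp (-(lam * t)) := by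
    refine intervalIntegral.integral_mono_on hxhi
      (intervalIntegrable_paretoCutoffWeight lam ζ hx hxhi)
      (Continuous.intervalIntegrable (by fun_prop) _ _) fun t ht => ?_
    unfold paretoCutoffWeight
    rw [mul_comm]
    exact mul_le_mul_of_nonneg_right
      (Real.rpow_le_rpow_of_nonpos hx ht.1 (by linarith)) (Real.exp_pos _).le
  rw [intervalIntegral.integral_const_mul] at h1
  exact h1.trans (mul_le_mul_of_nonneg_left (integral_exp_neg_mul_le hlam _ _) (by positivity))

lemma integral_mul_paretoCutoffWeight_tail_le (hlam : 0 < lam) (hζ : 0 < ζ) {x : ℝ} (hx : 0 < x)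
    (hxhi : x ≤ hi) :
    ∫ t in x..hi, t * paretoCutoffWeight lam ζ t ≤ x ^ (-ζ) / lam := by
  have h1 : ∫ t in x..hi, t * paretoCutoffWeight lam ζ t ≤
      ∫ t in x..hi, x ^ (-ζ) * Real.exp (-(lam * t)) := by
    refine intervalIntegral.integral_mono_on hxhi
      (intervalIntegrable_mul_paretoCutoffWeight lam ζ hx hxhi)
      (Continuous.intervalIntegrable (by fun_prop) _ _) fun t ht => ?_
    have ht0 : 0 < t := hx.trans_le ht.1
    have e : t * paretoCutoffWeight lam ζ t = t ^ (-ζ) * Real.exp (-(lam * t)) := by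
      have : t ^ (-ζ) = t * t ^ (-(ζ + 1)) := by
        rw [← Real.rpow_one_add' ht0.le (by linarith)]
        congr 1
        ring
      rw [this, paretoCutoffWeight]
      ring
    rw [e]
    exact mul_le_mul_of_nonneg_right
      (Real.rpow_le_rpow_of_nonpos hx ht.1 (by linarith)) (Real.exp_pos _).le
  rw [intervalIntegral.integral_const_mul] at h1
  refine h1.trans ?_
  rw [div_eq_mul_one_div]
  refine mul_le_mul_of_nonneg_left ((integral_exp_neg_mul_le hlam _ _).trans ?_) (by positivity)
  refine div_le_div_of_nonneg_right (Real.exp_le_one_iff.2 ?_) hlam.le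
  have := mul_pos hlam hx
  linarith

lemma le_paretoCutoffMean (lam ζ : ℝ) (hlo : 0 < lo) (hlt : lo < hi) :
    lo ≤ paretoCutoffMean lam ζ lo hi := by
  unfold paretoCutoffMean
  rw [le_div_iff₀ (integral_paretoCutoffWeight_pos lam ζ hlo hlt),
    ← intervalIntegral.integral_const_mul]
  refine intervalIntegral.integral_mono_on hlt.le
    ((intervalIntegrable_paretoCutoffWeight lam ζ hlo hlt.le).const_mul _)
    (intervalIntegrable_mul_paretoCutoffWeight lam ζ hlo hlt.le) fun x hx => ?_
  exact mul_le_mul_of_nonneg_right hx.1 (paretoCutoffWeight_pos lam ζ (hlo.trans_le hx.1)).le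

/-- If the lower bound were much smaller than `s`, so would be the mean, as long as `1 / lam` is
at most of the order `s`. -/
lemma paretoCutoffMean_le (hlam : 0 < lam) (hζ : 0 < ζ) (hlo : 0 < lo) (h2 : 2 * lo ≤ hi) {C : ℝ}
    (hC : lam * lo ≤ C) {s : ℝ} (hs : lo ≤ s) (hshi : s ≤ hi) :
    paretoCutoffMean lam ζ lo hi ≤
      s + (lo / s) ^ ζ / (lam * (Real.exp (-(2 * C)) * 2 ^ (-(ζ + 1)))) := by
  have hs0 := hlo.trans_le hs
  have hlt : lo < hi := by linarith
  have hI := le_integral_paretoCutoffWeight hlam hζ hlo h2 hC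
  have hI0 := integral_paretoCutoffWeight_pos lam ζ hlo hlt
  set I := ∫ x in lo..hi, paretoCutoffWeight lam ζ x with hIdef
  set κ := Real.exp (-(2 * C)) * 2 ^ (-(ζ + 1)) with hκ
  have hκ0 : 0 < κ := by positivity
  unfold paretoCutoffMean
  rw [← hIdef, div_le_iff₀ hI0, add_mul,
    ← intervalIntegral.integral_add_adjacent_intervals
      (intervalIntegrable_mul_paretoCutoffWeight lam ζ hlo hs)
      (intervalIntegrable_mul_paretoCutoffWeight lam ζ hs0 hshi)]
  refine add_le_add ?_ ((integral_mul_paretoCutoffWeight_tail_le hlam hζ hs0 hshi).trans ?_)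
  · have h1 : ∫ x in lo..s, x * paretoCutoffWeight lam ζ x ≤
        ∫ x in lo..s, s * paretoCutoffWeight lam ζ x := by
      refine intervalIntegral.integral_mono_on hs
        (intervalIntegrable_mul_paretoCutoffWeight lam ζ hlo hs)
        ((intervalIntegrable_paretoCutoffWeight lam ζ hlo hs).const_mul _) fun x hx => ?_
      exact mul_le_mul_of_nonneg_right hx.2 (paretoCutoffWeight_pos lam ζ (hlo.trans_le hx.1)).le
    rw [intervalIntegral.integral_const_mul] at h1
    refine h1.trans (mul_le_mul_of_nonneg_left ?_ hs0.le)
    refine intervalIntegral.integral_mono_interval le_rfl hs hshi ?_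
      (intervalIntegrable_paretoCutoffWeight lam ζ hlo hlt.le)
    filter_upwards [self_mem_ae_restrict measurableSet_Ioc] with x hx
    exact (paretoCutoffWeight_pos lam ζ (hlo.trans hx.1)).le
  · have e : s ^ (-ζ) / lam = (lo / s) ^ ζ / (lam * κ) * (κ * lo ^ (-ζ)) := by
      rw [Real.div_rpow hlo.le hs0.le, Real.rpow_neg hlo.le, Real.rpow_neg hs0.le]
      have : 0 < lo ^ ζ := by positivity
      have : 0 < s ^ ζ := by positivity
      field_simp
    rw [e]
    exact mul_le_mul_of_nonneg_left hI (by positivity)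

lemma paretoCutoffCDF_of_le (lam ζ : ℝ) {x : ℝ} (hx : x ≤ lo) :
    paretoCutoffCDF lam ζ lo hi x = 0 := by
  unfold paretoCutoffCDF
  rw [max_eq_left ((min_le_left _ _).trans hx), intervalIntegral.integral_same, zero_div]

/-- In the tail, the density is at most `lo ^ (-ζ) * exp (-(lam * x)) / x`, and the factor
`lo ^ (-ζ)` cancels against the normalising constant. -/
lemma one_sub_paretoCutoffCDF_le (hlam : 0 < lam) (hζ : 0 < ζ) (hlo : 0 < lo) (h2 : 2 * lo ≤ hi)
    {C : ℝ} (hC : lam * lo ≤ C) {x : ℝ} (hx : lo ≤ x) :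
    1 - paretoCutoffCDF lam ζ lo hi x ≤
      Real.exp (-(lam * x)) / (lam * x * (Real.exp (-(2 * C)) * 2 ^ (-(ζ + 1)))) := by
  have hx0 := hlo.trans_le hx
  have hlt : lo < hi := by linarith
  have hI := le_integral_paretoCutoffWeight hlam hζ hlo h2 hC
  have hI0 := integral_paretoCutoffWeight_pos lam ζ hlo hlt
  unfold paretoCutoffCDF
  set I := ∫ x in lo..hi, paretoCutoffWeight lam ζ x with hIdef
  set κ := Real.exp (-(2 * C)) * 2 ^ (-(ζ + 1)) with hκ
  have hκ0 : 0 < κ := by positivity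
  rcases le_total hi x with hhi | hhi
  · rw [min_eq_right hhi, max_eq_right hlt.le, div_self hI0.ne', sub_self]
    positivity
  · rw [min_eq_left hhi, max_eq_right hx, one_sub_div hI0.ne', div_le_iff₀ hI0, hIdef,
      ← intervalIntegral.integral_add_adjacent_intervals
        (intervalIntegrable_paretoCutoffWeight lam ζ hlo hx)
        (intervalIntegrable_paretoCutoffWeight lam ζ hx0 hhi), add_sub_cancel_left,
      intervalIntegral.integral_add_adjacent_intervals
        (intervalIntegrable_paretoCutoffWeight lam ζ hlo hx)
        (intervalIntegrable_paretoCutoffWeight lam ζ hx0 hhi)]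
    refine (integral_paretoCutoffWeight_tail_le hlam hζ hx0 hhi).trans ?_
    have e : x ^ (-(ζ + 1)) = x⁻¹ * x ^ (-ζ) := by
      rw [← Real.rpow_neg_one, ← Real.rpow_add hx0]
      congr 1
      ring
    calc x ^ (-(ζ + 1)) * (Real.exp (-(lam * x)) / lam)
        ≤ x⁻¹ * lo ^ (-ζ) * (Real.exp (-(lam * x)) / lam) := by
          rw [e]
          refine mul_le_mul_of_nonneg_right (mul_le_mul_of_nonneg_left
            (Real.rpow_le_rpow_of_nonpos hlo hx (by linarith)) (by positivity)) (by positivity)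
      _ = Real.exp (-(lam * x)) / (lam * x * κ) * (κ * lo ^ (-ζ)) := by field_simp
      _ ≤ _ := mul_le_mul_of_nonneg_left hI (by positivity)

end Pareto

/-! ### The fractions of vertices of small and of large degree -/

section DegreeLaw

variable {V : Type*} [Fintype V]

lemma sum_ind_le_degree (G : SimpleGraph V) (x : ℝ) [Nonempty V] :
    ∑ i, ind ((vertexDegree G i : ℝ) ≤ x) = Fintype.card V * degreeCDF G x := by
  classical
  unfold degreeCDF ind
  rw [mul_div_cancel₀ _ (by positivity), Finset.sum_boole, Nat.card_eq_fintype_card,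
    Fintype.card_subtype]

lemma sum_ind_low_le (G : SimpleGraph V) [Nonempty V] {p w : ℝ} (hp : 0 < p) :
    ∑ i, ind (p * vertexDegree G i < w) ≤ Fintype.card V * degreeCDF G (w / p) := by
  rw [← sum_ind_le_degree]
  refine Finset.sum_le_sum fun i _ => ?_
  by_cases h : p * vertexDegree G i < w
  · rw [ind_of h, ind_of]
    rw [le_div_iff₀ hp, mul_comm]
    exact h.le
  · rw [ind_of_not h]
    exact ind_nonneg _

lemma sum_ind_high_eq (G : SimpleGraph V) [Nonempty V] {p m : ℝ} (hp : 0 < p) :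
    ∑ i, ind (m < p * vertexDegree G i) = Fintype.card V * (1 - degreeCDF G (m / p)) := by
  rw [mul_sub, ← sum_ind_le_degree, mul_one, ← Finset.card_univ, Finset.cast_card,
    ← Finset.sum_sub_distrib]
  refine Finset.sum_congr rfl fun i _ => ?_
  by_cases h : m < p * vertexDegree G i
  · rw [ind_of h, ind_of_not, sub_zero]
    rw [le_div_iff₀ hp, mul_comm]
    exact not_le.2 h
  · rw [ind_of_not h, ind_of, sub_self]
    rw [le_div_iff₀ hp, mul_comm]
    exact not_lt.1 h

end DegreeLaw

section Asymptotic

variable {Nv : ℕ → ℕ} {G : ∀ n, SimpleGraph (Fin (Nv n))} {p lam dL : ℕ → ℝ} {ζ : ℝ}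

lemma eventually_le_mul_card (hp : ∀ n, 0 ≤ p n) (hNv : Tendsto Nv atTop atTop)
    (hp_large : (fun n => 1 / (Nv n : ℝ)) =o[atTop] p) (D : ℝ) :
    ∀ᶠ n in atTop, 0 < p n ∧ 0 < Nv n ∧ D ≤ p n * Nv n := by
  have hD : 0 < |D| + 1 := by positivity
  filter_upwards [hp_large.def (one_div_pos.2 hD), hNv.eventually_gt_atTop 0] with n h1 h2
  have hN : (0 : ℝ) < Nv n := by exact_mod_cast h2
  rw [Real.norm_of_nonneg (by positivity), Real.norm_of_nonneg (hp n), div_mul_eq_mul_div, one_mul,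
    div_le_div_iff₀ hN hD, one_mul] at h1
  refine ⟨?_, h2, by linarith [le_abs_self D]⟩
  refine lt_of_le_of_ne (hp n) fun h0 => ?_
  rw [← h0, zero_mul] at h1
  linarith

/-- The lower bound of the degree law is of the order `1 / p`, because the mean is, and the rate is
not much smaller than `p`. -/
lemma eventually_lower_bound (hp : ∀ n, 0 ≤ p n ∧ p n ≤ 1) (hNv : Tendsto Nv atTop atTop)
    (hinh : IsInhomogeneous Nv G lam dL ζ)
    (hlam : lam =O[atTop] p) (hlam_gt : ∀ᶠ n in atTop, p n < lam n)
    (hp_large : (fun n => 1 / (Nv n : ℝ)) =o[atTop] p)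
    (hmean : (fun n => paretoCutoffMean (lam n) ζ (dL n) ((Nv n : ℝ) - 1))
      =Θ[atTop] fun n => 1 / p n) :
    ∃ c₁ M C : ℝ, 0 < c₁ ∧ 0 < M ∧ ∀ᶠ n in atTop, c₁ ≤ p n * dL n ∧ p n * dL n ≤ M ∧
      lam n * dL n ≤ C ∧ 2 * dL n ≤ (Nv n : ℝ) - 1 := by
  obtain ⟨K, hK, hlamK⟩ := hlam.exists_pos
  obtain ⟨M, hM, hmeanM⟩ := hmean.1.exists_pos
  obtain ⟨k, hk, hmeank⟩ := hmean.2.exists_pos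
  set κ := Real.exp (-(2 * (K * M))) * 2 ^ (-(ζ + 1)) with hκ
  have hκ0 : 0 < κ := by positivity
  set τ := min 1 ((κ / (2 * k)) ^ (1 / ζ)) with hτ
  have hτ0 : 0 < τ := lt_min one_pos (by positivity)
  refine ⟨τ / (2 * k), M, K * M, by positivity, hM, ?_⟩
  filter_upwards [hlamK.bound, hmeanM.bound, hmeank.bound, hlam_gt, hinh.lower_pos,
    hinh.lower_lt, eventually_le_mul_card (fun n => (hp n).1) hNv hp_large
      (2 * M + 1 / (2 * k) + 1)] with n h1 h2 h3 h4 h5 h6 h7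
  obtain ⟨hp0, hN, hD⟩ := h7
  have hlam0 := hp0.trans h4
  have hmean_ge := le_paretoCutoffMean (lam n) ζ h5 h6
  have hp1 := (hp n).2
  rw [Real.norm_of_nonneg hlam0.le, Real.norm_of_nonneg hp0.le] at h1
  rw [Real.norm_of_nonneg (h5.le.trans hmean_ge), Real.norm_of_nonneg (by positivity)] at h2 h3
  have hlo : p n * dL n ≤ M := by
    have := mul_le_mul_of_nonneg_left (hmean_ge.trans h2) hp0.le
    have e : p n * (M * (1 / p n)) = M := by field_simp
    linarith
  have hC : lam n * dL n ≤ K * M := by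
    have e1 := mul_le_mul_of_nonneg_right h1 h5.le
    have e2 := mul_le_mul_of_nonneg_left hlo hK.le
    linarith
  have hk0 : 0 < 1 / (2 * k) := by positivity
  have h2lo : 2 * dL n ≤ (Nv n : ℝ) - 1 := by
    by_contra hlt
    have := mul_lt_mul_of_pos_left (not_le.1 hlt) hp0
    linarith
  refine ⟨?_, hlo, hC, h2lo⟩
  set s := 1 / (2 * k * p n) with hs
  have hs0 : 0 < s := by positivity
  have hps : p n * s = 1 / (2 * k) := by
    rw [hs]
    field_simp
  have hτs : τ / (2 * k) = p n * (τ * s) := by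
    rw [mul_left_comm, hps]
    ring
  rw [hτs]
  refine mul_le_mul_of_nonneg_left ?_ hp0.le
  rcases le_total s (dL n) with hsl | hsl
  · exact (mul_le_of_le_one_left hs0.le (min_le_left _ _)).trans hsl
  · have hshi : s ≤ (Nv n : ℝ) - 1 := by
      by_contra hlt
      have := mul_lt_mul_of_pos_left (not_le.1 hlt) hp0
      linarith
    have hm := paretoCutoffMean_le hlam0 hinh.shape_pos h5 h2lo hC hsl hshi
    rw [← hκ] at hm
    have e1 : 2 * s ≤ paretoCutoffMean (lam n) ζ (dL n) ((Nv n : ℝ) - 1) := by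
      have e : 2 * s = (1 / p n) / k := by
        rw [hs]
        field_simp
      rw [e, div_le_iff₀ hk]
      linarith
    have hr0 : 0 ≤ (dL n / s) ^ ζ := by positivity
    have e2 : κ / (2 * k) ≤ (dL n / s) ^ ζ := by
      have e3 : s ≤ (dL n / s) ^ ζ / (lam n * κ) := by linarith
      rw [le_div_iff₀ (by positivity)] at e3
      have e4 : s * (p n * κ) ≤ s * (lam n * κ) := by gcongr
      have e5 : s * (p n * κ) = κ / (2 * k) := by
        rw [← mul_assoc, mul_comm s, hps]
        ring
      linarith
    have e3 := Real.rpow_le_rpow (by positivity) e2 (one_div_pos.2 hinh.shape_pos).le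
    rw [← Real.rpow_mul (by positivity), mul_one_div_cancel hinh.shape_pos.ne', Real.rpow_one,
      le_div_iff₀ hs0] at e3
    exact (mul_le_mul_of_nonneg_right (min_le_right _ _) hs0.le).trans e3

/-- Few vertices have a degree much smaller than `1 / p`, and the tail of the scaled degrees is
thinner than exponential with rate one; the latter is where `p < lam` is essential. -/
lemma eventually_degree_fractions (hp : ∀ n, 0 ≤ p n ∧ p n ≤ 1) (hNv : Tendsto Nv atTop atTop)
    (hinh : IsInhomogeneous Nv G lam dL ζ)
    (hlam : lam =O[atTop] p) (hlam_gt : ∀ᶠ n in atTop, p n < lam n)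
    (hp_large : (fun n => 1 / (Nv n : ℝ)) =o[atTop] p)
    (hmean : (fun n => paretoCutoffMean (lam n) ζ (dL n) ((Nv n : ℝ) - 1))
      =Θ[atTop] fun n => 1 / p n) :
    ∃ w Ct : ℝ, 0 < w ∧ w ≤ 1 ∧ 0 ≤ Ct ∧ ∀ δ : ℝ, 0 < δ → ∀ᶠ n in atTop,
      ∑ i, ind (p n * vertexDegree (G n) i < 2 * w) ≤ Fintype.card (Fin (Nv n)) * δ ∧
      ∀ m : ℝ, 1 ≤ m → ∑ i, ind (m < p n * vertexDegree (G n) i) ≤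
        Fintype.card (Fin (Nv n)) * (δ + Ct * Real.exp (-m) / m) := by
  obtain ⟨c₁, M, C, hc₁, hM, hev⟩ :=
    eventually_lower_bound hp hNv hinh hlam hlam_gt hp_large hmean
  set κ := Real.exp (-(2 * C)) * 2 ^ (-(ζ + 1)) with hκ
  have hκ0 : 0 < κ := by positivity
  refine ⟨min 1 (c₁ / 2), 1 / κ + M * Real.exp M, lt_min one_pos (by positivity), min_le_left _ _,
    by positivity, fun δ hδ => ?_⟩
  filter_upwards [hev, hlam_gt, hinh.lower_pos, hinh.degree_law δ hδ,
    eventually_le_mul_card (fun n => (hp n).1) hNv hp_large 0] with n h1 h2 h3 h4 h5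
  obtain ⟨g1, g2, g3, g4⟩ := h1
  obtain ⟨hp0, hN, -⟩ := h5
  have hlam0 := hp0.trans h2
  have : Nonempty (Fin (Nv n)) := ⟨⟨0, hN⟩⟩
  refine ⟨(sum_ind_low_le (G n) hp0).trans (mul_le_mul_of_nonneg_left ?_ (by positivity)),
    fun m hm => ?_⟩
  · have h := h4 (2 * min 1 (c₁ / 2) / p n)
    rw [paretoCutoffCDF_of_le, sub_zero] at h
    · exact (le_abs_self _).trans h
    · rw [div_le_iff₀ hp0]
      linarith [min_le_right 1 (c₁ / 2)]
  · rw [sum_ind_high_eq (G n) hp0]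
    refine mul_le_mul_of_nonneg_left ?_ (by positivity)
    have hm0 : 0 < m := by linarith
    have h := (abs_le.1 (h4 (m / p n))).1
    have hκm : (1 / κ + M * Real.exp M) * Real.exp (-m) / m =
        Real.exp (-m) / (m * κ) + M * Real.exp (M - m) / m := by
      rw [sub_eq_add_neg, Real.exp_add]
      field_simp
    suffices 1 - paretoCutoffCDF (lam n) ζ (dL n) ((Nv n : ℝ) - 1) (m / p n) ≤
        Real.exp (-m) / (m * κ) + M * Real.exp (M - m) / m by linarith
    rcases le_total (dL n) (m / p n) with hx | hx
    · have e := one_sub_paretoCutoffCDF_le hlam0 hinh.shape_pos h3 g4 g3 hx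
      rw [← hκ] at e
      have e1 : m ≤ lam n * (m / p n) := by
        rw [← mul_div_assoc, le_div_iff₀ hp0, mul_comm]
        exact mul_le_mul_of_nonneg_right h2.le hm0.le
      have e2 : Real.exp (-(lam n * (m / p n))) / (lam n * (m / p n) * κ) ≤
          Real.exp (-m) / (m * κ) := by gcongr
      have : 0 ≤ M * Real.exp (M - m) / m := by positivity
      linarith
    -- below the lower bound of the law, `m` is bounded
    · rw [paretoCutoffCDF_of_le _ _ hx, sub_zero]
      have hmM : m ≤ M := by
        rw [div_le_iff₀ hp0] at hx
        linarith
      have e1 : 1 ≤ M * Real.exp (M - m) / m := by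
        rw [le_div_iff₀ hm0, one_mul]
        exact hmM.trans (le_mul_of_one_le_right hM.le (Real.one_le_exp (by linarith)))
      have : 0 ≤ Real.exp (-m) / (m * κ) := by positivity
      linarith

end Asymptotic

/-! ### The bounds vanish in the limit -/

section Limits

/-- The constants of the error bounds in terms of the truncation levels `R` and `X`. -/
lemma exists_bounds_le_exp {b A w c : ℝ} (hb : 0 < b) (hA : 0 ≤ A) (hw : 0 < w) (hc : 0 ≤ c) :
    ∃ C : ℝ, 0 ≤ C ∧ ∀ R X δ : ℝ, 1 ≤ R → 1 < X → X ≤ R / 8 → 0 < δ →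
      crudeBound b R X c ≤ C * Real.exp (R / 2) ∧ idealBound b A w X c ≤ C * Real.exp (R / 2) ∧
      4 * upperBound b w X c + c ≤ C * Real.exp X ∧
      weightBound b A w R ≤ C * Real.exp (R / 2) ^ 2 ∧
      lipschitzBound b A w R δ X c ≤ C * (Real.exp (R / 2) ^ 2 * δ) ∧
      4 * crudeBound b R X c + c ≤ C * Real.exp (R / 2) ∧
      7 + 3 * R + A ≤ C * Real.exp (R / 2) := by
  obtain ⟨c₃, hc₃⟩ : ∃ x, x = 3 * c * (Real.exp 2 * (1 + 4 / b)) + c := ⟨_, rfl⟩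
  obtain ⟨c₄, hc₄⟩ : ∃ x, x = 6 * c * (Real.exp (2 * A) * Real.exp 1 * (1 + 1 / (b * w))) :=
    ⟨_, rfl⟩
  obtain ⟨c₅, hc₅⟩ : ∃ x, x = 3 * c * (Real.exp 1 * (1 + 1 / (b * w))) + c := ⟨_, rfl⟩
  obtain ⟨c₆, hc₆⟩ : ∃ x, x = Real.exp (A + 2) * (1 + 1 / (b * w)) := ⟨_, rfl⟩
  obtain ⟨c₇, hc₇⟩ : ∃ x, x = 4 * ((5 + A) / b) + 2 * (2 + A) := ⟨_, rfl⟩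
  obtain ⟨c₈, hc₈⟩ : ∃ x, x = 44 * c * c₇ * (Real.exp (2 * A) * Real.exp 1) *
    (1 + 1 / (b * w)) ^ 2 := ⟨_, rfl⟩
  have p3 : 0 ≤ c₃ := by rw [hc₃]; positivity
  have p4 : 0 ≤ c₄ := by rw [hc₄]; positivity
  have p5 : 0 ≤ c₅ := by rw [hc₅]; positivity
  have p6 : 0 ≤ c₆ := by rw [hc₆]; positivity
  have p7 : 0 ≤ c₇ := by rw [hc₇]; positivity
  have p8 : 0 ≤ c₈ := by rw [hc₈]; positivity
  refine ⟨c₃ + c₄ + (4 * c₅ + c) + c₆ + c₈ + (4 * c₃ + c) + (13 + A), by positivity, ?_⟩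
  intro R X δ hR hX1 hXR hδ
  obtain ⟨S, hS⟩ : ∃ S, S = Real.exp (R / 2) := ⟨_, rfl⟩
  rw [← hS]
  have hS0 : 0 < S := hS ▸ Real.exp_pos _
  have hS1 : 1 ≤ S := hS ▸ Real.one_le_exp (by linarith)
  have hRS : R ≤ 2 * S := by
    rw [hS]
    linarith [Real.add_one_le_exp (R / 2)]
  have hAS : A ≤ A * S := le_mul_of_one_le_right hA hS1
  have hXS : Real.exp X ≤ S := hS ▸ Real.exp_le_exp.2 (by linarith)
  have hX1e : Real.exp (X + 1) = Real.exp X * Real.exp 1 := Real.exp_add _ _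
  have hX1S : Real.exp (X + 1) ≤ S * Real.exp 1 := by
    rw [hX1e]
    exact mul_le_mul_of_nonneg_right hXS (Real.exp_pos _).le
  have hbw : 0 < 1 / (b * w) := by positivity
  have hRAS : R + A ≤ (2 + A) * S := by linarith
  have q3 : crudeBound b R X c ≤ c₃ * S := by
    have e0 : Real.exp (X + 1) ^ 2 ≤ Real.exp 2 * Real.exp (R / 4) := by
      rw [← Real.exp_nat_mul, ← Real.exp_add]
      refine Real.exp_le_exp.2 ?_
      push_cast
      linarith
    have e1 : 1 + R / b ≤ (1 + 4 / b) * Real.exp (R / 4) := by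
      have h1 : R ≤ 4 * Real.exp (R / 4) := by linarith [Real.add_one_le_exp (R / 4)]
      have h2 : (1 : ℝ) ≤ Real.exp (R / 4) := Real.one_le_exp (by linarith)
      have h3 := div_le_div_of_nonneg_right h1 hb.le
      have h4 : 4 * Real.exp (R / 4) / b = 4 / b * Real.exp (R / 4) := by ring
      linarith
    have e2 : Real.exp (R / 4) * Real.exp (R / 4) = S := by
      rw [hS, ← Real.exp_add]
      congr 1
      ring
    unfold crudeBound
    calc 3 * c * (Real.exp (X + 1) ^ 2 * (1 + R / b)) + c ≤
        3 * c * ((Real.exp 2 * Real.exp (R / 4)) * ((1 + 4 / b) * Real.exp (R / 4))) + c * S := by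
          refine add_le_add (mul_le_mul_of_nonneg_left ?_ (by positivity))
            (le_mul_of_one_le_right hc hS1)
          exact mul_le_mul e0 e1 (by positivity) (by positivity)
      _ = 3 * c * (Real.exp 2 * (1 + 4 / b)) * (Real.exp (R / 4) * Real.exp (R / 4)) + c * S := by
          ring
      _ = c₃ * S := by
          rw [e2, hc₃]
          ring
  have q4 : idealBound b A w X c ≤ c₄ * S := by
    unfold idealBound
    calc _ ≤ 6 * c * (Real.exp (2 * A) * (S * Real.exp 1) * (1 + 1 / (b * w))) := by gcongr
      _ = c₄ * S := by
        rw [hc₄]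
        ring
  have q5 : 4 * upperBound b w X c + c ≤ (4 * c₅ + c) * Real.exp X := by
    have h1 : c ≤ c * Real.exp X :=
      le_mul_of_one_le_right hc (Real.one_le_exp (by linarith))
    have h2 : upperBound b w X c ≤ c₅ * Real.exp X := by
      unfold upperBound
      rw [hX1e, hc₅]
      linarith
    linarith
  have q6 : weightBound b A w R = c₆ * S ^ 2 := by
    have : Real.exp (R + A + 2) = S ^ 2 * Real.exp (A + 2) := by
      rw [hS, ← Real.exp_nat_mul, ← Real.exp_add]
      congr 1
      push_cast
      ring
    unfold weightBound
    rw [this, hc₆]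
    ring
  have q7 : paramError b A R δ ≤ c₇ * S * δ := by
    have e1 : (2 * R + A + 1) * δ / b ≤ (5 + A) / b * S * δ := by
      have : 2 * R + A + 1 ≤ (5 + A) * S := by linarith
      rw [div_mul_eq_mul_div, div_mul_eq_mul_div]
      gcongr
    have e2 : (R + A) * δ ≤ (2 + A) * S * δ := by gcongr
    unfold paramError
    rw [hc₇]
    linarith
  have q8 : lipschitzBound b A w R δ X c ≤ c₈ * (S ^ 2 * δ) := by
    unfold lipschitzBound
    have : 0 ≤ paramError b A R δ := by unfold paramError; positivity
    calc _ ≤ 44 * c * (c₇ * S * δ) * (Real.exp (2 * A) * (S * Real.exp 1)) *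
          (1 + 1 / (b * w)) ^ 2 := by gcongr
      _ = c₈ * (S ^ 2 * δ) := by
        rw [hc₈]
        ring
  have hc3S : 4 * crudeBound b R X c + c ≤ (4 * c₃ + c) * S := by
    have : c ≤ c * S := le_mul_of_one_le_right hc hS1
    linarith
  have hX0 := (Real.exp_pos X).le
  refine ⟨q3.trans ?_, q4.trans ?_, q5.trans ?_, q6.le.trans ?_, q8.trans ?_, hc3S.trans ?_,
    le_trans (by linarith : 7 + 3 * R + A ≤ (13 + A) * S) ?_⟩ <;>
  exact mul_le_mul_of_nonneg_right (by linarith) (by positivity)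

/-- All terms of the bound are of the order of a power of `exp R` times `δ`, except for the tail
contributions: the tail at `X - 1` cancels the factor `exp X` up to `1 / (X - 1)`, and the tail at
`R` beats the crude bound, which is at most of the order `exp (R / 2)`. -/
lemma biasBound_le {b A w Ct c : ℝ} (hb : 0 < b) (hA : 0 ≤ A) (hw : 0 < w) (hCt : 0 ≤ Ct)
    (hc : 0 ≤ c) : ∃ D : ℝ, 0 ≤ D ∧ ∀ R X δ : ℝ, 1 ≤ R → 1 < X → X ≤ R / 8 → 0 < δ → δ ≤ 1 →
      biasBound b A w Ct R δ X c ≤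
        D * (Real.exp (R / 2) ^ 4 * δ + 1 / Real.exp (R / 2) + 1 / (X - 1)) := by
  obtain ⟨C, hC, hbounds⟩ := exists_bounds_le_exp hb hA hw hc
  refine ⟨15 * C + 28 * C ^ 2 + 16 * C ^ 3 + 1 + 5 * Ct * C + C * (Ct * Real.exp 1) + 2 * c, by positivity, ?_⟩
  intro R X δ hR hX1 hXR hδ hδ1
  obtain ⟨q3, q4, q5, q6, q8, q9, q10⟩ := hbounds R X δ hR hX1 hXR hδ
  have hSR : Real.exp (R / 2) ^ 2 = Real.exp R := by
    rw [← Real.exp_nat_mul]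
    congr 1
    push_cast
    ring
  have hS1 : 1 ≤ Real.exp (R / 2) := Real.one_le_exp (by linarith)
  have hXS : Real.exp X ≤ Real.exp (R / 2) := Real.exp_le_exp.2 (by linarith)
  generalize Real.exp (R / 2) = S at *
  have hS0 : 0 < S := by linarith
  have hX0 : 0 < X - 1 := by linarith
  have n3 : 0 ≤ crudeBound b R X c := by unfold crudeBound; positivity
  have n4 : 0 ≤ idealBound b A w X c := by unfold idealBound; positivity
  have n5 : 0 ≤ upperBound b w X c := by unfold upperBound; positivity
  have n6 : 0 ≤ weightBound b A w R := by unfold weightBound; positivity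
  have hRA : R + A ≤ C * S := by linarith
  obtain ⟨U, hUdef⟩ : ∃ U, U = S ^ 4 * δ := ⟨_, rfl⟩
  have hU : 0 ≤ U := by rw [hUdef]; positivity
  have hpow : ∀ k j : ℕ, k ≤ 4 → 1 ≤ j → S ^ k * δ ^ j ≤ U := by
    intro k j hk hj
    rw [hUdef]
    refine mul_le_mul (pow_le_pow_right₀ hS1 hk) ?_ (by positivity) (by positivity)
    simpa using pow_le_pow_of_le_one hδ.le hδ1 hj
  have hδU : δ ≤ U := by simpa using hpow 0 1 (by norm_num) le_rfl
  have hSδU : S * δ ≤ U := by simpa using hpow 1 1 (by norm_num) le_rfl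
  have tR : tailBound Ct δ R ≤ δ + Ct * (1 / S ^ 2) := by
    unfold tailBound
    rw [mul_div_assoc, hSR, one_div, ← Real.exp_neg]
    exact add_le_add le_rfl (mul_le_mul_of_nonneg_left (div_le_self (Real.exp_pos _).le hR) hCt)
  have tX : tailBound Ct δ (X - 1) * Real.exp X =
      δ * Real.exp X + Ct * Real.exp 1 * (1 / (X - 1)) := by
    have : Real.exp (-(X - 1)) * Real.exp X = Real.exp 1 := by
      rw [← Real.exp_add]
      congr 1
      ring
    unfold tailBound
    rw [add_mul, div_mul_eq_mul_div, mul_assoc, this]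
    ring
  have tX0 : 0 ≤ tailBound Ct δ (X - 1) := by unfold tailBound; positivity
  have tR0 : 0 ≤ tailBound Ct δ R := by unfold tailBound; positivity
  have r1 : 4 * lipschitzBound b A w R δ X c ≤ 4 * C * U := by
    have := mul_le_mul_of_nonneg_left (hpow 2 1 (by norm_num) le_rfl) hC
    rw [pow_one] at this
    linarith
  have r2 : 4 * (crudeBound b R X c + 4 * idealBound b A w X c) * ((R + A) * δ ^ 2) ≤
      20 * C ^ 2 * U := by
    calc _ ≤ 4 * (C * S + 4 * (C * S)) * (C * S * δ ^ 2) := by gcongr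
      _ = 20 * C ^ 2 * (S ^ 2 * δ ^ 2) := by ring
      _ ≤ _ := mul_le_mul_of_nonneg_left (hpow 2 2 (by norm_num) (by norm_num)) (by positivity)
  have r3 : tailBound Ct δ (X - 1) * (4 * upperBound b w X c + c) ≤
      C * U + C * (Ct * Real.exp 1) * (1 / (X - 1)) := by
    have h1 : δ * Real.exp X ≤ U :=
      (mul_le_mul_of_nonneg_left hXS hδ.le).trans (by linarith)
    calc _ ≤ tailBound Ct δ (X - 1) * (C * Real.exp X) := mul_le_mul_of_nonneg_left q5 tX0
      _ = C * (tailBound Ct δ (X - 1) * Real.exp X) := by ring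
      _ ≤ _ := by
        rw [tX]
        linarith [mul_le_mul_of_nonneg_left h1 hC]
  have r4 : (δ + tailBound Ct δ R) * (4 * crudeBound b R X c + c) ≤
      2 * C * U + Ct * C * (1 / S) := by
    calc _ ≤ (δ + (δ + Ct * (1 / S ^ 2))) * (C * S) :=
          mul_le_mul (by linarith) q9 (by positivity) (by positivity)
      _ = 2 * C * (S * δ) + Ct * C * (1 / S) := by
        field_simp
        ring
      _ ≤ _ := by linarith [mul_le_mul_of_nonneg_left hSδU hC]
  have r5 : idealErrorBound b A w R δ X c ≤ (16 * C ^ 3 + 1) * U := by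
    unfold idealErrorBound
    calc _ ≤ 16 * (C * S) ^ 2 * (C * S * δ ^ 3) + U := by
          refine add_le_add ?_ (by linarith)
          gcongr
      _ = 16 * C ^ 3 * (S ^ 3 * δ ^ 3) + U := by ring
      _ ≤ 16 * C ^ 3 * U + U := add_le_add (mul_le_mul_of_nonneg_left
        (hpow 3 3 (by norm_num) (by norm_num)) (by positivity)) le_rfl
      _ = _ := by ring
  have r6 : crudeBound b R X c * badWeightBound b A w Ct R δ ≤
      (8 * C ^ 2 + 8 * C) * U + 4 * Ct * C * (1 / S) := by
    have h1 : badWeightBound b A w Ct R δ ≤ 4 * (C * S * δ ^ 2) +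
        4 * (δ + (δ + Ct * (1 / S ^ 2))) + 4 * (C * S ^ 2) * δ := by
      unfold badWeightBound
      gcongr
    calc _ ≤ C * S * (4 * (C * S * δ ^ 2) + 4 * (δ + (δ + Ct * (1 / S ^ 2))) +
          4 * (C * S ^ 2) * δ) := mul_le_mul q3 h1 (by unfold badWeightBound; positivity)
            (by positivity)
      _ = 4 * C ^ 2 * (S ^ 2 * δ ^ 2) + 8 * C * (S * δ) + 4 * C ^ 2 * (S ^ 3 * δ ^ 1) +
          4 * Ct * C * (1 / S) := by
        field_simp
        ring
      _ ≤ 4 * C ^ 2 * U + 8 * C * U + 4 * C ^ 2 * U + 4 * Ct * C * (1 / S) := by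
        refine add_le_add (add_le_add (add_le_add ?_ ?_) ?_) le_rfl
        · exact mul_le_mul_of_nonneg_left (hpow 2 2 (by norm_num) (by norm_num)) (by positivity)
        · exact mul_le_mul_of_nonneg_left hSδU (by positivity)
        · exact mul_le_mul_of_nonneg_left (hpow 3 1 (by norm_num) le_rfl) (by positivity)
      _ = _ := by ring
  have r7 : c * (2 * δ ^ 4) ≤ 2 * c * U := by
    have := mul_le_mul_of_nonneg_left (hpow 0 4 (by norm_num) (by norm_num)) hc
    rw [pow_zero, one_mul] at this
    linarith
  have hS' : 0 ≤ 1 / S := by positivity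
  have hX' : 0 ≤ 1 / (X - 1) := by positivity
  have hE : 0 ≤ C * (Ct * Real.exp 1) := by positivity
  have hCC : 0 ≤ Ct * C := by positivity
  rw [← hUdef]
  generalize 1 / S = s at *
  generalize 1 / (X - 1) = x at *
  generalize C * (Ct * Real.exp 1) = e at *
  unfold biasBound nodeErrorBound
  have t1 : 0 ≤ Ct * C * U := by positivity
  have t2 : 0 ≤ e * U := by positivity
  have t3 : 0 ≤ (15 * C + 28 * C ^ 2 + 16 * C ^ 3 + 1 + e + 2 * c) * s := by positivity
  have t4 : 0 ≤ (15 * C + 28 * C ^ 2 + 16 * C ^ 3 + 1 + 5 * Ct * C + 2 * c) * x := by positivity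
  linarith

/-- The error level that belongs to the truncation level `R`. -/
noncomputable def errorLevel (R : ℝ) : ℝ := Real.exp (-R ^ 2)

lemma errorLevel_pos (R : ℝ) : 0 < errorLevel R := Real.exp_pos _

lemma errorLevel_le_one (R : ℝ) : errorLevel R ≤ 1 :=
  Real.exp_le_one_iff.2 (by have := sq_nonneg R; linarith)

/-- The error level beats all exponentials. -/
lemma tendsto_exp_mul_errorLevel (k : ℝ) :
    Tendsto (fun R => Real.exp (k * R) * errorLevel R) atTop (𝓝 0) := by
  have h : (fun R => Real.exp (k * R) * errorLevel R) = fun R => Real.exp (-(R * (R - k))) := by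
    ext R
    rw [errorLevel, ← Real.exp_add]
    congr 1
    ring
  rw [h]
  exact Real.tendsto_exp_neg_atTop_nhds_zero.comp
    (tendsto_id.atTop_mul_atTop₀ (tendsto_atTop_add_const_right _ _ tendsto_id))

lemma tendsto_errorLevel : Tendsto errorLevel atTop (𝓝 0) := by
  simpa using tendsto_exp_mul_errorLevel 0

lemma tendsto_paramError (b A : ℝ) :
    Tendsto (fun R => paramError b A R (errorLevel R)) atTop (𝓝 0) := by
  have h1 : Tendsto (fun R => R * errorLevel R) atTop (𝓝 0) := by
    refine squeeze_zero' ?_ ?_ (tendsto_exp_mul_errorLevel 1)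
    · filter_upwards [eventually_ge_atTop 0] with R hR
      exact mul_nonneg hR (errorLevel_pos R).le
    · filter_upwards with R
      refine mul_le_mul_of_nonneg_right ?_ (errorLevel_pos R).le
      linarith [Real.add_one_le_exp (1 * R)]
  have h2 : (fun R => paramError b A R (errorLevel R)) = fun R =>
      (8 / b + 2) * (R * errorLevel R) + (4 * (A + 1) / b + 2 * A) * errorLevel R := by
    ext R
    unfold paramError
    ring
  rw [h2]
  simpa using (h1.const_mul (8 / b + 2)).add (tendsto_errorLevel.const_mul (4 * (A + 1) / b + 2 * A))

lemma tendsto_biasBound {b A w Ct c : ℝ} (hb : 0 < b) (hA : 0 ≤ A) (hw : 0 < w) (hCt : 0 ≤ Ct)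
    (hc : 0 ≤ c) {R X : ℕ → ℝ} (hR : Tendsto R atTop atTop) (hX : Tendsto X atTop atTop)
    (hXR : ∀ᶠ n in atTop, X n ≤ R n / 8) :
    Tendsto (fun n => max 0 (biasBound b A w Ct (R n) (errorLevel (R n)) (X n) c)) atTop (𝓝 0) := by
  obtain ⟨D, hD, h⟩ := biasBound_le hb hA hw hCt hc
  have h1 : Tendsto (fun R : ℝ => Real.exp (R / 2) ^ 4 * errorLevel R) atTop (𝓝 0) := by
    refine (tendsto_exp_mul_errorLevel 2).congr fun R => ?_
    rw [← Real.exp_nat_mul]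
    congr 2
    push_cast
    ring
  have h2 : Tendsto (fun R : ℝ => 1 / Real.exp (R / 2)) atTop (𝓝 0) := by
    simp only [one_div]
    exact tendsto_inv_atTop_zero.comp (Real.tendsto_exp_atTop.comp
      (tendsto_id.atTop_div_const (by norm_num)))
  have h3 : Tendsto (fun X : ℝ => 1 / (X - 1)) atTop (𝓝 0) := by
    simp only [one_div]
    exact tendsto_inv_atTop_zero.comp (tendsto_atTop_add_const_right _ _ tendsto_id)
  have h4 := (((h1.comp hR).add (h2.comp hR)).add (h3.comp hX)).const_mul D
  simp only [add_zero, mul_zero] at h4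
  refine squeeze_zero' (Eventually.of_forall fun n => le_max_left _ _) ?_ h4
  filter_upwards [hR.eventually_ge_atTop 1, hX.eventually_gt_atTop 1, hXR] with n e1 e2 e3
  refine max_le ?_ (h _ _ _ e1 e2 e3 (errorLevel_pos _) (errorLevel_le_one _))
  have : 0 < X n - 1 := by linarith
  have := (errorLevel_pos (R n)).le
  simp only [Function.comp_apply]
  positivity

/-- If a property holds eventually for every fixed parameter, then it holds eventually along some
parameter that grows slowly enough. -/
lemma exists_tendsto_eventually {f : ℕ → ℕ → Prop} (h : ∀ m, ∀ᶠ n in atTop, f m n) :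
    ∃ r : ℕ → ℕ, Tendsto r atTop atTop ∧ ∀ᶠ n in atTop, f (r n) n := by
  choose N hN using fun m => eventually_atTop.1 (h m)
  classical
  refine ⟨fun n => Nat.findGreatest (fun m => N m ≤ n) n, ?_, ?_⟩
  · refine tendsto_atTop.2 fun m => ?_
    filter_upwards [eventually_ge_atTop m, eventually_ge_atTop (N m)] with n h1 h2
    exact Nat.le_findGreatest h1 h2
  · filter_upwards [eventually_ge_atTop (N 0)] with n hn
    exact hN _ _ (Nat.findGreatest_spec (P := fun m => N m ≤ n) (Nat.zero_le n) hn)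

end Limits

/-! ### Choice of the truncation levels and of the cutoffs -/

section Sequences

variable {Nv : ℕ → ℕ} {G : ∀ n, SimpleGraph (Fin (Nv n))} {p α β lam dL : ℕ → ℝ} {ζ : ℝ}
  {Ω : ℕ → Type*} [∀ n, MeasurableSpace (Ω n)] {μ : ∀ n, Measure (Ω n)}
  [∀ n, IsProbabilityMeasure (μ n)]

/-- For a fixed error level, consistent estimates of the rates are eventually good with high
probability. -/
lemma eventually_real_not_goodRates_le {αh βh : ∀ n, Ω n → ℝ}
    (hαh : IsConsistent μ (fun n ω => αh n ω / α n) fun _ => 1) (hβh : IsConsistent μ βh β)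
    (hα : ∀ᶠ n in atTop, 0 < α n) {δ : ℝ} (hδ : 0 < δ) :
    ∀ᶠ n in atTop, (μ n).real {ω | ¬ GoodRates (α n) (β n) δ (αh n ω) (βh n ω)} ≤ 2 * δ ^ 4 := by
  have hδ4 : 0 < δ ^ 4 := by positivity
  filter_upwards [(hαh _ hδ4).eventually_le_const hδ4, (hβh _ hδ4).eventually_le_const hδ4, hα]
    with n h1 h2 h3
  refine le_trans ?_ ((measureReal_union_le _ _).trans ((add_le_add h1 h2).trans (by linarith)))
  refine measureReal_mono fun ω hω => ?_
  by_contra hn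
  simp only [Set.mem_union, Set.mem_ofPred_eq, not_or, not_le] at hn
  refine hω ⟨?_, hn.2.le⟩
  have e : αh n ω / α n - 1 = (αh n ω - α n) / α n := by field_simp
  have := hn.1.le
  rwa [e, abs_div, abs_of_pos h3, div_le_iff₀ h3] at this

lemma eventually_card_sq_sub_pairs_le
    (hcommon : (fun n => (pairsWithoutCommonNeighbor (G n) : ℝ))
      ~[atTop] fun n => (Nv n : ℝ) ^ 2) {ε : ℝ} (hε : 0 < ε) :
    ∀ᶠ n in atTop, (Nv n : ℝ) ^ 2 - pairsWithoutCommonNeighbor (G n) ≤ ε * (Nv n : ℝ) ^ 2 := by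
  filter_upwards [hcommon.isLittleO.def hε] with n h
  simp only [Pi.sub_apply, Real.norm_eq_abs] at h
  rw [abs_of_nonneg (sq_nonneg (Nv n : ℝ))] at h
  linarith [neg_abs_le ((pairsWithoutCommonNeighbor (G n) : ℝ) - (Nv n : ℝ) ^ 2)]

/-- Along truncation levels that grow slowly enough, the quantitative assumptions hold, and the
estimates of the rates are good with high probability. -/
lemma exists_regime (hp : ∀ n, 0 ≤ p n ∧ p n ≤ 1) (hα : ∀ n, 0 ≤ α n) (hβ : ∀ n, 0 ≤ β n ∧ β n ≤ 1)
    (hNv : Tendsto Nv atTop atTop)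
    (hinh : IsInhomogeneous Nv G lam dL ζ)
    (hlam : lam =Θ[atTop] p) (hlam_gt : ∀ᶠ n in atTop, p n < lam n)
    (hp_small : p =o[atTop] fun _ => (1 : ℝ))
    (hp_large : (fun n => 1 / (Nv n : ℝ)) =o[atTop] p)
    (hmean : (fun n => paretoCutoffMean (lam n) ζ (dL n) ((Nv n : ℝ) - 1))
      =Θ[atTop] fun n => 1 / p n)
    (hcommon : (fun n => (pairsWithoutCommonNeighbor (G n) : ℝ))
      ~[atTop] fun n => (Nv n : ℝ) ^ 2)
    (hβ_rate : (fun _ => (1 : ℝ)) =O[atTop] fun n => 1 - β n)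
    (hα_rate : α =Θ[atTop] fun n => 1 / (p n * Nv n))
    (hα_small : α =o[atTop] p)
    {αh βh : ∀ n, Ω n → ℝ}
    (hαh : IsConsistent μ (fun n ω => αh n ω / α n) fun _ => 1) (hβh : IsConsistent μ βh β) :
    ∃ (w Ct A b₀ : ℝ) (R : ℕ → ℝ), 0 < w ∧ 0 ≤ Ct ∧ 0 ≤ A ∧ 0 < b₀ ∧ (∀ n, 1 ≤ R n) ∧
      Tendsto R atTop atTop ∧ (∀ᶠ n in atTop,
        (μ n).real {ω | ¬ GoodRates (α n) (β n) (errorLevel (R n)) (αh n ω) (βh n ω)} ≤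
          2 * errorLevel (R n) ^ 4) ∧
      ∀ b : ℝ, 0 < b → b ≤ b₀ → ∀ᶠ n in atTop,
        Regime (G n) (p n) (α n) (β n) b A w Ct (R n) (errorLevel (R n)) := by
  obtain ⟨w, Ct, hw, hw1, hCt, hdeg⟩ :=
    eventually_degree_fractions hp hNv hinh hlam.1 hlam_gt hp_large hmean
  obtain ⟨A, hA, hαA⟩ := hα_rate.1.exists_pos
  obtain ⟨A', hA', hαA'⟩ := hα_rate.2.exists_pos
  obtain ⟨B, hB, hβB⟩ := hβ_rate.exists_pos
  have hp0 := eventually_le_mul_card (fun n => (hp n).1) hNv hp_large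
  have hαpos : ∀ᶠ n in atTop, 0 < α n := by
    filter_upwards [hαA'.bound, hp0 0] with n h1 h2
    obtain ⟨g1, g2, -⟩ := h2
    have hN : (0 : ℝ) < Nv n := by exact_mod_cast g2
    refine lt_of_le_of_ne (hα n) fun h0 => ?_
    rw [← h0, norm_zero, mul_zero] at h1
    exact absurd h1 (not_le.2 (norm_pos_iff.2 (by positivity)))
  have hα1 : α =o[atTop] fun _ => (1 : ℝ) := hα_small.trans hp_small
  have hstep : ∀ m : ℕ, ∀ᶠ n in atTop, (p n ≤ errorLevel (m + 1) ^ 4 ∧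
      α n ≤ errorLevel (m + 1) ^ 4 ∧ 1 ≤ errorLevel (m + 1) ^ 4 * (p n * Nv n)) ∧
      (∑ i, ind (p n * vertexDegree (G n) i < 2 * w) ≤
          Fintype.card (Fin (Nv n)) * errorLevel (m + 1) ∧
        ∀ x : ℝ, 1 ≤ x → ∑ i, ind (x < p n * vertexDegree (G n) i) ≤
          Fintype.card (Fin (Nv n)) * (errorLevel (m + 1) + Ct * Real.exp (-x) / x)) ∧
      (Nv n : ℝ) ^ 2 - pairsWithoutCommonNeighbor (G n) ≤
        errorLevel (m + 1) ^ 4 * (Nv n : ℝ) ^ 2 ∧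
      (μ n).real {ω | ¬ GoodRates (α n) (β n) (errorLevel (m + 1)) (αh n ω) (βh n ω)} ≤
        2 * errorLevel (m + 1) ^ 4 := by
    intro m
    have hδ := errorLevel_pos (m + 1)
    have hδ4 : 0 < errorLevel (m + 1) ^ 4 := by positivity
    refine Eventually.and ?_ ((hdeg _ hδ).and
      ((eventually_card_sq_sub_pairs_le hcommon hδ4).and
        (eventually_real_not_goodRates_le hαh hβh hαpos hδ)))
    filter_upwards [hp_small.def hδ4, hα1.def hδ4, hp0 (1 / errorLevel (m + 1) ^ 4)]
      with n h1 h2 h3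
    rw [norm_one, mul_one, Real.norm_of_nonneg (hp n).1] at h1
    rw [norm_one, mul_one, Real.norm_of_nonneg (hα n)] at h2
    refine ⟨h1, h2, ?_⟩
    have := h3.2.2
    rwa [div_le_iff₀ hδ4, mul_comm] at this
  obtain ⟨r, hr, hev⟩ := exists_tendsto_eventually hstep
  have hR : Tendsto (fun n => (r n : ℝ) + 1) atTop atTop :=
    tendsto_atTop_add_const_right _ _ (tendsto_natCast_atTop_atTop.comp hr)
  refine ⟨w, Ct, A, 1 / (4 * B), fun n => r n + 1, hw, hCt, hA.le, by positivity,
    fun n => by linarith [(Nat.cast_nonneg (r n) : (0 : ℝ) ≤ r n)], hR,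
    hev.mono fun n h => h.2.2.2, fun b hb hb₀ => ?_⟩
  filter_upwards [hev, hp0 0, hαA.bound, hβB.bound,
    (tendsto_errorLevel.comp hR).eventually_le_const (by norm_num : (0 : ℝ) < 1 / 4),
    (tendsto_errorLevel.comp hR).eventually_le_const hb,
    ((tendsto_paramError b A).comp hR).eventually_le_const hw] with n h1 h2 h3 h4 h5 h6 h7
  obtain ⟨⟨g1, g2, g3⟩, ⟨g4, g5⟩, g6, -⟩ := h1
  obtain ⟨hpos, hN, -⟩ := h2
  have hN' : (0 : ℝ) < Nv n := by exact_mod_cast hN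
  refine
    { p_pos := hpos
      p_le := g1
      δ_pos := errorLevel_pos _
      δ_le := h5
      δ_le_b := h6
      b_le := ?_
      β_nonneg := (hβ n).1
      α_nonneg := hα n
      α_le := g2
      A_nonneg := hA.le
      α_mul_le := ?_
      one_le := by simpa using g3
      one_le_R := by linarith [(Nat.cast_nonneg (r n) : (0 : ℝ) ≤ r n)]
      w_pos := hw
      w_le := hw1
      error_le := h7
      Ct_nonneg := hCt
      low := g4
      tail := g5
      pairs := by simpa using g6 }
  · rw [norm_one, Real.norm_of_nonneg (by linarith [(hβ n).2])] at h4
    rw [le_div_iff₀ (by positivity)] at hb₀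
    by_contra hlt
    have := mul_lt_mul_of_pos_left (not_le.1 hlt) hB
    linarith
  · rw [Real.norm_of_nonneg (hα n), Real.norm_of_nonneg (by positivity), mul_one_div,
      le_div_iff₀ (by positivity)] at h3
    rw [Fintype.card_fin]
    linarith

end Sequences

theorem theorem5
    -- the networks, the rates, and the potential outcomes
    (Nv : ℕ → ℕ) (G : ∀ n, SimpleGraph (Fin (Nv n)))
    (p α β lam dL : ℕ → ℝ) (ζ c : ℝ)
    (y : ∀ n, Fin (Nv n) → ExposureLevel → ℝ)
    -- the random treatment assignment and the random observed network
    {Ω : ℕ → Type*} [∀ n, MeasurableSpace (Ω n)] (μ : ∀ n, Measure (Ω n))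
    [∀ n, IsProbabilityMeasure (μ n)]
    (Z : ∀ n, Ω n → Finset (Fin (Nv n))) (H : ∀ n, Ω n → SimpleGraph (Fin (Nv n)))
    (hp : ∀ n, 0 ≤ p n ∧ p n ≤ 1) (hα : ∀ n, 0 ≤ α n ∧ α n ≤ 1) (hβ : ∀ n, 0 ≤ β n ∧ β n ≤ 1)
    (hexp : ∀ n, IsNoisyExperiment (μ n) (G n) (p n) (α n) (β n) (Z n) (H n))
    -- large graphs
    (hNv : Tendsto Nv atTop atTop)
    -- inhomogeneous setting, with `λ = Θ(p)` and `λ > p`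
    (hinh : IsInhomogeneous Nv G lam dL ζ)
    (hlam : lam =Θ[atTop] p) (hlam_gt : ∀ᶠ n in atTop, p n < lam n)
    -- `p = o(1)`, `p = ω(1/N_v)`, mean degree `Θ(1/p)`, few common neighbours, bounded outcomes
    (hp_small : p =o[atTop] fun _ => (1 : ℝ))
    (hp_large : (fun n => 1 / (Nv n : ℝ)) =o[atTop] p)
    (hmean : (fun n => paretoCutoffMean (lam n) ζ (dL n) ((Nv n : ℝ) - 1))
      =Θ[atTop] fun n => 1 / p n)
    (hcommon : (fun n => (pairsWithoutCommonNeighbor (G n) : ℝ))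
      ~[atTop] fun n => (Nv n : ℝ) ^ 2)
    (hy : ∀ n i k, |y n i k| ≤ c)
    -- `1 - β = Ω(1)`, `α = Θ(1/(p N_v))`, `α = o(p)`
    (hβ_rate : (fun _ => (1 : ℝ)) =O[atTop] fun n => 1 - β n)
    (hα_rate : α =Θ[atTop] fun n => 1 / (p n * Nv n))
    (hα_small : α =o[atTop] p)
    -- consistent estimators of `α` and `β` (for `α → 0`: of the rate `α`, so `α̂ / α → 1`)
    (αh βh : ∀ n, Ω n → ℝ) (hαh_meas : ∀ n, Measurable (αh n)) (hβh_meas : ∀ n, Measurable (βh n))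
    (hαh : IsConsistent μ (fun n ω => αh n ω / α n) fun _ => 1)
    (hβh : IsConsistent μ βh β) :
    -- for all cutoffs `C₁ = o(1/p)`, `C₂ = ω(1/p)` that separate the degrees of order `1/p`
    -- from those of order `o(1/p)` and `ω(1/p)` slowly enough
    ∃ L₁ L₂ : ℕ → ℝ, (∀ n, 0 < L₁ n) ∧ Tendsto (fun n => L₁ n * p n) atTop (𝓝 0) ∧
      Tendsto (fun n => L₂ n * p n) atTop atTop ∧
      ∀ C₁ C₂ : ℕ → ℝ, (∀ n, L₁ n ≤ C₁ n) → Tendsto (fun n => C₁ n * p n) atTop (𝓝 0) →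
        (∀ n, C₂ n ≤ L₂ n) → Tendsto (fun n => C₂ n * p n) atTop atTop →
        ∀ k : ExposureLevel,
          IsConsistent μ
            (fun n ω => mmeEstimator (p n) (G n) (H n ω) (Z n ω) (y n) (αh n ω) (βh n ω)
              (C₁ n) (C₂ n) k)
            (fun n => meanOutcome (y n) k) ∧
          -- unbiasedness, when the estimates are probabilities and `1 - β̂ = Ω(1)` like `1 - β`
          ((∃ b : ℝ, 0 < b ∧ ∀ᶠ n in atTop, ∀ᵐ ω ∂(μ n),
              (0 ≤ αh n ω ∧ αh n ω ≤ 1) ∧ (0 ≤ βh n ω ∧ βh n ω ≤ 1 - b)) →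
            IsAsymptoticallyUnbiased μ
              (fun n ω => mmeEstimator (p n) (G n) (H n ω) (Z n ω) (y n) (αh n ω) (βh n ω)
                (C₁ n) (C₂ n) k)
              (fun n => meanOutcome (y n) k)) := by
  have hc : 0 ≤ c := by
    obtain ⟨n, hn⟩ := (hNv.eventually_gt_atTop 0).exists
    exact (abs_nonneg _).trans (hy n ⟨0, hn⟩ .c11)
  obtain ⟨w, Ct, A, b₀, R, hw, hCt, hA, hb₀, hR1, hR, hgood, hreg⟩ :=
    exists_regime hp (fun n => (hα n).1) hβ hNv hinh hlam hlam_gt hp_small hp_large hmean hcommon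
      hβ_rate hα_rate hα_small hαh hβh
  have hp0 : ∀ᶠ n in atTop, 0 < p n :=
    (eventually_le_mul_card (fun n => (hp n).1) hNv hp_large 0).mono fun n h => h.1
  have hR0 : ∀ n, 0 < R n := fun n => one_pos.trans_le (hR1 n)
  -- the value of `L₁` where `p` vanishes only has to be positive
  refine ⟨fun n => if 0 < p n then 1 / (R n * p n) else 1, fun n => R n / (8 * p n),
    fun n => ?_, ?_, ?_, ?_⟩
  · have := hR0 n
    beta_reduce
    split_ifs <;> positivity
  · refine Tendsto.congr' ?_ (tendsto_inv_atTop_zero.comp hR)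
    filter_upwards [hp0] with n hn
    have := (hR0 n).ne'
    simp only [Function.comp_apply, if_pos hn]
    field_simp
  · refine Tendsto.congr' ?_ (hR.atTop_div_const (by norm_num : (0 : ℝ) < 8))
    filter_upwards [hp0] with n hn
    field_simp
  intro C₁ C₂ hC₁ hC₁0 hC₂ hC₂0 k
  obtain ⟨t, s, rfl⟩ := exists_level k
  have hXR : ∀ᶠ n in atTop, C₂ n * p n ≤ R n / 8 := by
    filter_upwards [hp0] with n hn
    have := hC₂ n
    rw [le_div_iff₀ (by positivity)] at this
    linarith
  have hcut : ∀ᶠ n in atTop, Cutoffs (p n) w (R n) (C₂ n * p n) (C₁ n) (C₂ n) := by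
    filter_upwards [hp0, hXR, hC₁0.eventually_le_const hw, hC₂0.eventually_ge_atTop 4]
      with n hn h1 h2 h3
    refine ⟨?_, by linarith, mul_comm _ _, h3, by linarith [hR0 n]⟩
    have h4 := hC₁ n
    simp only [if_pos hn] at h4
    have h5 := mul_le_mul_of_nonneg_left h4 hn.le
    have := (hR0 n).ne'
    have e : p n * (1 / (R n * p n)) = 1 / R n := by field_simp
    linarith
  have hδ4 : Tendsto (fun n => 2 * errorLevel (R n) ^ 4) atTop (𝓝 0) := by
    simpa using ((tendsto_errorLevel.comp hR).pow 4).const_mul 2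
  refine ⟨fun ε hε => ?_, ?_⟩
  · have hbias := tendsto_biasBound hb₀ hA hw hCt hc hR hC₂0 hXR
    have hlim := hδ4.add (hbias.div_const ε)
    rw [zero_div, add_zero] at hlim
    refine squeeze_zero' (Eventually.of_forall fun n => measureReal_nonneg) ?_ hlim
    filter_upwards [hreg b₀ hb₀ le_rfl, hgood, hcut] with n h1 h2 h3
    refine (h1.real_error_ge_le (hexp n) (hy n) h3 (αh n) (βh n) t s hε).trans
      (add_le_add h2 (div_le_div_of_nonneg_right (le_trans ?_ (le_max_right _ _)) hε.le))
    exact h1.nodeErrorBound_add_le hc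
  · rintro ⟨b', hb', hadm⟩
    have hb : 0 < min b₀ b' := lt_min hb₀ hb'
    have hbias := tendsto_biasBound hb hA hw hCt hc hR hC₂0 hXR
    have hall : ∀ᶠ n in atTop, Integrable (fun ω => mmeEstimator (p n) (G n) (H n ω) (Z n ω) (y n)
          (αh n ω) (βh n ω) (C₁ n) (C₂ n) (level t s)) (μ n) ∧
        |(∫ ω, mmeEstimator (p n) (G n) (H n ω) (Z n ω) (y n)
          (αh n ω) (βh n ω) (C₁ n) (C₂ n) (level t s) ∂(μ n)) - meanOutcome (y n) (level t s)| ≤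
        biasBound (min b₀ b') A w Ct (R n) (errorLevel (R n)) (C₂ n * p n) c := by
      filter_upwards [hreg _ hb (min_le_left _ _), hgood, hcut, hadm] with n h1 h2 h3 h4
      refine h1.integrable_and_abs_integral_sub_le (hexp n) (hy n) h3 (hαh_meas n) (hβh_meas n)
        ?_ h2 t s
      filter_upwards [h4] with ω hω
      exact ⟨hω.1, hω.2.1, hω.2.2.trans (by linarith [min_le_right b₀ b'])⟩
    refine ⟨hall.mono fun n h => h.1, squeeze_zero_norm' ?_ hbias⟩
    exact hall.mono fun n h => h.2.trans (le_max_right _ _)
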